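/- Let $k \ge 2$ be fixed. For a $k$-uniform hypergraph $H$ with vertex set $V$, $|V| = n$, and $m$ hyperedges, let $T_k(H)$ be the number of $k$-simplices in $H$, i.e. of sets $X \subseteq V$ with $|X| = k+1$ all of whose $k$-element subsets are hyperedges of $H$. The hyperedges of $H$ are presented, each exactly once and in arbitrary order, as a stream over the vertex set $V = \{1,\dots,n\}$. **Theorem.** There are constants $C, c$ depending only on $k$ such that for all $n$, all thresholds $T > 0$, all $\varepsilon \in (0,1]$ and all $\delta \in (0,1)$ there is a randomized 2-pass streaming algorithm (which may depend on $k, n, T, \varepsilon, \delta$, but not on $H$ or $m$) with the following guarantee. For every $n$-vertex $k$-uniform hypergraph $H$ with $T_k(H) \ge T$ and every stream of its $m$ hyperedges, the algorithm outputs a number $\widetilde T$ with $$\Pr\big[(1-\varepsilon)\,T_k(H) \le \widetilde T \le (1+\varepsilon)\,T_k(H)\big] \ge 1-\delta,$$ and it runs in $\widetilde O\big(m/T^{2/(k+2)}\big)$ space: at all times its memory, including any stored random bits, holds at most $$C\,\varepsilon^{-2}\,\log(2/\delta)\,(\log n)^c \cdot \frac{m}{T^{2/(k+2)}}$$ bits.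 -/

import Mathlib

/-- Every hyperedge has exactly `k` vertices. -/
def Hypergraph.IsKUniform {V : Type*} (H : Hypergraph V) (k : ℕ) : Prop :=
  ∀ e ∈ H.edgeSet, e.ncard = k

/-- The vertex sets of the `k`-simplices of `H`: the `(k+1)`-sets of vertices all of whose
`k`-element subsets are hyperedges. -/
def Hypergraph.simplices {V : Type*} (H : Hypergraph V) (k : ℕ) : Set (Set V) :=
  {X | X ⊆ H.vertexSet ∧ X.ncard = k + 1 ∧ ∀ e ⊆ X, e.ncard = k → e ∈ H.edgeSet}

/-- `T_k(H)`, the number of `k`-simplices of `H`. -/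
noncomputable def Hypergraph.simplexCount {V : Type*} (H : Hypergraph V) (k : ℕ) : ℕ :=
  (H.simplices k).ncard

/-- The list `σ` presents the hyperedges of `H`, each exactly once, in some order. -/
def Hypergraph.IsEdgeStream {V : Type*} (H : Hypergraph V) (σ : List (Set V)) : Prop :=
  σ.Nodup ∧ ∀ e, e ∈ σ ↔ e ∈ H.edgeSet

/-- A randomized streaming algorithm that makes `p` passes over a stream of symbols from `α`.
The content of its memory is a state, held as the bit string `code s`. Reading a symbol during
pass `i` replaces the state `s` by a random one, distributed as `step i x s`, with randomness that
is fresh in every step: whatever is to be reused later (random bits, counters, the seed of a hash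
function) has to be kept in the state. The output is determined by the final state. -/
structure StreamingAlgorithm (α : Type) (p : ℕ) where
  State : Type
  code : State → List Bool
  code_injective : Function.Injective code
  init : PMF State
  step : Fin p → α → State → PMF State
  output : State → ℝ

namespace StreamingAlgorithm

/-- Everything that is read in `p` passes over `σ`, each symbol with the index of its pass. -/
def reads {α : Type} (p : ℕ) (σ : List α) : List (Fin p × α) :=
  (List.finRange p).flatMap fun i => σ.map fun x => (i, x)

/-- The distribution of the state after reading the given symbols from the state `s`. -/
noncomputable def runFrom {α : Type} {p : ℕ} (A : StreamingAlgorithm α p) :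
    A.State → List (Fin p × α) → PMF A.State
  | s, [] => PMF.pure s
  | s, r :: rs => (A.step r.1 r.2 s).bind fun s' => A.runFrom s' rs

/-- The distribution of the state after reading the given symbols from the start. -/
noncomputable def run {α : Type} {p : ℕ} (A : StreamingAlgorithm α p)
    (rs : List (Fin p × α)) : PMF A.State :=
  A.init.bind fun s => A.runFrom s rs

/-- On the stream `σ`, whatever the random choices, the memory never holds more than `B` bits
at any moment of the `p` passes. -/
def RunsInSpace {α : Type} {p : ℕ} (A : StreamingAlgorithm α p) (σ : List α) (B : ℝ) : Prop :=
  ∀ rs, rs <+: reads p σ → ∀ s ∈ (A.run rs).support, ((A.code s).length : ℝ) ≤ B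

/-- On the stream `σ`, the output lies in `[(1 - ε) Q, (1 + ε) Q]` with probability at least
`1 - δ`. -/
def IsEstimate {α : Type} {p : ℕ} (A : StreamingAlgorithm α p) (σ : List α)
    (ε δ Q : ℝ) : Prop :=
  ENNReal.ofReal (1 - δ) ≤
    (A.run (reads p σ)).toOuterMeasure {s | (1 - ε) * Q ≤ A.output s ∧ A.output s ≤ (1 + ε) * Q}

end StreamingAlgorithm

/-! Put `h = T^(2/(k+2))`, so that `h^(k+2) = T^2` and the space bound is `m / h` up to factors in
`ε`, `δ` and `log n`: an edge may be stored with probability about `1 / h`. Simplices are found in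
two ways, one for simplices with a set of vertices that lies in many others, one for the rest.

Heavy sets. A `j`-set `J` is heavy if roughly `h^(k+1-j)` or more of the simplices still under
consideration contain it. For `j = k, k-1, …, r+1`, where `r = ⌊k/2⌋`, the simplices with a heavy
`j`-subset are counted and then removed (`survivors`). If vertices are sampled with probability
about `1 / h` and all edges with a sampled vertex are stored, one sees the simplices `X ⊇ J` whose
vertices outside `J` are all sampled; their number, rescaled, estimates the number of simplices at
`J`. Sets larger than `j` are light by then, which bounds the variance by a constant times `codegree
J * h^(k+1-j)`, and so by a constant times `(codegree J)^2` if `J` is heavy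
(`ave_sq_sampled_sub_le`, `ave_abs_heavyFound_sub_le`). The same estimator at constant accuracy,
with a majority vote, decides which sets are heavy (`prob_not_allGood_le`). For `j = k` the heavy
set is itself an edge that need not be stored; the second pass supplies it when it arrives
(`sum_arrivalCount`).

Light simplices. What remains has at most `2 h^(k+1-i)` members around any set of `i > r` vertices.
Write `k + 1 = 2r + a` with `a ∈ {1, 2}`, colour all `r`-sets with about `ν = h^(1/a)` colours, and
count the simplices all of whose windows of `r` consecutive vertices have one colour. Every face
contains at least `a + 1` windows, so it suffices to store the edges with `a + 1` `r`-subsets of one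
colour, which has probability `O(ν^(-a)) = O(1/h)`. Two simplices with `i > r` common vertices share
at most `i - r + 1` windows, which costs a factor of about `ν^(i-r)`; since `ν^(i-r) h^(k+1-i) ≤ T`,
the variance is `O(T)` times the number of light simplices (`ave_sq_colored_sub_le`).

Memory. The space bound must hold with certainty and `m` is unknown, so a copy gives up when it
stores more than `κ j` edges among the first `j`; a harmonic sum shows that this is rare
(`prob_overflow_le`). The random functions are too long to be stored. There are only finitely many
streams, however, so polynomially many fixed choices of these functions suffice and only an index is
kept; the median of independent copies reaches the confidence `1 - δ` (`exists_streamingAlgorithm`).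
-/

/-- The average of `f` over a finite type. -/
noncomputable def ave {Ω : Type*} [Fintype Ω] (f : Ω → ℝ) : ℝ :=
  (∑ ω, f ω) / Fintype.card Ω

open Classical in
/-- The fraction of the elements of a finite type that satisfy `p`. -/
noncomputable def prob {Ω : Type*} [Fintype Ω] (p : Ω → Prop) : ℝ :=
  ave fun ω => if p ω then 1 else 0

/-! ### Averages and probabilities on a finite sample space -/

section Average

variable {Ω Ω' : Type*} [Fintype Ω] [Fintype Ω']

theorem ave_add (f g : Ω → ℝ) : ave (fun ω => f ω + g ω) = ave f + ave g := by
  simp [ave, Finset.sum_add_distrib, add_div]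

theorem ave_sub (f g : Ω → ℝ) : ave (fun ω => f ω - g ω) = ave f - ave g := by
  simp [ave, Finset.sum_sub_distrib, sub_div]

theorem ave_const_mul (c : ℝ) (f : Ω → ℝ) : ave (fun ω => c * f ω) = c * ave f := by
  simp [ave, ← Finset.mul_sum, mul_div_assoc]

theorem ave_const [Nonempty Ω] (c : ℝ) : ave (fun _ : Ω => c) = c := by
  simp [ave]

theorem ave_sum {ι : Type*} (s : Finset ι) (f : ι → Ω → ℝ) :
    ave (fun ω => ∑ i ∈ s, f i ω) = ∑ i ∈ s, ave (f i) := by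
  simp only [ave]
  rw [Finset.sum_comm, Finset.sum_div]

theorem ave_mono {f g : Ω → ℝ} (h : ∀ ω, f ω ≤ g ω) : ave f ≤ ave g := by
  unfold ave
  gcongr with ω
  exact h ω

theorem ave_nonneg {f : Ω → ℝ} (h : ∀ ω, 0 ≤ f ω) : 0 ≤ ave f :=
  div_nonneg (Finset.sum_nonneg fun ω _ => h ω) (Nat.cast_nonneg _)

theorem ave_le_const [Nonempty Ω] {f : Ω → ℝ} {c : ℝ} (h : ∀ ω, f ω ≤ c) : ave f ≤ c :=
  (ave_mono h).trans_eq (ave_const c)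

theorem ave_equiv (φ : Ω ≃ Ω') (f : Ω' → ℝ) : ave (fun ω => f (φ ω)) = ave f := by
  simp only [ave]
  rw [φ.sum_comp, Fintype.card_congr φ]

theorem ave_prod (f : Ω × Ω' → ℝ) : ave f = ave fun a => ave fun b => f (a, b) := by
  simp only [ave]
  rw [← Finset.sum_div, Fintype.sum_prod_type, Fintype.card_prod, Nat.cast_mul, div_div, mul_comm]

theorem prob_mono {p q : Ω → Prop} (h : ∀ ω, p ω → q ω) : prob p ≤ prob q := by
  classical
  refine ave_mono fun ω => ?_
  by_cases hp : p ω
  · simp [hp, h ω hp]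
  · simp only [hp, if_false]; split_ifs <;> norm_num

theorem prob_nonneg (p : Ω → Prop) : 0 ≤ prob p :=
  ave_nonneg fun ω => by split_ifs <;> norm_num

theorem prob_or_le (p q : Ω → Prop) : prob (fun ω => p ω ∨ q ω) ≤ prob p + prob q := by
  classical
  unfold prob
  rw [← ave_add]
  refine ave_mono fun ω => ?_
  by_cases hp : p ω <;> by_cases hq : q ω <;> simp [hp, hq]

theorem prob_exists_le {ι : Type*} (s : Finset ι) (p : ι → Ω → Prop) :
    prob (fun ω => ∃ i ∈ s, p i ω) ≤ ∑ i ∈ s, prob (p i) := by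
  classical
  unfold prob
  rw [← ave_sum]
  refine ave_mono fun ω => ?_
  split_ifs with h
  · obtain ⟨i, hi, hp⟩ := h
    calc (1 : ℝ) = if p i ω then 1 else 0 := by simp [hp]
      _ ≤ _ := Finset.single_le_sum (f := fun i => if p i ω then (1 : ℝ) else 0)
        (fun j _ => by split_ifs <;> norm_num) hi
  · exact Finset.sum_nonneg fun j _ => by split_ifs <;> norm_num

theorem prob_exists_le_of_le {ι : Type*} (s : Finset ι) (p : ι → Ω → Prop) (β : ℝ)
    (h : ∀ i ∈ s, prob (p i) ≤ β) : prob (fun ω => ∃ i ∈ s, p i ω) ≤ s.card * β :=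
  (prob_exists_le s p).trans ((Finset.sum_le_sum h).trans_eq (by simp))

theorem prob_not [Nonempty Ω] (p : Ω → Prop) : prob (fun ω => ¬ p ω) = 1 - prob p := by
  classical
  unfold prob
  rw [eq_sub_iff_add_eq, ← ave_add]
  refine Eq.trans ?_ (ave_const (Ω := Ω) 1)
  congr 1; ext ω
  by_cases hp : p ω <;> simp [hp]

/-- Markov's inequality. -/
theorem prob_le_ave_div {f : Ω → ℝ} (hf : ∀ ω, 0 ≤ f ω) {c : ℝ} (hc : 0 < c) :
    prob (fun ω => c ≤ f ω) ≤ ave f / c := by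
  classical
  rw [le_div_iff₀ hc, mul_comm]
  unfold prob
  rw [← ave_const_mul]
  refine ave_mono fun ω => ?_
  split_ifs with h
  · simpa using h
  · simpa using hf ω

/-- Chebyshev's inequality. -/
theorem prob_abs_sub_le {f : Ω → ℝ} {μ c : ℝ} (hc : 0 < c) :
    prob (fun ω => c ≤ |f ω - μ|) ≤ ave (fun ω => (f ω - μ) ^ 2) / c ^ 2 := by
  refine le_trans (prob_mono fun ω h => ?_) (prob_le_ave_div (fun ω => sq_nonneg _) (by positivity))
  rw [← sq_abs (f ω - μ)]
  gcongr

theorem ave_sq_le [Nonempty Ω] (f : Ω → ℝ) : ave f ^ 2 ≤ ave fun ω => f ω ^ 2 := by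
  have h : 0 ≤ ave fun ω => (f ω - ave f) ^ 2 := ave_nonneg fun ω => sq_nonneg _
  have : (ave fun ω => (f ω - ave f) ^ 2) = ave (fun ω => f ω ^ 2) - ave f ^ 2 := by
    have : (fun ω => (f ω - ave f) ^ 2)
        = fun ω => f ω ^ 2 - (2 * ave f * f ω - ave f ^ 2) := by
      ext ω; ring
    rw [this, ave_sub, ave_sub, ave_const_mul, ave_const]; ring
  linarith

theorem ave_abs_le [Nonempty Ω] (f : Ω → ℝ) {v : ℝ} (h : (ave fun ω => f ω ^ 2) ≤ v) :
    (ave fun ω => |f ω|) ≤ √v := by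
  refine Real.le_sqrt_of_sq_le ((ave_sq_le _).trans ?_)
  simpa using h

theorem prob_prod_le [Nonempty Ω] (p : Ω × Ω' → Prop) (β : ℝ)
    (h : ∀ a, prob (fun b => p (a, b)) ≤ β) : prob p ≤ β := by
  unfold prob
  rw [ave_prod]
  exact ave_le_const h

theorem prob_fst [Nonempty Ω'] (p : Ω → Prop) : prob (fun x : Ω × Ω' => p x.1) = prob p := by
  classical
  unfold prob
  rw [ave_prod]
  exact congrArg ave (funext fun a => ave_const (Ω := Ω') (if p a then 1 else 0))

theorem prob_snd [Nonempty Ω] (p : Ω' → Prop) : prob (fun x : Ω × Ω' => p x.2) = prob p := by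
  classical
  unfold prob
  rw [ave_prod]
  exact ave_const (Ω := Ω) (ave fun b => if p b then 1 else 0)

theorem prob_eq_card (p : Ω → Prop) [DecidablePred p] :
    prob p = ((Finset.univ.filter p).card : ℝ) / Fintype.card Ω := by
  unfold prob ave
  beta_reduce
  rw [← Finset.sum_boole]
  congr!

end Average

/-! ### Independence: averages over product spaces -/

section AveragePi

variable {ι Ω : Type*} [Fintype ι] [DecidableEq ι] [Fintype Ω]

theorem ave_pi_prod (f : ι → Ω → ℝ) :
    ave (fun ω : ι → Ω => ∏ i, f i (ω i)) = ∏ i, ave (f i) := by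
  simp only [ave, Finset.prod_div_distrib]
  rw [Finset.prod_univ_sum]
  simp

theorem ave_pi_apply [Nonempty Ω] (i : ι) (f : Ω → ℝ) :
    ave (fun ω : ι → Ω => f (ω i)) = ave f := by
  have := ave_pi_prod (fun j : ι => if j = i then f else fun _ => 1)
  simp only [apply_ite ave, ave_const, Finset.prod_ite_eq', Finset.mem_univ, if_true] at this
  rw [← this]
  congr 1; ext ω
  rw [Finset.prod_eq_single i] <;> simp +contextual

theorem ave_pi_apply_mul [Nonempty Ω] {i j : ι} (hij : i ≠ j) (f g : Ω → ℝ) :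
    ave (fun ω : ι → Ω => f (ω i) * g (ω j)) = ave f * ave g := by
  have := ave_pi_prod (fun l : ι => if l = i then f else if l = j then g else fun _ => 1)
  have e : ∀ (F : ι → ℝ), (∀ l, l ≠ i → l ≠ j → F l = 1) → ∏ l, F l = F i * F j := by
    intro F hF
    rw [← Finset.prod_pair hij]
    refine (Finset.prod_subset (Finset.subset_univ _) fun l _ hl => ?_).symm
    simp only [Finset.mem_insert, Finset.mem_singleton, not_or] at hl
    exact hF l hl.1 hl.2
  rw [e _ (fun l h1 h2 => by simp [h1, h2, ave_const])] at this
  simp only [if_true, hij.symm, if_false] at this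
  rw [← this]
  congr 1; ext ω
  rw [e _ (fun l h1 h2 => by simp [h1, h2])]
  simp [hij.symm]

/-- The average of `M` independent copies has an `M`-th of the variance. -/
theorem ave_sq_mean_sub_le [Nonempty Ω] (M : ℕ) (hM : 0 < M) (Y : Ω → ℝ) (μ v : ℝ)
    (hμ : ave Y = μ) (hv : (ave fun ω => (Y ω - μ) ^ 2) ≤ v) :
    (ave fun ω : Fin M → Ω => ((∑ i, Y (ω i)) / M - μ) ^ 2) ≤ v / M := by
  have hM' : (0 : ℝ) < M := by exact_mod_cast hM
  have h0 : ave (fun ω => Y ω - μ) = 0 := by rw [ave_sub, ave_const, hμ, sub_self]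
  have key : (fun ω : Fin M → Ω => ((∑ i, Y (ω i)) / M - μ) ^ 2)
      = fun ω => (1 / (M : ℝ) ^ 2) * ∑ i, ∑ j, (Y (ω i) - μ) * (Y (ω j) - μ) := by
    ext ω
    rw [← Finset.sum_mul_sum, Finset.sum_sub_distrib]
    simp only [Finset.sum_const, Finset.card_univ, Fintype.card_fin, nsmul_eq_mul]
    field_simp
  rw [key, ave_const_mul, ave_sum]
  have : ∀ i : Fin M, (ave fun ω : Fin M → Ω => ∑ j, (Y (ω i) - μ) * (Y (ω j) - μ)) ≤ v := by
    intro i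
    rw [ave_sum, Finset.sum_eq_single i]
    · rw [ave_pi_apply i (fun x => (Y x - μ) * (Y x - μ))]
      simpa [sq] using hv
    · intro j _ hj
      rw [ave_pi_apply_mul hj.symm (fun x => Y x - μ) (fun x => Y x - μ), h0, zero_mul]
    · simp
  calc _ ≤ (1 / (M : ℝ) ^ 2) * ∑ i : Fin M, v := by gcongr with i; exact this i
    _ = v / M := by
      simp only [Finset.sum_const, Finset.card_univ, Fintype.card_fin, nsmul_eq_mul]
      field_simp

/-- Chernoff's bound: events of probability at most `a / 4` rarely make up a fraction `a` of `R`
independent trials. -/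
theorem prob_card_ge_le [Nonempty Ω] (R : ℕ) (p : Ω → Prop) [DecidablePred p] (a : ℝ)
    (hp : prob p ≤ a / 4) :
    prob (fun ω : Fin R → Ω => a * R ≤ ((Finset.univ.filter fun i => p (ω i)).card : ℝ))
      ≤ Real.exp (-(a * R / 2)) := by
  have e1 : ∀ ω : Fin R → Ω,
      (∏ i, if p (ω i) then Real.exp 1 else 1)
        = Real.exp ((Finset.univ.filter fun i => p (ω i)).card : ℝ) := by
    intro ω
    rw [Finset.prod_ite]
    simp [← Real.exp_nat_mul]
  have e2 := ave_pi_prod (fun (_ : Fin R) (x : Ω) => if p x then Real.exp 1 else 1)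
  simp only [e1] at e2
  have e3 : (ave fun x : Ω => if p x then Real.exp 1 else 1) = 1 + (Real.exp 1 - 1) * prob p := by
    unfold prob
    rw [← ave_const_mul]
    rw [← sub_eq_iff_eq_add', ← ave_const (Ω := Ω) 1, ← ave_sub, ave_const]
    congr 1; ext x
    by_cases hx : p x <;> simp [hx]
  -- Each factor is `1 + (e - 1) p ≤ 1 + 2 (a / 4) ≤ e^(a/2)`, so half of the exponent `a * R`
  -- survives Markov's inequality.
  have e4 : (ave fun x : Ω => if p x then Real.exp 1 else 1) ≤ Real.exp (a / 2) := by
    rw [e3]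
    have h1 : Real.exp 1 - 1 ≤ 2 := by have := Real.exp_one_lt_d9; linarith
    have h2 := prob_nonneg p
    calc _ ≤ 1 + 2 * prob p := by gcongr
      _ ≤ a / 2 + 1 := by linarith
      _ ≤ _ := Real.add_one_le_exp _
  have e0 : 0 ≤ (ave fun x : Ω => if p x then Real.exp 1 else 1) :=
    ave_nonneg fun x => by split_ifs <;> positivity
  have e5 : (ave fun ω : Fin R → Ω => Real.exp ((Finset.univ.filter fun i => p (ω i)).card : ℝ))
      ≤ Real.exp (a * R / 2) := by
    rw [e2, Finset.prod_const, Finset.card_univ, Fintype.card_fin]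
    calc _ ≤ Real.exp (a / 2) ^ R := by gcongr
      _ = _ := by rw [← Real.exp_nat_mul]; congr 1; ring
  calc _ ≤ prob (fun ω : Fin R → Ω => Real.exp (a * R)
          ≤ Real.exp ((Finset.univ.filter fun i => p (ω i)).card : ℝ)) :=
        prob_mono fun ω h => Real.exp_le_exp.2 h
    _ ≤ _ := prob_le_ave_div (fun ω => (Real.exp_pos _).le) (Real.exp_pos _)
    _ ≤ Real.exp (a * R / 2) / Real.exp (a * R) := by gcongr
    _ = _ := by rw [← Real.exp_sub]; congr 1; ring

/-- Resampling one coordinate of a uniform point of a product leaves it uniform. This is how the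
oracle of one level is treated as fresh, given those of all other levels. -/
theorem ave_pi_update [Nonempty Ω] (d : ι) (f : (ι → Ω) → ℝ) :
    ave f = ave fun ω => ave fun x => f (Function.update ω d x) := by
  have h1 : ∀ (F : (ι → Ω) → ℝ), ave F
      = ave fun x : Ω => ave fun y : {j // j ≠ d} → Ω => F ((Equiv.funSplitAt d Ω).symm (x, y)) := by
    intro F
    rw [← ave_prod fun z => F ((Equiv.funSplitAt d Ω).symm z), ave_equiv]
  have h2 : ∀ (x x' : Ω) (y : {j // j ≠ d} → Ω),
      Function.update ((Equiv.funSplitAt d Ω).symm (x', y)) d x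
        = (Equiv.funSplitAt d Ω).symm (x, y) := by
    intro x x' y
    ext j
    by_cases hj : j = d
    · subst hj; simp [Equiv.funSplitAt, Equiv.piSplitAt]
    · simp [Equiv.funSplitAt, Equiv.piSplitAt, hj]
  conv_rhs => rw [h1]
  simp only [h2, ave_const]
  rw [h1, ← ave_prod fun z : Ω × _ => f ((Equiv.funSplitAt d Ω).symm z),
    ← ave_equiv (Equiv.prodComm _ _), ave_prod]
  rfl

theorem prob_pi_update_le [Nonempty Ω] (d : ι) (p : (ι → Ω) → Prop) (β : ℝ)
    (h : ∀ ω, prob (fun x => p (Function.update ω d x)) ≤ β) : prob p ≤ β := by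
  unfold prob
  rw [ave_pi_update d]
  exact ave_le_const h

theorem prob_pi_apply [Nonempty Ω] (i : ι) (p : Ω → Prop) :
    prob (fun ω : ι → Ω => p (ω i)) = prob p :=
  ave_pi_apply i (fun x => @ite ℝ (p x) (Classical.propDecidable _) 1 0)

end AveragePi

/-! ### Prefix codes, which turn states into bit strings of controlled length -/

/-- An encoding by bit strings in which no code word is a proper prefix of another. -/
structure PrefixCode (α : Type*) where
  enc : α → List Bool
  inj : ∀ a b r r', enc a ++ r = enc b ++ r' → a = b ∧ r = r'

namespace PrefixCode

variable {α β : Type*}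

theorem injective (c : PrefixCode α) : Function.Injective c.enc := fun a b h =>
  (c.inj a b [] [] (by simpa using h)).1

/-- The code of `f a` as a code of `a`. -/
def comap (c : PrefixCode β) (f : α → β) (hf : Function.Injective f) : PrefixCode α where
  enc a := c.enc (f a)
  inj _ _ _ _ h := ⟨hf (c.inj _ _ _ _ h).1, (c.inj _ _ _ _ h).2⟩

/-- A bit is its own code. -/
def bool : PrefixCode Bool where
  enc b := [b]
  inj _ _ _ _ h := by simpa using h

/-- Pairs are coded by concatenation. -/
def prod (c : PrefixCode α) (d : PrefixCode β) : PrefixCode (α × β) where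
  enc x := c.enc x.1 ++ d.enc x.2
  inj a b r r' h := by
    rw [List.append_assoc, List.append_assoc] at h
    obtain ⟨h1, h2⟩ := c.inj _ _ _ _ h
    obtain ⟨h3, h4⟩ := d.inj _ _ _ _ h2
    exact ⟨Prod.ext h1 h3, h4⟩

/-- The code of a list: every entry is announced by the bit `true`, the end by `false`. -/
def listEnc (c : PrefixCode α) : List α → List Bool
  | [] => [false]
  | x :: l => true :: (c.enc x ++ listEnc c l)

/-- Lists of coded objects. -/
def list (c : PrefixCode α) : PrefixCode (List α) where
  enc := c.listEnc
  inj a := by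
    induction a with
    | nil =>
      intro b r r' h
      cases b with
      | nil => simpa [listEnc] using h
      | cons y l => simp [listEnc] at h
    | cons x l ih =>
      intro b r r' h
      cases b with
      | nil => simp [listEnc] at h
      | cons y l' =>
        simp only [listEnc, List.cons_append, List.append_assoc, List.cons.injEq, true_and] at h
        obtain ⟨h1, h2⟩ := c.inj _ _ _ _ h
        obtain ⟨h3, h4⟩ := ih _ _ _ h2
        exact ⟨by rw [h1, h3], h4⟩

theorem length_list (c : PrefixCode α) (l : List α) :
    (c.list.enc l).length = (l.map fun x => (c.enc x).length + 1).sum + 1 := by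
  change (c.listEnc l).length = _
  induction l with
  | nil => rfl
  | cons x l ih => simp [listEnc, ih]; omega

theorem length_list_le (c : PrefixCode α) (l : List α) (b : ℕ)
    (h : ∀ x ∈ l, (c.enc x).length ≤ b) : (c.list.enc l).length ≤ l.length * (b + 1) + 1 := by
  rw [length_list]
  have := List.sum_le_card_nsmul (l.map fun x => (c.enc x).length + 1) (b + 1) (by
    intro y hy
    obtain ⟨x, hx, rfl⟩ := List.mem_map.1 hy
    have := h x hx
    omega)
  simpa using this

/-- Natural numbers through their binary digits. -/
def nat : PrefixCode ℕ :=
  bool.list.comap Nat.bits fun a b h => by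
    rw [← Nat.ofDigits_digits 2 a, ← Nat.ofDigits_digits 2 b, Nat.digits_two_eq_bits,
      Nat.digits_two_eq_bits, h]

theorem length_nat (m : ℕ) : (nat.enc m).length = 2 * m.size + 1 := by
  change (bool.list.enc m.bits).length = _
  rw [length_list, ← Nat.size_eq_bits_len]
  simp [bool, mul_comm]

/-- Finite sets as lists of their elements. -/
noncomputable def finset (c : PrefixCode α) : PrefixCode (Finset α) :=
  c.list.comap Finset.toList fun a b h => by
    ext x
    rw [← Finset.mem_toList, h, Finset.mem_toList]

theorem length_finset_le (c : PrefixCode α) (s : Finset α) (b : ℕ)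
    (h : ∀ x ∈ s, (c.enc x).length ≤ b) : (c.finset.enc s).length ≤ s.card * (b + 1) + 1 := by
  refine (c.length_list_le s.toList b (by simpa using h)).trans ?_
  simp

/-- Optional objects as lists of length at most one. -/
def option (c : PrefixCode α) : PrefixCode (Option α) :=
  c.list.comap Option.toList fun a b h => by
    cases a <;> cases b <;> simp_all

/-- Vectors as lists. -/
def vec (c : PrefixCode α) (R : ℕ) : PrefixCode (Fin R → α) :=
  c.list.comap List.ofFn List.ofFn_injective

theorem length_vec_le (c : PrefixCode α) {R : ℕ} (v : Fin R → α) (b : ℕ)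
    (h : ∀ i, (c.enc (v i)).length ≤ b) : ((c.vec R).enc v).length ≤ R * (b + 1) + 1 := by
  refine (c.length_list_le (List.ofFn v) b (by simpa [List.mem_ofFn] using h)).trans ?_
  simp

end PrefixCode

/-! ### Medians, and the existence of short lists of seeds -/

open Classical in
/-- A median of a finite family of real numbers. -/
noncomputable def median {R : ℕ} (v : Fin R → ℝ) : ℝ :=
  if h : ∃ y, R ≤ 2 * (Finset.univ.filter fun j => v j ≤ y).card ∧
      R ≤ 2 * (Finset.univ.filter fun j => y ≤ v j).card then h.choose else 0

/-- The smallest `v i` such that at least half of the family is `≤ v i` works: the largest value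
strictly below it, if any, has fewer than half of the family at or below it. -/
theorem exists_median {R : ℕ} (hR : 0 < R) (v : Fin R → ℝ) :
    ∃ y, R ≤ 2 * (Finset.univ.filter fun j => v j ≤ y).card ∧
      R ≤ 2 * (Finset.univ.filter fun j => y ≤ v j).card := by
  have : Nonempty (Fin R) := ⟨⟨0, hR⟩⟩
  set S := Finset.univ.filter fun i : Fin R =>
    R ≤ 2 * (Finset.univ.filter fun j => v j ≤ v i).card with hS
  have hne : S.Nonempty := by
    obtain ⟨i, -, hi⟩ := Finset.exists_max_image Finset.univ v Finset.univ_nonempty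
    refine ⟨i, ?_⟩
    rw [hS, Finset.mem_filter, Finset.filter_true_of_mem (fun j _ => hi j (Finset.mem_univ j))]
    simp; omega
  obtain ⟨i, hi, hmin⟩ := Finset.exists_min_image S v hne
  refine ⟨v i, (Finset.mem_filter.1 hi).2, ?_⟩
  have hsplit := Finset.card_filter_add_card_filter_not (s := (Finset.univ : Finset (Fin R)))
    (fun j => v i ≤ v j)
  simp only [not_le, Finset.card_univ, Fintype.card_fin] at hsplit
  rcases (Finset.univ.filter fun j => v j < v i).eq_empty_or_nonempty with h | h
  · rw [h] at hsplit; simp at hsplit; omega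
  · obtain ⟨j, hj, hmax⟩ := Finset.exists_max_image _ v h
    have hjS : j ∉ S := fun hjS => absurd (hmin j hjS) (not_le.2 (Finset.mem_filter.1 hj).2)
    have h1 : ¬ R ≤ 2 * (Finset.univ.filter fun l => v l ≤ v j).card := fun h' =>
      hjS (Finset.mem_filter.2 ⟨Finset.mem_univ _, h'⟩)
    have h2 : (Finset.univ.filter fun l => v l < v i).card
        ≤ (Finset.univ.filter fun l => v l ≤ v j).card :=
      Finset.card_le_card fun l hl => by
        simp only [Finset.mem_filter, Finset.mem_univ, true_and]
        exact hmax l hl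
    omega

/-- At least half of the values lie at or below the median and at least half at or above it, so a
strict majority inside `[lo, hi]` has a member on each side. -/
theorem median_mem {R : ℕ} (v : Fin R → ℝ) {lo hi : ℝ} [DecidablePred fun i => ¬ (lo ≤ v i ∧ v i ≤ hi)]
    (h : 2 * (Finset.univ.filter fun i => ¬ (lo ≤ v i ∧ v i ≤ hi)).card < R) :
    lo ≤ median v ∧ median v ≤ hi := by
  have hex := exists_median (by omega) v
  have hm : median v = hex.choose := dif_pos hex
  obtain ⟨h1, h2⟩ := hex.choose_spec
  rw [← hm] at h1 h2
  have key : ∀ (P : Fin R → Prop) [DecidablePred P], R ≤ 2 * (Finset.univ.filter P).card →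
      ∃ i, P i ∧ lo ≤ v i ∧ v i ≤ hi := by
    intro P _ hP
    by_contra hcon
    push Not at hcon
    have := Finset.card_le_card (show Finset.univ.filter P
      ⊆ Finset.univ.filter fun i => ¬ (lo ≤ v i ∧ v i ≤ hi) from fun i hi' => by
        simp only [Finset.mem_filter, Finset.mem_univ, true_and] at hi' ⊢
        exact fun h => absurd h.2 (not_le.2 (hcon i hi' h.1)))
    omega
  obtain ⟨i, hi1, hi2, -⟩ := key _ h1
  obtain ⟨j, hj1, -, hj2⟩ := key _ h2
  exact ⟨hi2.trans hi1, hj1.trans hj2⟩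

/-- Few seeds suffice: for finitely many events of small probability there is a short list of
elements that meets each of them rarely. -/
theorem exists_seeds {Ω I : Type*} [Fintype Ω] [Nonempty Ω] [Fintype I] (bad : I → Ω → Prop)
    (hbad : ∀ i, prob (bad i) ≤ 1 / 32) (t : ℕ) (ht : 16 * Real.log (Fintype.card I) < t) :
    ∃ seed : Fin t → Ω, ∀ i, prob (fun j => bad i (seed j)) ≤ 1 / 8 := by
  classical
  rcases isEmpty_or_nonempty I with hI | hI
  · exact ⟨fun _ => Classical.arbitrary Ω, fun i => hI.elim i⟩
  have hc : (0 : ℝ) < Fintype.card I := by exact_mod_cast Fintype.card_pos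
  -- Probabilistic method: a random list is bad for a given event with probability at most
  -- `e^(-t/16)`, which is less than `1 / |I|`.
  have h1 : prob (fun ω : Fin t → Ω => ∃ i ∈ (Finset.univ : Finset I),
      (1 / 8 : ℝ) * t ≤ ((Finset.univ.filter fun j => bad i (ω j)).card : ℝ)) < 1 := by
    refine (prob_exists_le_of_le Finset.univ _ (Real.exp (-(1 / 8 * t / 2))) fun i _ =>
      prob_card_ge_le t (bad i) (1 / 8) ((hbad i).trans (by norm_num))).trans_lt ?_
    rw [Finset.card_univ]
    calc (Fintype.card I : ℝ) * Real.exp (-(1 / 8 * t / 2))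
        < Fintype.card I * Real.exp (-Real.log (Fintype.card I)) := by gcongr; linarith
      _ = 1 := by rw [Real.exp_neg, Real.exp_log hc, mul_inv_cancel₀ hc.ne']
  have h2 : ∃ ω : Fin t → Ω, ¬ ∃ i ∈ (Finset.univ : Finset I),
      (1 / 8 : ℝ) * t ≤ ((Finset.univ.filter fun j => bad i (ω j)).card : ℝ) := by
    by_contra hcon
    push Not at hcon
    have : (1 : ℝ) ≤ prob (fun ω : Fin t → Ω => ∃ i ∈ (Finset.univ : Finset I),
      (1 / 8 : ℝ) * t ≤ ((Finset.univ.filter fun j => bad i (ω j)).card : ℝ)) := by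
      conv_lhs => rw [← ave_const (Ω := Fin t → Ω) 1]
      exact ave_mono fun ω => by rw [if_pos (hcon ω)]
    linarith
  obtain ⟨ω, hω⟩ := h2
  push Not at hω
  refine ⟨ω, fun i => ?_⟩
  have h3 := hω i (Finset.mem_univ i)
  rw [prob_eq_card, Fintype.card_fin]
  have ht0 : (0 : ℝ) < t := lt_of_le_of_lt
    (mul_nonneg (by norm_num) (Real.log_nonneg (by exact_mod_cast Fintype.card_pos))) ht
  rw [div_le_iff₀ ht0]
  exact h3.le

/-! ### Storing a seed index, and amplifying by medians -/

section Amplification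

variable {α S Ω : Type} {p : ℕ}

/-- The state of a deterministic algorithm after reading `rs`. -/
def runDet (step : Fin p → α → S → S) (s : S) (rs : List (Fin p × α)) : S :=
  rs.foldl (fun s r => step r.1 r.2 s) s

/-- `R` independent copies of a deterministic algorithm with a random seed; the output is the
median. -/
noncomputable abbrev medianAlgorithm {t : ℕ} [NeZero t] (R : ℕ) (code : PrefixCode S) (s₀ : S)
    (step : Fin t → Fin p → α → S → S) (out : Fin t → S → ℝ) : StreamingAlgorithm α p where
  State := Fin R → Fin t × S
  code := (((PrefixCode.nat.comap Fin.val Fin.val_injective).prod code).vec R).enc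
  code_injective := PrefixCode.injective _
  init := (PMF.uniformOfFintype (Fin R → Fin t)).map fun w i => (w i, s₀)
  step i x s := PMF.pure fun j => ((s j).1, step (s j).1 i x (s j).2)
  output s := median fun j => out (s j).1 (s j).2

/-- All randomness lies in the initial draw of the seeds; afterwards the steps are deterministic. -/
theorem medianAlgorithm_run {t : ℕ} [NeZero t] (R : ℕ) (code : PrefixCode S) (s₀ : S)
    (step : Fin t → Fin p → α → S → S) (out : Fin t → S → ℝ) (rs : List (Fin p × α)) :
    (medianAlgorithm R code s₀ step out).run rs
      = (PMF.uniformOfFintype (Fin R → Fin t)).map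
          fun w i => (w i, runDet (step (w i)) s₀ rs) := by
  have h : ∀ (rs : List (Fin p × α)) (s : Fin R → Fin t × S),
      (medianAlgorithm R code s₀ step out).runFrom s rs
        = PMF.pure fun i => ((s i).1, runDet (step (s i).1) (s i).2 rs) := by
    intro rs
    induction rs with
    | nil => intro s; rfl
    | cons r rs ih =>
      intro s
      change (PMF.pure _).bind _ = _
      rw [PMF.pure_bind, ih]
      rfl
  unfold StreamingAlgorithm.run
  simp only [h]
  change (PMF.map _ _).bind _ = _
  rw [PMF.bind_map]
  rfl

/-- From a family of deterministic algorithms most of which are right on every input, to a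
streaming algorithm that stores its own random bits and fails with probability at most `δ`. -/
theorem exists_streamingAlgorithm {I : Type} [Fintype Ω] [Nonempty Ω] [Fintype I]
    (code : PrefixCode S) (s₀ : S) (step : Ω → Fin p → α → S → S) (out : Ω → S → ℝ)
    (σ : I → List α) (lo hi : I → ℝ) (b : I → ℕ)
    (hgood : ∀ i, prob (fun ω => ¬ (lo i ≤ out ω (runDet (step ω) s₀ (StreamingAlgorithm.reads p (σ i)))
      ∧ out ω (runDet (step ω) s₀ (StreamingAlgorithm.reads p (σ i))) ≤ hi i)) ≤ 1 / 32)
    (hspace : ∀ i ω rs, rs <+: StreamingAlgorithm.reads p (σ i) →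
      (code.enc (runDet (step ω) s₀ rs)).length ≤ b i)
    (t R : ℕ) (ht : 16 * Real.log (Fintype.card I) < t) (ht0 : 0 < t) (δ : ℝ)
    (hδ : Real.exp (-(R / 4)) ≤ δ) :
    ∃ A : StreamingAlgorithm α p, ∀ i,
      ENNReal.ofReal (1 - δ) ≤ (A.run (StreamingAlgorithm.reads p (σ i))).toOuterMeasure
        {s | lo i ≤ A.output s ∧ A.output s ≤ hi i} ∧
      A.RunsInSpace (σ i) ((R * (2 * t.size + b i + 2) + 1 : ℕ) : ℝ) := by
  classical
  obtain ⟨seed, hseed⟩ := exists_seeds (fun i ω =>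
    ¬ (lo i ≤ out ω (runDet (step ω) s₀ (StreamingAlgorithm.reads p (σ i)))
      ∧ out ω (runDet (step ω) s₀ (StreamingAlgorithm.reads p (σ i))) ≤ hi i)) hgood t ht
  have : NeZero t := ⟨ht0.ne'⟩
  refine ⟨medianAlgorithm R code s₀ (fun j => step (seed j)) (fun j => out (seed j)), fun i =>
    ⟨?_, ?_⟩⟩
  · rw [medianAlgorithm_run, PMF.toOuterMeasure_map_apply]
    set v : Fin t → ℝ := fun j =>
      out (seed j) (runDet (step (seed j)) s₀ (StreamingAlgorithm.reads p (σ i))) with hv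
    set A : Set (Fin R → Fin t) := {w | lo i ≤ median (fun l => v (w l)) ∧
      median (fun l => v (w l)) ≤ hi i} with hA
    change _ ≤ (PMF.uniformOfFintype (Fin R → Fin t)).toOuterMeasure A
    rw [PMF.toOuterMeasure_uniformOfFintype_apply]
    -- A copy is wrong with probability at most `1/8 = (1/2)/4`, and the median is wrong only if at
    -- least half of the copies are.
    have h1 := prob_card_ge_le R (fun j => ¬ (lo i ≤ v j ∧ v j ≤ hi i)) (1 / 2)
      ((hseed i).trans (by norm_num))
    have h2 : prob (fun w => w ∉ A) ≤ δ := by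
      refine (prob_mono fun w hw => ?_).trans (h1.trans (le_trans (by
        apply le_of_eq; congr 1; ring) hδ))
      by_contra hcon
      refine hw (median_mem _ ?_)
      have : (((2 * (Finset.univ.filter fun l => ¬ (lo i ≤ v (w l) ∧ v (w l) ≤ hi i)).card : ℕ)) : ℝ)
          < (R : ℝ) := by
        push_cast; push Not at hcon ⊢; linarith
      exact_mod_cast this
    have h3 : 1 - δ ≤ (Fintype.card A : ℝ) / Fintype.card (Fin R → Fin t) := by
      have h4 := prob_not fun w => w ∈ A
      have h5 := prob_eq_card fun w => w ∈ A
      rw [← Fintype.card_subtype] at h5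
      have h6 : Fintype.card A = Fintype.card {w // w ∈ A} := rfl
      rw [h6, ← h5]
      linarith
    refine (ENNReal.ofReal_le_ofReal h3).trans_eq ?_
    rw [ENNReal.ofReal_div_of_pos (by exact_mod_cast Fintype.card_pos), ENNReal.ofReal_natCast,
      ENNReal.ofReal_natCast]
  · intro rs hrs s hs
    rw [medianAlgorithm_run, PMF.support_map] at hs
    obtain ⟨w, -, rfl⟩ := hs
    refine Nat.cast_le.2 (((PrefixCode.nat.comap Fin.val Fin.val_injective).prod code).length_vec_le _
      (2 * t.size + b i + 1) fun j => ?_)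
    change ((PrefixCode.nat.enc (w j).val) ++ _).length ≤ _
    rw [List.length_append, PrefixCode.length_nat]
    have h1 := hspace i (seed (w j)) rs hrs
    have h2 : Nat.size (w j).val ≤ t.size := Nat.size_le_size (w j).isLt.le
    change _ + (code.enc (runDet (step (seed (w j))) s₀ rs)).length ≤ _
    omega

end Amplification

/-! ### Monochromatic sets under a uniformly random colouring -/

section UniformFunctions

variable {I : Type*} [Fintype I] [DecidableEq I] {N : ℕ} [NeZero N]

theorem prob_forall_eq (U : Finset I) (a : I → Fin N) :
    prob (fun g : I → Fin N => ∀ i ∈ U, g i = a i) = (1 / (N : ℝ)) ^ U.card := by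
  classical
  have h := ave_pi_prod (Ω := Fin N)
    fun (i : I) (x : Fin N) => if i ∈ U then (if x = a i then (1 : ℝ) else 0) else 1
  have h1 : ∀ i : I, ave (fun x : Fin N => if i ∈ U then (if x = a i then (1 : ℝ) else 0) else 1)
      = if i ∈ U then 1 / (N : ℝ) else 1 := by
    intro i
    split_ifs
    · simp [ave]
    · exact ave_const _
  rw [Finset.prod_congr rfl fun i _ => h1 i, Finset.prod_ite_mem, Finset.univ_inter,
    Finset.prod_const] at h
  rw [← h]
  unfold prob
  congr 1
  ext g
  rw [Finset.prod_ite_mem, Finset.univ_inter]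
  split_ifs with hg
  · exact (Finset.prod_eq_one fun i hi => by rw [if_pos (hg i hi)]).symm
  · push Not at hg
    obtain ⟨i, hi, hne⟩ := hg
    exact (Finset.prod_eq_zero hi (by rw [if_neg hne])).symm

theorem prob_const_on_le (U : Finset I) :
    prob (fun g : I → Fin N => ∃ c, ∀ i ∈ U, g i = c) ≤ N * (1 / (N : ℝ)) ^ U.card := by
  have := prob_exists_le_of_le (Finset.univ : Finset (Fin N))
    (fun c (g : I → Fin N) => ∀ i ∈ U, g i = c) _ fun c _ => (prob_forall_eq U fun _ => c).le
  simpa using this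

theorem prob_const_on (U : Finset I) (hU : U.Nonempty) :
    prob (fun g : I → Fin N => ∃ c, ∀ i ∈ U, g i = c) = N * (1 / (N : ℝ)) ^ U.card := by
  classical
  have h : ∑ c : Fin N, prob (fun g : I → Fin N => ∀ i ∈ U, g i = c)
      = N * (1 / (N : ℝ)) ^ U.card := by
    rw [Finset.sum_congr rfl fun c _ => prob_forall_eq U fun _ => c]
    simp
  rw [← h]
  unfold prob
  rw [← ave_sum]
  congr 1
  ext g
  obtain ⟨i, hi⟩ := hU
  split_ifs with hg
  · obtain ⟨c, hc⟩ := hg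
    rw [Finset.sum_eq_single c]
    · rw [if_pos hc]
    · intro c' _ hne
      rw [if_neg fun h' => hne ((h' i hi).symm.trans (hc i hi))]
    · simp
  · push Not at hg
    refine (Finset.sum_eq_zero fun c _ => if_neg fun h' => ?_).symm
    obtain ⟨j, hj, hne⟩ := hg c
    exact hne (h' j hj)

/-- On disjoint sets the two events are independent. If the sets share `s ≥ 1` points, both colours
agree and the union is monochromatic, which gains `N^(s-1)` over independence. The truncated
subtraction makes the disjoint case fit the same formula. -/
theorem prob_const_on_and_le (U W : Finset I) :
    prob (fun g : I → Fin N => (∃ c, ∀ i ∈ U, g i = c) ∧ ∃ c, ∀ i ∈ W, g i = c)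
      ≤ (N * (1 / (N : ℝ)) ^ U.card) * (N * (1 / (N : ℝ)) ^ W.card)
        * (N : ℝ) ^ ((U ∩ W).card - 1) := by
  have hN : (0 : ℝ) < N := by exact_mod_cast NeZero.pos N
  rcases (U ∩ W).eq_empty_or_nonempty with h | h
  · have hd : Disjoint U W := Finset.disjoint_iff_inter_eq_empty.2 h
    have h1 : ∀ c ∈ (Finset.univ : Finset (Fin N × Fin N)),
        prob (fun g : I → Fin N => (∀ i ∈ U, g i = c.1) ∧ ∀ i ∈ W, g i = c.2)
          ≤ (1 / (N : ℝ)) ^ (U.card + W.card) := by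
      intro c _
      rw [← Finset.card_union_of_disjoint hd,
        ← prob_forall_eq (U ∪ W) fun i => if i ∈ U then c.1 else c.2]
      refine prob_mono fun g hg i hi => ?_
      split_ifs with hiU
      · exact hg.1 i hiU
      · exact hg.2 i ((Finset.mem_union.1 hi).resolve_left hiU)
    refine (prob_mono fun g hg => ?_).trans ((prob_exists_le_of_le _ _ _ h1).trans_eq ?_)
    · obtain ⟨⟨c, hc⟩, c', hc'⟩ := hg
      exact ⟨(c, c'), Finset.mem_univ _, hc, hc'⟩
    · simp [h, pow_add]; ring
  · obtain ⟨i, hi⟩ := h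
    refine (prob_mono fun g hg => ?_).trans ((prob_const_on_le (U ∪ W)).trans_eq ?_)
    · obtain ⟨⟨c, hc⟩, c', hc'⟩ := hg
      have hcc : c' = c := by
        rw [← hc i (Finset.mem_inter.1 hi).1, ← hc' i (Finset.mem_inter.1 hi).2]
      refine ⟨c, fun j hj => ?_⟩
      rcases Finset.mem_union.1 hj with h | h
      · exact hc j h
      · rw [hc' j h, hcc]
    · have h2 := Finset.card_union_add_card_inter U W
      have h3 : 0 < (U ∩ W).card := Finset.card_pos.2 ⟨i, hi⟩
      obtain ⟨m, hm⟩ := Nat.exists_eq_succ_of_ne_zero h3.ne'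
      have h4 : (1 / (N : ℝ)) ^ U.card * (1 / (N : ℝ)) ^ W.card
          = (1 / (N : ℝ)) ^ (U ∪ W).card * (1 / (N : ℝ)) ^ (m + 1) := by
        rw [← pow_add, ← pow_add, ← h2, hm]
      rw [hm, Nat.succ_sub_one]
      calc (N : ℝ) * (1 / (N : ℝ)) ^ (U ∪ W).card
          = N * N * ((1 / (N : ℝ)) ^ (U ∪ W).card * (1 / (N : ℝ)) ^ (m + 1)) * (N : ℝ) ^ m := by
            rw [pow_succ, one_div, inv_pow, inv_pow]; field_simp
        _ = _ := by rw [← h4]; ring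

end UniformFunctions

/-! ### Second moments of counts of random events -/

section SecondMoment

variable {ι Ω : Type*} [Fintype Ω]

theorem ave_card_div (A : Finset ι) (e : ι → Ω → Prop) [∀ ω, DecidablePred fun X => e X ω]
    {P : ℝ} (hP : 0 < P) (h1 : ∀ X ∈ A, prob (e X) = P) :
    ave (fun ω => ((A.filter fun X => e X ω).card : ℝ) / P) = A.card := by
  classical
  have : (fun ω => ((A.filter fun X => e X ω).card : ℝ) / P)
      = fun ω => P⁻¹ * ∑ X ∈ A, if e X ω then (1 : ℝ) else 0 := by
    ext ω
    rw [Finset.sum_boole, div_eq_inv_mul]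
  rw [this, ave_const_mul, ave_sum, Finset.sum_congr rfl (g := fun _ => P)]
  · rw [Finset.sum_const, nsmul_eq_mul]; field_simp
  · intro X hX
    rw [← h1 X hX]
    unfold prob
    congr!

/-- The variance of the number of events that happen, scaled to its expectation. -/
theorem ave_sq_card_div_sub_le [Nonempty Ω] (A : Finset ι) (e : ι → Ω → Prop)
    [∀ ω, DecidablePred fun X => e X ω] {P : ℝ} (hP : 0 < P) (h1 : ∀ X ∈ A, prob (e X) = P)
    (c : ι → ι → ℝ) (h2 : ∀ X ∈ A, ∀ X' ∈ A, prob (fun ω => e X ω ∧ e X' ω) ≤ P ^ 2 * (1 + c X X'))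
    (B : ℝ) (h3 : ∀ X ∈ A, ∑ X' ∈ A, c X X' ≤ B) :
    (ave fun ω => (((A.filter fun X => e X ω).card : ℝ) / P - A.card) ^ 2) ≤ A.card * B := by
  classical
  have hm := ave_card_div A e hP h1
  set Y : Ω → ℝ := fun ω => ((A.filter fun X => e X ω).card : ℝ) / P with hY
  have hsq : ave (fun ω => Y ω ^ 2) ≤ ∑ X ∈ A, ∑ X' ∈ A, (1 + c X X') := by
    have : (fun ω => Y ω ^ 2)
        = fun ω => (P ^ 2)⁻¹ * ∑ X ∈ A, ∑ X' ∈ A, if e X ω ∧ e X' ω then (1 : ℝ) else 0 := by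
      ext ω
      rw [hY]
      beta_reduce
      rw [← Finset.sum_boole, div_pow, sq (∑ X ∈ A, _), Finset.sum_mul_sum, div_eq_inv_mul]
      congr 1
      refine Finset.sum_congr rfl fun X _ => Finset.sum_congr rfl fun X' _ => ?_
      by_cases ha : e X ω <;> by_cases hb : e X' ω <;> simp [ha, hb]
    rw [this, ave_const_mul, ave_sum, inv_mul_le_iff₀ (by positivity), Finset.mul_sum]
    refine Finset.sum_le_sum fun X hX => ?_
    rw [ave_sum, Finset.mul_sum]
    refine Finset.sum_le_sum fun X' hX' => le_of_eq_of_le ?_ (h2 X hX X' hX')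
    unfold prob
    beta_reduce
    congr!
  have hvar : (ave fun ω => (Y ω - A.card) ^ 2) = ave (fun ω => Y ω ^ 2) - (A.card : ℝ) ^ 2 := by
    have : (fun ω => (Y ω - A.card) ^ 2)
        = fun ω => Y ω ^ 2 - (2 * A.card * Y ω - (A.card : ℝ) ^ 2) := by
      ext ω; ring
    rw [this, ave_sub, ave_sub, ave_const_mul, ave_const, hm]; ring
  rw [hvar]
  have h4 : ∑ X ∈ A, ∑ X' ∈ A, (1 + c X X')
      = (A.card : ℝ) ^ 2 + ∑ X ∈ A, ∑ X' ∈ A, c X X' := by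
    simp only [Finset.sum_add_distrib, Finset.sum_const, nsmul_eq_mul]; ring
  have h5 : ∑ X ∈ A, ∑ X' ∈ A, c X X' ≤ A.card * B :=
    (Finset.sum_le_sum h3).trans_eq (by simp)
  linarith

/-- Sums over the members of a family, by their intersection with a fixed set. -/
theorem sum_le_of_inter {V : Type*} [DecidableEq V] (A : Finset (Finset V)) (X : Finset V)
    (c : Finset V → ℝ) (G : Finset V → ℝ) (hG : ∀ J, 0 ≤ G J) (hc : ∀ X' ∈ A, c X' ≤ G (X ∩ X'))
    (B : ℝ) (hB : ∀ J ⊆ X, ((A.filter fun X' => J ⊆ X').card : ℝ) * G J ≤ B) :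
    ∑ X' ∈ A, c X' ≤ 2 ^ X.card * B := by
  -- Each `X'` is charged to `J = X ∩ X'`; the other subsets of `X` only add nonnegative terms.
  calc ∑ X' ∈ A, c X' ≤ ∑ X' ∈ A, ∑ J ∈ X.powerset, if J ⊆ X' then G J else 0 := by
        refine Finset.sum_le_sum fun X' hX' => (hc X' hX').trans ?_
        have := Finset.single_le_sum (f := fun J => if J ⊆ X' then G J else 0)
          (fun J _ => by split_ifs; exacts [hG J, le_rfl])
          (Finset.mem_powerset.2 (Finset.inter_subset_left (s₁ := X) (s₂ := X')))
        simpa [Finset.inter_subset_right] using this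
    _ = ∑ J ∈ X.powerset, ((A.filter fun X' => J ⊆ X').card : ℝ) * G J := by
        rw [Finset.sum_comm]
        refine Finset.sum_congr rfl fun J _ => ?_
        rw [← Finset.sum_filter, Finset.sum_const, nsmul_eq_mul]
    _ ≤ ∑ J ∈ X.powerset, B := Finset.sum_le_sum fun J hJ => hB J (Finset.mem_powerset.1 hJ)
    _ = _ := by simp

end SecondMoment

/-! ### Vertex sampling -/

section Sampling

variable {V : Type*} [Fintype V] [DecidableEq V] {N : ℕ} [NeZero N]

theorem prob_sampled (X J : Finset V) :
    prob (fun g : V → Fin N => ∀ v ∈ X \ J, g v = 0) = (1 / (N : ℝ)) ^ (X \ J).card :=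
  prob_forall_eq _ fun _ => 0

/-- Estimating the size of a family of sets around `J` by vertex sampling. -/
theorem ave_sq_sampled_sub_le (k w : ℕ) (A : Finset (Finset V)) (J : Finset V)
    (hA : ∀ X ∈ A, J ⊆ X ∧ X.card = k + 1 ∧ (X \ J).card = w) (h : ℝ) (h1 : 1 ≤ h)
    (hN : (N : ℝ) ≤ 2 * h)
    (hdeg : ∀ I, J ⊂ I →
      ((A.filter fun X => I ⊆ X).card : ℝ) ≤ 2 * h ^ (k + 1 - I.card)) :
    ave (fun g : V → Fin N =>
      ((A.filter fun X => ∀ v ∈ X \ J, g v = 0).card : ℝ) * (N : ℝ) ^ w) = A.card ∧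
    ave (fun g : V → Fin N =>
      (((A.filter fun X => ∀ v ∈ X \ J, g v = 0).card : ℝ) * (N : ℝ) ^ w - A.card) ^ 2)
      ≤ A.card * (2 ^ (2 * k + 3) * h ^ w) := by
  have hN0 : (0 : ℝ) < N := by exact_mod_cast NeZero.pos N
  have hN1 : (1 : ℝ) ≤ N := by exact_mod_cast NeZero.pos N
  have hP : (0 : ℝ) < (1 / (N : ℝ)) ^ w := by positivity
  have e : ∀ g : V → Fin N, ((A.filter fun X => ∀ v ∈ X \ J, g v = 0).card : ℝ) * (N : ℝ) ^ w
      = ((A.filter fun X => ∀ v ∈ X \ J, g v = 0).card : ℝ) / (1 / (N : ℝ)) ^ w := by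
    intro g; rw [one_div, inv_pow, div_inv_eq_mul]
  simp only [e]
  have hp : ∀ X ∈ A, prob (fun g : V → Fin N => ∀ v ∈ X \ J, g v = 0) = (1 / (N : ℝ)) ^ w :=
    fun X hX => by rw [prob_sampled, (hA X hX).2.2]
  refine ⟨ave_card_div A _ hP hp, ?_⟩
  -- The joint probability of `X` and `X'` exceeds the product by the factor `N^|(X ∩ X') \ J|`.
  -- Subtracting `1` makes the correlation vanish when `X ∩ X' = J`, so no bound on the codegree of
  -- `J` itself is needed.
  refine ave_sq_card_div_sub_le A _ hP hp
    (fun X X' => (N : ℝ) ^ ((X ∩ X') \ J).card - 1) ?_ _ ?_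
  · intro X hX X' hX'
    have h2 : prob (fun g : V → Fin N => (∀ v ∈ X \ J, g v = 0) ∧ ∀ v ∈ X' \ J, g v = 0)
        = (1 / (N : ℝ)) ^ ((X \ J) ∪ (X' \ J)).card := by
      rw [← prob_forall_eq _ fun _ => 0]
      congr 1; ext g
      simp only [Finset.mem_union, or_imp, forall_and]
    rw [h2]
    have h3 := Finset.card_union_add_card_inter (X \ J) (X' \ J)
    have h4 : (X \ J) ∩ (X' \ J) = (X ∩ X') \ J := by
      ext v; simp only [Finset.mem_inter, Finset.mem_sdiff]; tauto
    rw [h4, (hA X hX).2.2, (hA X' hX').2.2] at h3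
    have h5 : ((1 / (N : ℝ)) ^ w) ^ 2
        = (1 / (N : ℝ)) ^ ((X \ J) ∪ (X' \ J)).card * (1 / (N : ℝ)) ^ ((X ∩ X') \ J).card := by
      rw [← pow_mul, ← pow_add, h3]; ring
    rw [h5, add_sub_cancel, mul_assoc, ← mul_pow, one_div_mul_cancel hN0.ne', one_pow, mul_one]
  · intro X hX
    have h6 := sum_le_of_inter A X (fun X' => (N : ℝ) ^ ((X ∩ X') \ J).card - 1)
      (fun I => if J ⊂ I then (N : ℝ) ^ (I \ J).card - 1 else 0) ?_ ?_ (2 ^ (k + 2) * h ^ w) ?_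
    · refine h6.trans_eq ?_
      rw [(hA X hX).2.1, ← mul_assoc, ← pow_add]; congr 2; ring
    · intro I
      split_ifs
      · exact sub_nonneg.2 (one_le_pow₀ hN1)
      · exact le_rfl
    · intro X' hX'
      have hJ : J ⊆ X ∩ X' := Finset.subset_inter (hA X hX).1 (hA X' hX').1
      by_cases hJ' : J ⊂ X ∩ X'
      · rw [if_pos hJ']
      · have : J = X ∩ X' := by
          by_contra hne; exact hJ' (hJ.ssubset_of_ne hne)
        rw [if_neg hJ', ← this]; simp
    · intro I hI
      split_ifs with hJI
      · have hw : (I \ J).card ≤ w := by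
          rw [← (hA X hX).2.2]
          exact Finset.card_le_card (Finset.sdiff_subset_sdiff hI le_rfl)
        have hi : k + 1 - I.card + (I \ J).card = w := by
          have a1 := Finset.card_sdiff_of_subset hJI.subset
          have a2 := Finset.card_sdiff_of_subset (hA X hX).1
          have a3 := Finset.card_le_card hI
          have a4 := Finset.card_le_card hJI.subset
          have a5 := (hA X hX).2.1
          have a6 := (hA X hX).2.2
          omega
        have hk : (I \ J).card ≤ k + 1 := by
          rw [← (hA X hX).2.1]
          exact Finset.card_le_card (Finset.sdiff_subset.trans hI)
        calc _ ≤ (2 * h ^ (k + 1 - I.card)) * (2 * h) ^ (I \ J).card := by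
              gcongr
              · exact sub_nonneg.2 (one_le_pow₀ hN1)
              · exact hdeg I hJI
              · exact (sub_le_self _ zero_le_one).trans (by gcongr)
          _ = 2 * 2 ^ (I \ J).card * h ^ w := by rw [mul_pow, ← hi, pow_add]; ring
          _ ≤ 2 * 2 ^ (k + 1) * h ^ w := by gcongr; norm_num
          _ = _ := by ring
      · rw [mul_zero]; positivity

end Sampling

/-! ### Windows of consecutive elements, and colouring of `r`-sets -/

section Windows

variable {V : Type*} [LinearOrder V]

/-- The number of elements of `X` below `v`. -/
def rankIn (X : Finset V) (v : V) : ℕ := (X.filter (· < v)).card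

theorem rankIn_lt {X : Finset V} {v : V} (hv : v ∈ X) : rankIn X v < X.card :=
  Finset.card_lt_card ⟨Finset.filter_subset _ _, fun h => by
    simpa using (Finset.mem_filter.1 (h hv)).2⟩

theorem rankIn_strictMono {X : Finset V} {u v : V} (hu : u ∈ X) (huv : u < v) :
    rankIn X u < rankIn X v :=
  Finset.card_lt_card ⟨fun x hx => by
    simp only [Finset.mem_filter] at hx ⊢
    exact ⟨hx.1, hx.2.trans huv⟩, fun h => by
    have := h (Finset.mem_filter.2 ⟨hu, huv⟩)
    simp at this⟩

theorem rankIn_injOn (X : Finset V) : Set.InjOn (rankIn X) X := by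
  intro u hu v hv h
  rcases lt_trichotomy u v with h' | h' | h'
  · exact absurd h (rankIn_strictMono hu h').ne
  · exact h'
  · exact absurd h (rankIn_strictMono hv h').ne'

theorem image_rankIn (X : Finset V) : X.image (rankIn X) = Finset.range X.card := by
  refine Finset.eq_of_subset_of_card_le (fun i hi => ?_) ?_
  · obtain ⟨v, hv, rfl⟩ := Finset.mem_image.1 hi
    exact Finset.mem_range.2 (rankIn_lt hv)
  · rw [Finset.card_range, Finset.card_image_of_injOn (rankIn_injOn X)]

/-- The elements of `X` in the positions `i, …, i + r - 1`. -/
def window (r : ℕ) (X : Finset V) (i : ℕ) : Finset V :=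
  X.filter fun v => rankIn X v ∈ Finset.Ico i (i + r)

/-- The sets of `r` consecutive elements of a set of `k + 1` elements. -/
def windows (k r : ℕ) (X : Finset V) : Finset (Finset V) :=
  (Finset.range (k + 2 - r)).image (window r X)

theorem image_window {k r : ℕ} {X : Finset V} (hX : X.card = k + 1) {i : ℕ} (hi : i + r ≤ k + 1) :
    (window r X i).image (rankIn X) = Finset.Ico i (i + r) := by
  ext j
  simp only [window, Finset.mem_image, Finset.mem_filter]
  constructor
  · rintro ⟨v, ⟨-, hv⟩, rfl⟩; exact hv
  · intro hj
    have : j ∈ X.image (rankIn X) := by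
      rw [image_rankIn, hX, Finset.mem_range]
      have := (Finset.mem_Ico.1 hj).2
      omega
    obtain ⟨v, hv, rfl⟩ := Finset.mem_image.1 this
    exact ⟨v, ⟨hv, hj⟩, rfl⟩

theorem window_injOn {k r : ℕ} (hr : 0 < r) {X : Finset V} (hX : X.card = k + 1) :
    Set.InjOn (window r X) (Finset.range (k + 2 - r)) := by
  intro i hi j hj h
  rw [Finset.coe_range, Set.mem_Iio] at hi hj
  have h1 := image_window (r := r) hX (i := i) (by omega)
  have h2 := image_window (r := r) hX (i := j) (by omega)
  rw [h, h2] at h1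
  have h3 : i ∈ Finset.Ico j (j + r) := by rw [h1]; simp [hr]
  have h4 : j ∈ Finset.Ico i (i + r) := by rw [← h1]; simp [hr]
  simp only [Finset.mem_Ico] at h3 h4
  omega

theorem card_windows {k r : ℕ} (hr : 0 < r) {X : Finset V} (hX : X.card = k + 1) :
    (windows k r X).card = k + 2 - r := by
  rw [windows, Finset.card_image_of_injOn (window_injOn hr hX), Finset.card_range]

theorem mem_windows {k r : ℕ} {X : Finset V} (hX : X.card = k + 1) {W : Finset V}
    (hW : W ∈ windows k r X) (hr : r ≤ k + 1) : W ⊆ X ∧ W.card = r := by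
  obtain ⟨i, hi, rfl⟩ := Finset.mem_image.1 hW
  refine ⟨Finset.filter_subset _ _, ?_⟩
  have h1 := image_window (r := r) hX (i := i) (by have := Finset.mem_range.1 hi; omega)
  have h2 := Finset.card_image_of_injOn
    ((rankIn_injOn X).mono (Finset.coe_subset.2 (Finset.filter_subset
      (fun v => rankIn X v ∈ Finset.Ico i (i + r)) X)))
  change ((window r X i).image (rankIn X)).card = (window r X i).card at h2
  rw [h1, Nat.card_Ico] at h2
  omega

/-- A set of `j` elements contains at most `j - r + 1` windows. -/
theorem card_windows_subset {k r : ℕ} (hr : 0 < r) {X : Finset V} (hX : X.card = k + 1)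
    (J : Finset V) (hne : ((windows k r X).filter (· ⊆ J)).Nonempty) :
    ((windows k r X).filter (· ⊆ J)).card + r ≤ J.card + 1 := by
  set I := (Finset.range (k + 2 - r)).filter fun i => window r X i ⊆ J with hI
  have h1 : (windows k r X).filter (· ⊆ J) = I.image (window r X) := by
    rw [windows, Finset.filter_image]
  have h2 : ((windows k r X).filter (· ⊆ J)).card ≤ I.card := by
    rw [h1]; exact Finset.card_image_le
  have hIne : I.Nonempty := by
    rw [h1] at hne; exact Finset.image_nonempty.1 hne
  have hsub : ∀ i ∈ I, Finset.Ico i (i + r) ⊆ (X ∩ J).image (rankIn X) := by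
    intro i hi
    have hi' := Finset.mem_filter.1 hi
    rw [← image_window (r := r) hX (i := i) (by have := Finset.mem_range.1 hi'.1; omega)]
    exact Finset.image_subset_image
      (Finset.subset_inter (Finset.filter_subset _ _) hi'.2)
  set i₀ := I.max' hIne with hi₀
  -- The starting positions of the windows inside `J`, together with the `r - 1` further positions
  -- of the last such window, are distinct ranks of elements of `X ∩ J`.
  have h3 : I ∪ Finset.Ico (i₀ + 1) (i₀ + r) ⊆ (X ∩ J).image (rankIn X) := by
    refine Finset.union_subset (fun i hi => hsub i hi (by simp [hr])) fun j hj => ?_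
    refine hsub i₀ (I.max'_mem hIne) ?_
    simp only [Finset.mem_Ico] at hj ⊢
    omega
  have h4 : Disjoint I (Finset.Ico (i₀ + 1) (i₀ + r)) := by
    rw [Finset.disjoint_left]
    intro i hi hi'
    have := I.le_max' i hi
    have := (Finset.mem_Ico.1 hi').1
    omega
  have h5 := (Finset.card_le_card h3).trans Finset.card_image_le
  have h6 := Finset.card_le_card (Finset.inter_subset_right (s₁ := X) (s₂ := J))
  rw [Finset.card_union_of_disjoint h4, Nat.card_Ico] at h5
  omega

/-- Every element misses many windows. -/
theorem card_windows_erase {k r : ℕ} (hr : 0 < r) {X : Finset V} (hX : X.card = k + 1) (x : V) :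
    k + 2 - 2 * r ≤ ((windows k r X).filter (x ∉ ·)).card := by
  -- A window that contains `x` starts at one of the at most `r` positions ending with the rank of
  -- `x`.
  have h1 : (windows k r X).filter (x ∈ ·)
      ⊆ (Finset.Icc (rankIn X x + 1 - r) (rankIn X x)).image (window r X) := by
    intro W hW
    obtain ⟨hW, hx⟩ := Finset.mem_filter.1 hW
    obtain ⟨i, -, rfl⟩ := Finset.mem_image.1 hW
    have := (Finset.mem_filter.1 hx).2
    refine Finset.mem_image_of_mem _ ?_
    simp only [Finset.mem_Ico, Finset.mem_Icc] at this ⊢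
    omega
  have h2 := (Finset.card_le_card h1).trans Finset.card_image_le
  rw [Nat.card_Icc] at h2
  have h3 := Finset.card_filter_add_card_filter_not (s := windows k r X) (x ∈ ·)
  rw [card_windows hr hX] at h3
  omega

/-- Estimating the size of a family of `(k + 1)`-sets by colouring all `r`-sets. -/
theorem ave_sq_colored_sub_le [Fintype V] {N : ℕ} [NeZero N] (k r a : ℕ) (hr : 0 < r) (ha : 0 < a) (ha2 : a ≤ 2)
    (hk : k + 1 = 2 * r + a) (A : Finset (Finset V)) (hA : ∀ X ∈ A, X.card = k + 1)
    (h ν T : ℝ) (h1 : 1 ≤ ν) (hν : ν ^ a = h) (hT : 0 ≤ T) (hhT : h ^ (k + 2) = T ^ 2)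
    (hN : (N : ℝ) ≤ 2 * ν)
    (hdeg : ∀ I : Finset V, r < I.card →
      ((A.filter fun X => I ⊆ X).card : ℝ) ≤ 2 * h ^ (k + 1 - I.card)) :
    ave (fun f : Finset V → Fin N =>
      ((A.filter fun X => ∃ c, ∀ W ∈ windows k r X, f W = c).card : ℝ)
        * (N : ℝ) ^ (k + 1 - r)) = A.card ∧
    ave (fun f : Finset V → Fin N =>
      (((A.filter fun X => ∃ c, ∀ W ∈ windows k r X, f W = c).card : ℝ)
        * (N : ℝ) ^ (k + 1 - r) - A.card) ^ 2) ≤ A.card * (2 ^ (2 * k + 3) * T) := by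
  have hN0 : (0 : ℝ) < N := by exact_mod_cast NeZero.pos N
  have hN1 : (1 : ℝ) ≤ N := by exact_mod_cast NeZero.pos N
  have hh1 : 1 ≤ h := hν ▸ one_le_pow₀ h1
  set P : ℝ := N * (1 / (N : ℝ)) ^ (k + 2 - r) with hPdef
  have hP : 0 < P := by positivity
  have hPN : P * (N : ℝ) ^ (k + 1 - r) = 1 := by
    rw [hPdef, show k + 2 - r = (k + 1 - r) + 1 by omega, pow_succ, one_div, inv_pow]
    field_simp
  have e : ∀ x : ℝ, x * (N : ℝ) ^ (k + 1 - r) = x / P := by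
    intro x; rw [eq_div_iff hP.ne', mul_assoc, mul_comm _ P, hPN, mul_one]
  simp only [e]
  have hp : ∀ X ∈ A, prob (fun f : Finset V → Fin N => ∃ c, ∀ W ∈ windows k r X, f W = c) = P := by
    intro X hX
    have hc := card_windows (k := k) hr (hA X hX)
    rw [prob_const_on _ (Finset.card_pos.1 (by omega)), hc]
  refine ⟨ave_card_div A _ hP hp, ?_⟩
  -- Sets with at most `r` common elements share at most one window, which costs nothing. With `i >
  -- r` common elements they share at most `i - r + 1` windows, which costs `N^(i-r)`.
  refine ave_sq_card_div_sub_le A _ hP hp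
    (fun X X' => if r < (X ∩ X').card then (N : ℝ) ^ ((X ∩ X').card - r) else 0) ?_ _ ?_
  · intro X hX X' hX'
    refine (prob_const_on_and_le _ _).trans ?_
    rw [card_windows hr (hA X hX), card_windows hr (hA X' hX'), ← hPdef, ← sq]
    gcongr
    have hm : windows k r X ∩ windows k r X' ⊆ (windows k r X).filter (· ⊆ X ∩ X') := by
      intro W hW
      obtain ⟨hW1, hW2⟩ := Finset.mem_inter.1 hW
      exact Finset.mem_filter.2 ⟨hW1, Finset.subset_inter
        (mem_windows (hA X hX) hW1 (by omega)).1 (mem_windows (hA X' hX') hW2 (by omega)).1⟩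
    rcases (windows k r X ∩ windows k r X').eq_empty_or_nonempty with he | hne
    · rw [he, Finset.card_empty, zero_tsub, pow_zero, le_add_iff_nonneg_right]
      split_ifs <;> positivity
    · have h2 := card_windows_subset (k := k) hr (hA X hX) (X ∩ X') (hne.mono hm)
      have h3 := Finset.card_le_card hm
      split_ifs with h4
      · calc (N : ℝ) ^ ((windows k r X ∩ windows k r X').card - 1)
            ≤ (N : ℝ) ^ ((X ∩ X').card - r) := pow_le_pow_right₀ hN1 (by omega)
          _ ≤ _ := le_add_of_nonneg_left zero_le_one
      · rw [show (windows k r X ∩ windows k r X').card - 1 = 0 by omega]; simp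
  · intro X hX
    have h6 := sum_le_of_inter A X
      (fun X' => if r < (X ∩ X').card then (N : ℝ) ^ ((X ∩ X').card - r) else 0)
      (fun I => if r < I.card then (N : ℝ) ^ (I.card - r) else 0)
      (fun I => by split_ifs <;> positivity) (fun X' _ => le_rfl) (2 ^ (k + 2) * T) ?_
    · refine h6.trans_eq ?_
      rw [hA X hX, ← mul_assoc, ← pow_add]; congr 2; ring
    · intro I hI
      split_ifs with hIr
      · have hIk : I.card ≤ k + 1 := hA X hX ▸ Finset.card_le_card hI
        -- The inequality behind the choice of `h`. Squared and written in powers of `ν`, with `i =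
        -- |I|`, it reads `2(i-r) + 2a(k+1-i) ≤ a(k+2)`. Equality holds for every `i` if `a = 1`,
        -- and for `i = r + 1` if `a = 2`.
        have hkey : ν ^ (I.card - r) * h ^ (k + 1 - I.card) ≤ T := by
          refine le_of_sq_le_sq ?_ hT
          rw [← hhT, ← hν, ← pow_mul, ← pow_mul, ← pow_add, ← pow_mul]
          refine pow_le_pow_right₀ h1 ?_
          interval_cases a <;> omega
        calc _ ≤ (2 * h ^ (k + 1 - I.card)) * (2 * ν) ^ (I.card - r) := by
              gcongr
              exact hdeg I hIr
          _ = 2 * 2 ^ (I.card - r) * (ν ^ (I.card - r) * h ^ (k + 1 - I.card)) := by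
              rw [mul_pow]; ring
          _ ≤ 2 * 2 ^ (k + 1) * T := by gcongr; norm_num; omega
          _ = _ := by ring
      · rw [mul_zero]; positivity

end Windows

/-! ### Codegrees -/

section Codegree

variable {V : Type*} [DecidableEq V]

/-- The number of members of `A` that contain `J`. -/
def codegree (A : Finset (Finset V)) (J : Finset V) : ℕ := (A.filter fun X => J ⊆ X).card

/-- No set of more than `j` vertices is in too many members of `A`. -/
def CodegreeBound (k : ℕ) (h : ℝ) (A : Finset (Finset V)) (j : ℕ) : Prop :=
  ∀ I : Finset V, j < I.card → (codegree A I : ℝ) ≤ 2 * h ^ (k + 1 - I.card)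

/-- Sets of more than `k` vertices lie in at most one `(k+1)`-set. This starts the downward
induction on the size of heavy sets. -/
theorem codegreeBound_zero (k : ℕ) (h : ℝ) (h1 : 1 ≤ h) (A : Finset (Finset V))
    (hA : ∀ X ∈ A, X.card = k + 1) : CodegreeBound k h A k := by
  intro I hI
  have h2 : codegree A I ≤ 1 := by
    refine Finset.card_le_one.2 fun X hX Y hY => ?_
    obtain ⟨hX, hIX⟩ := Finset.mem_filter.1 hX
    obtain ⟨hY, hIY⟩ := Finset.mem_filter.1 hY
    rw [← Finset.eq_of_subset_of_card_le hIX (by rw [hA X hX]; exact hI),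
      Finset.eq_of_subset_of_card_le hIY (by rw [hA Y hY]; exact hI)]
  have h3 : (1 : ℝ) ≤ h ^ (k + 1 - I.card) := one_le_pow₀ h1
  have h4 : (codegree A I : ℝ) ≤ 1 := by exact_mod_cast h2
  linarith

theorem CodegreeBound.mono {k : ℕ} {h : ℝ} {A B : Finset (Finset V)} {j : ℕ}
    (hA : CodegreeBound k h A j) (hBA : B ⊆ A) : CodegreeBound k h B j := fun I hI =>
  le_trans (Nat.cast_le.2 (Finset.card_le_card (Finset.filter_subset_filter _ hBA))) (hA I hI)

end Codegree

/-! ### The heaviness oracle and the successive removal of heavy sets -/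

section Oracle

variable {V : Type*} [Fintype V] [DecidableEq V]

/-- The `(k + 1)`-sets all of whose `k`-subsets belong to `G`. -/
def simplicesOf (k : ℕ) (G : Finset (Finset V)) : Finset (Finset V) :=
  (Finset.univ.powersetCard (k + 1)).filter fun X => X.powersetCard k ⊆ G

theorem mem_simplicesOf {k : ℕ} {G : Finset (Finset V)} {X : Finset V} :
    X ∈ simplicesOf k G ↔ X.card = k + 1 ∧ X.powersetCard k ⊆ G := by
  simp [simplicesOf]

variable {N M M₁ : ℕ} [NeZero N]

/-- The members of `A` that arise from `J` by adding sampled vertices. -/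
def sampledAround (g : V → Fin N) (A : Finset (Finset V)) (J : Finset V) : Finset (Finset V) :=
  A.filter fun X => J ⊆ X ∧ ∀ v ∈ X \ J, g v = 0

/-- The estimate from `M` vertex samples of the number of members of `A` that contain `J`. -/
noncomputable def codegreeEstimate (k : ℕ) (g : Fin M → V → Fin N) (A : Finset (Finset V))
    (J : Finset V) : ℝ :=
  (∑ i, ((sampledAround (g i) A J).card : ℝ) * (N : ℝ) ^ (k + 1 - J.card)) / M

/-- The majority of `M₁` estimates says that many members of `A` contain `J`. -/
def IsHeavy (k : ℕ) (h : ℝ) (o : Fin M₁ → Fin M → V → Fin N) (A : Finset (Finset V))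
    (J : Finset V) : Prop :=
  M₁ ≤ 2 * (Finset.univ.filter fun u => h ^ (k + 1 - J.card) ≤ codegreeEstimate k (o u) A J).card

noncomputable instance (k : ℕ) (h : ℝ) (o : Fin M₁ → Fin M → V → Fin N)
    (A : Finset (Finset V)) (J : Finset V) : Decidable (IsHeavy k h o A J) :=
  Classical.dec _

/-- The oracle recognizes the `j`-sets that are in many members of `A`. -/
def OracleGood (k : ℕ) (h : ℝ) (o : Fin M₁ → Fin M → V → Fin N) (A : Finset (Finset V))
    (j : ℕ) : Prop :=
  ∀ J : Finset V, J.card = j →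
    (IsHeavy k h o A J → h ^ (k + 1 - j) ≤ 2 * codegree A J) ∧
    (¬ IsHeavy k h o A J → (codegree A J : ℝ) ≤ 2 * h ^ (k + 1 - j))

theorem ave_sq_codegreeEstimate_le (k j : ℕ) (h : ℝ) (h1 : 1 ≤ h) (hN : (N : ℝ) ≤ 2 * h)
    (hM : 0 < M) (A : Finset (Finset V)) (hA : ∀ X ∈ A, X.card = k + 1)
    (hdeg : CodegreeBound k h A j) (J : Finset V) (hJ : J.card = j) :
    ave (fun g : Fin M → V → Fin N => (codegreeEstimate k g A J - codegree A J) ^ 2)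
      ≤ codegree A J * (2 ^ (2 * k + 3) * h ^ (k + 1 - j)) / M := by
  set B := A.filter fun X => J ⊆ X with hB
  obtain ⟨e1, e2⟩ := ave_sq_sampled_sub_le (N := N) k (k + 1 - j) B J (fun X hX => by
    obtain ⟨hX, hJX⟩ := Finset.mem_filter.1 hX
    exact ⟨hJX, hA X hX, by rw [Finset.card_sdiff_of_subset hJX, hA X hX, hJ]⟩) h h1 hN
    (fun I hI => by
      refine le_trans ?_ (hdeg I (hJ ▸ Finset.card_lt_card hI))
      rw [hB, Finset.filter_filter]
      exact Nat.cast_le.2 (Finset.card_le_card fun X hX => by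
        simp only [Finset.mem_filter] at hX ⊢; exact ⟨hX.1, hX.2.2⟩))
  have e3 : ∀ g : V → Fin N, sampledAround g A J = B.filter fun X => ∀ v ∈ X \ J, g v = 0 := by
    intro g; rw [hB, Finset.filter_filter]; rfl
  have := ave_sq_mean_sub_le M hM _ _ _ e1 e2
  unfold codegreeEstimate
  simp only [e3, hJ]
  exact this

/-- Let `c` be the codegree and `θ` the threshold. For `θ/2 ≤ c ≤ 2θ` either answer is admissible.
Otherwise a wrong majority needs at least half of the estimates to be off by `max(c, θ)/2` or more,
which Chebyshev's inequality makes unlikely for each and Chernoff's bound very unlikely for half of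
them. -/
theorem prob_not_isHeavy_correct_le (k j : ℕ) (h : ℝ) (h1 : 1 ≤ h) (hN : (N : ℝ) ≤ 2 * h)
    (hM : 2 ^ (2 * k + 8) ≤ M) (A : Finset (Finset V)) (hA : ∀ X ∈ A, X.card = k + 1)
    (hdeg : CodegreeBound k h A j) (J : Finset V) (hJ : J.card = j) :
    prob (fun o : Fin M₁ → Fin M → V → Fin N =>
      ¬ ((IsHeavy k h o A J → h ^ (k + 1 - j) ≤ 2 * codegree A J) ∧
        (¬ IsHeavy k h o A J → (codegree A J : ℝ) ≤ 2 * h ^ (k + 1 - j))))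
      ≤ Real.exp (-(M₁ / 4)) := by
  classical
  have hM0 : 0 < M := lt_of_lt_of_le (by positivity) hM
  have hMr : (2 : ℝ) ^ (2 * k + 8) ≤ M := by exact_mod_cast hM
  have hMr0 : (0 : ℝ) < M := by exact_mod_cast hM0
  set θ := h ^ (k + 1 - j) with hθ
  have hθ0 : 0 < θ := by positivity
  set c : ℝ := (codegree A J : ℝ) with hc
  have hc0 : 0 ≤ c := Nat.cast_nonneg _
  have hvar := ave_sq_codegreeEstimate_le (N := N) k j h h1 hN hM0 A hA hdeg J hJ
  -- The variance is at most `2^(2k+3) c θ / M`; with `c θ ≤ 4 t^2` and `M ≥ 2^(2k+8)` this is at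
  -- most `t^2 / 8`.
  have hcheb : ∀ t : ℝ, 0 < t → c * θ ≤ 4 * t ^ 2 →
      prob (fun g : Fin M → V → Fin N => t ≤ |codegreeEstimate k g A J - c|) ≤ 1 / 8 := by
    intro t ht htc
    refine (prob_abs_sub_le ht).trans ?_
    rw [div_le_iff₀ (by positivity)]
    refine hvar.trans ?_
    rw [div_le_iff₀ hMr0, ← hθ, ← hc]
    calc c * (2 ^ (2 * k + 3) * θ) = c * θ * 2 ^ (2 * k + 3) := by ring
      _ ≤ 4 * t ^ 2 * 2 ^ (2 * k + 3) := by gcongr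
      _ = 1 / 8 * t ^ 2 * 2 ^ (2 * k + 8) := by ring
      _ ≤ _ := by gcongr
  have hmaj : ∀ q : (Fin M → V → Fin N) → Prop, prob q ≤ 1 / 8 →
      (∀ o : Fin M₁ → Fin M → V → Fin N,
        ¬ ((IsHeavy k h o A J → θ ≤ 2 * c) ∧ (¬ IsHeavy k h o A J → c ≤ 2 * θ)) →
        M₁ ≤ 2 * (Finset.univ.filter fun u => q (o u)).card) →
      prob (fun o : Fin M₁ → Fin M → V → Fin N =>
        ¬ ((IsHeavy k h o A J → θ ≤ 2 * c) ∧ (¬ IsHeavy k h o A J → c ≤ 2 * θ)))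
        ≤ Real.exp (-(M₁ / 4)) := by
    intro q hq himp
    refine (prob_mono fun o ho => ?_).trans ((prob_card_ge_le M₁ q (1 / 2)
      (hq.trans (by norm_num))).trans_eq (by congr 1; ring))
    have := himp o ho
    have : (M₁ : ℝ) ≤ 2 * ((Finset.univ.filter fun u => q (o u)).card : ℝ) := by exact_mod_cast this
    linarith
  rcases lt_or_ge (2 * θ) c with hlt | hge
  · refine hmaj (fun g => c / 2 ≤ |codegreeEstimate k g A J - c|) (hcheb _ (by linarith) ?_) ?_
    · nlinarith
    · intro o ho
      have hnot : ¬ IsHeavy k h o A J := fun hh => ho ⟨fun _ => by linarith, fun h' => absurd hh h'⟩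
      unfold IsHeavy at hnot
      rw [hJ, ← hθ] at hnot
      have h2 := Finset.card_filter_add_card_filter_not (s := (Finset.univ : Finset (Fin M₁)))
        fun u => θ ≤ codegreeEstimate k (o u) A J
      rw [Finset.card_univ, Fintype.card_fin] at h2
      have h3 : (Finset.univ.filter fun u => ¬ θ ≤ codegreeEstimate k (o u) A J).card
          ≤ (Finset.univ.filter fun u => c / 2 ≤ |codegreeEstimate k (o u) A J - c|).card := by
        refine Finset.card_le_card fun u hu => ?_
        simp only [Finset.mem_filter, Finset.mem_univ, true_and, not_le] at hu ⊢
        rw [abs_sub_comm]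
        exact le_trans (by linarith) (le_abs_self _)
      omega
  · rcases lt_or_ge (2 * c) θ with hlt' | hge'
    · refine hmaj (fun g => θ / 2 ≤ |codegreeEstimate k g A J - c|) (hcheb _ (by linarith) ?_) ?_
      · nlinarith
      · intro o ho
        have hh : IsHeavy k h o A J := by
          by_contra hh
          exact ho ⟨fun h' => absurd h' hh, fun _ => hge⟩
        unfold IsHeavy at hh
        rw [hJ, ← hθ] at hh
        refine hh.trans (Nat.mul_le_mul_left 2 (Finset.card_le_card fun u hu => ?_))
        simp only [Finset.mem_filter, Finset.mem_univ, true_and] at hu ⊢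
        exact le_trans (by linarith) (le_abs_self _)
    · refine (prob_mono (q := fun _ => False) fun o ho => ho ⟨fun _ => hge', fun _ => hge⟩).trans ?_
      simp only [prob, if_false, ave, Finset.sum_const_zero, zero_div]
      positivity

theorem prob_not_oracleGood_le (k j : ℕ) (hj : j ≤ k) (hV : 0 < Fintype.card V)
    (h : ℝ) (h1 : 1 ≤ h) (hN : (N : ℝ) ≤ 2 * h)
    (hM : 2 ^ (2 * k + 8) ≤ M) (A : Finset (Finset V)) (hA : ∀ X ∈ A, X.card = k + 1)
    (hdeg : CodegreeBound k h A j) :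
    prob (fun o : Fin M₁ → Fin M → V → Fin N => ¬ OracleGood k h o A j)
      ≤ (Fintype.card V : ℝ) ^ k * Real.exp (-(M₁ / 4)) := by
  refine (prob_mono fun o ho => ?_).trans ((prob_exists_le_of_le
    ((Finset.univ : Finset V).powersetCard j) (fun J (o : Fin M₁ → Fin M → V → Fin N) =>
      ¬ ((IsHeavy k h o A J → h ^ (k + 1 - j) ≤ 2 * codegree A J) ∧
        (¬ IsHeavy k h o A J → (codegree A J : ℝ) ≤ 2 * h ^ (k + 1 - j)))) _ fun J hJ =>
      prob_not_isHeavy_correct_le k j h h1 hN hM A hA hdeg J (Finset.mem_powersetCard_univ.1 hJ)).trans ?_)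
  · unfold OracleGood at ho
    push Not at ho
    obtain ⟨J, hJ, hJ'⟩ := ho
    refine ⟨J, Finset.mem_powersetCard_univ.2 hJ, fun hcon => ?_⟩
    obtain ⟨h2, h3⟩ := hJ' hcon.1
    exact h3.not_ge (hcon.2 h2)
  · gcongr
    rw [Finset.card_powersetCard, Finset.card_univ]
    calc ((Fintype.card V).choose j : ℝ) ≤ (Fintype.card V : ℝ) ^ j := by
          exact_mod_cast Nat.choose_le_pow _ _
      _ ≤ _ := pow_le_pow_right₀ (by exact_mod_cast hV) hj

/-- The simplices of `G` without heavy subsets of more than `k - d` vertices. -/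
noncomputable def survivors (k : ℕ) (h : ℝ) (O : Fin (k + 1) → Fin M₁ → Fin M → V → Fin N)
    (G : Finset (Finset V)) : ℕ → Finset (Finset V)
  | 0 => simplicesOf k G
  | d + 1 => (survivors k h O G d).filter fun X => ∀ J ∈ X.powersetCard (k - d),
      ¬ IsHeavy k h (O (Fin.ofNat (k + 1) d)) (survivors k h O G d) J

theorem survivors_subset (k : ℕ) (h : ℝ) (O : Fin (k + 1) → Fin M₁ → Fin M → V → Fin N)
    (G : Finset (Finset V)) (d : ℕ) : survivors k h O G d ⊆ simplicesOf k G := by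
  induction d with
  | zero => exact le_rfl
  | succ d ih => exact (Finset.filter_subset _ _).trans ih

theorem card_of_mem_survivors {k : ℕ} {h : ℝ} {O : Fin (k + 1) → Fin M₁ → Fin M → V → Fin N}
    {G : Finset (Finset V)} {d : ℕ} {X : Finset V} (hX : X ∈ survivors k h O G d) :
    X.card = k + 1 := (mem_simplicesOf.1 (survivors_subset k h O G d hX)).1

/-- Level `d'` consults only oracles with index below `d'`. `Fin.ofNat` does not wrap around on the
indices up to `k`, so the updated oracle is none of these. -/
theorem survivors_update (k : ℕ) (h : ℝ) (O : Fin (k + 1) → Fin M₁ → Fin M → V → Fin N)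
    (G : Finset (Finset V)) (d : ℕ) (hd : d ≤ k) (o : Fin M₁ → Fin M → V → Fin N) (d' : ℕ)
    (hd' : d' ≤ d) :
    survivors k h (Function.update O (Fin.ofNat (k + 1) d) o) G d' = survivors k h O G d' := by
  induction d' with
  | zero => rfl
  | succ d' ih =>
    have hne : (Fin.ofNat (k + 1) d' : Fin (k + 1)) ≠ Fin.ofNat (k + 1) d := by
      intro heq
      have := congrArg Fin.val heq
      simp only [Fin.val_ofNat] at this
      rw [Nat.mod_eq_of_lt (by omega), Nat.mod_eq_of_lt (by omega)] at this
      omega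
    simp only [survivors]
    rw [ih (by omega), Function.update_of_ne hne]

/-- A `(k - d)`-set declared heavy lies in no survivor. One not declared heavy had small codegree
since the oracle is right, and codegrees only drop. -/
theorem codegreeBound_succ {k : ℕ} {h : ℝ} (h1 : 1 ≤ h)
    {O : Fin (k + 1) → Fin M₁ → Fin M → V → Fin N} {G : Finset (Finset V)} {d : ℕ} (hd : d < k)
    (hdeg : CodegreeBound k h (survivors k h O G d) (k - d))
    (hgood : OracleGood k h (O (Fin.ofNat (k + 1) d)) (survivors k h O G d) (k - d)) :
    CodegreeBound k h (survivors k h O G (d + 1)) (k - (d + 1)) := by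
  intro I hI
  have hsub : survivors k h O G (d + 1) ⊆ survivors k h O G d := Finset.filter_subset _ _
  rcases Nat.lt_or_ge (k - d) I.card with hlt | hge
  · exact hdeg.mono hsub I hlt
  · have hIc : I.card = k - d := by omega
    by_cases hh : IsHeavy k h (O (Fin.ofNat (k + 1) d)) (survivors k h O G d) I
    · have : codegree (survivors k h O G (d + 1)) I = 0 := by
        refine Finset.card_eq_zero.2 (Finset.filter_eq_empty_iff.2 fun X hX hIX => ?_)
        exact (Finset.mem_filter.1 hX).2 I (Finset.mem_powersetCard.2 ⟨hIX, hIc⟩) hh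
      rw [this]; simp; positivity
    · have := (hgood I hIc).2 hh
      rw [← hIc] at this
      exact le_trans (Nat.cast_le.2 (Finset.card_le_card (Finset.filter_subset_filter _ hsub))) this

/-- The oracle is right on all levels. -/
def AllGood (k : ℕ) (h : ℝ) (O : Fin (k + 1) → Fin M₁ → Fin M → V → Fin N)
    (G : Finset (Finset V)) : Prop :=
  ∀ d < k, CodegreeBound k h (survivors k h O G d) (k - d) →
    OracleGood k h (O (Fin.ofNat (k + 1) d)) (survivors k h O G d) (k - d)

theorem AllGood.codegreeBound {k : ℕ} {h : ℝ} (h1 : 1 ≤ h)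
    {O : Fin (k + 1) → Fin M₁ → Fin M → V → Fin N} {G : Finset (Finset V)}
    (hO : AllGood k h O G) : ∀ d ≤ k, CodegreeBound k h (survivors k h O G d) (k - d)
  | 0, _ => codegreeBound_zero k h h1 _ fun _ hX => (mem_simplicesOf.1 hX).1
  | d + 1, hd => codegreeBound_succ h1 hd (hO.codegreeBound h1 d (by omega))
      (hO d hd (hO.codegreeBound h1 d (by omega)))

/-- The implication in `AllGood` lets the levels be treated separately. With the other oracles
fixed, either the codegree bound at level `d` fails and there is nothing to show, or the fresh
oracle `d` is right with high probability. -/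
theorem prob_not_allGood_le (k : ℕ) (hV : 0 < Fintype.card V) (h : ℝ) (h1 : 1 ≤ h)
    (hN : (N : ℝ) ≤ 2 * h) (hM : 2 ^ (2 * k + 8) ≤ M) (G : Finset (Finset V)) :
    prob (fun O : Fin (k + 1) → Fin M₁ → Fin M → V → Fin N => ¬ AllGood k h O G)
      ≤ k * ((Fintype.card V : ℝ) ^ k * Real.exp (-(M₁ / 4))) := by
  refine (prob_mono fun O hO => ?_).trans ((prob_exists_le_of_le (Finset.range k)
    (fun d (O : Fin (k + 1) → Fin M₁ → Fin M → V → Fin N) =>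
      CodegreeBound k h (survivors k h O G d) (k - d) ∧
      ¬ OracleGood k h (O (Fin.ofNat (k + 1) d)) (survivors k h O G d) (k - d))
    ((Fintype.card V : ℝ) ^ k * Real.exp (-(M₁ / 4))) fun d hd => ?_).trans_eq (by simp))
  · unfold AllGood at hO
    push Not at hO
    obtain ⟨d, hd, h2, h3⟩ := hO
    exact ⟨d, Finset.mem_range.2 hd, h2, h3⟩
  · refine prob_pi_update_le (Fin.ofNat (k + 1) d) _ _ fun O => ?_
    simp only [survivors_update k h O G d (Finset.mem_range.1 hd).le _ d le_rfl,
      Function.update_self]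
    by_cases hdeg : CodegreeBound k h (survivors k h O G d) (k - d)
    · exact (prob_mono fun o ho => ho.2).trans
        (prob_not_oracleGood_le k (k - d) (by omega) hV h h1 hN hM _
          (fun X hX => card_of_mem_survivors hX) hdeg)
    · refine (prob_mono (q := fun _ => False) fun o ho => hdeg ho.1).trans ?_
      simp only [prob, if_false, ave, Finset.sum_const_zero, zero_div]
      positivity

end Oracle

/-! ### Counting simplices with heavy subsets -/

section Estimator

/-- Some element of a nonempty finite set of sets. -/
noncomputable def pick {V : Type*} (S : Finset (Finset V)) : Finset V :=
  if h : S.Nonempty then h.choose else ∅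

theorem pick_mem {V : Type*} {S : Finset (Finset V)} (h : S.Nonempty) : pick S ∈ S := by
  rw [pick, dif_pos h]
  exact h.choose_spec

variable {V : Type*} [Fintype V] [DecidableEq V] {N M M₀ M₁ : ℕ} [NeZero N]

/-- The heavy `j`-subsets of `X`. -/
noncomputable def heavySubsets (k : ℕ) (h : ℝ) (o : Fin M₁ → Fin M₀ → V → Fin N)
    (A : Finset (Finset V)) (j : ℕ) (X : Finset V) : Finset (Finset V) :=
  (X.powersetCard j).filter fun J => IsHeavy k h o A J

/-- The members of `A` that arise by adding sampled vertices to a designated heavy `j`-subset. -/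
noncomputable def heavyFound (k : ℕ) (h : ℝ) (o : Fin M₁ → Fin M₀ → V → Fin N)
    (A : Finset (Finset V)) (j : ℕ) (g : V → Fin N) : Finset (Finset V) :=
  A.filter fun X => (heavySubsets k h o A j X).Nonempty ∧
    ∀ v ∈ X \ pick (heavySubsets k h o A j X), g v = 0

/-- Double counting: a member of `A` has at most `2^(k+1)` subsets. -/
theorem sum_codegree (A : Finset (Finset V)) (k j : ℕ) (hA : ∀ X ∈ A, X.card = k + 1) :
    ∑ J ∈ (Finset.univ : Finset V).powersetCard j, codegree A J ≤ 2 ^ (k + 1) * A.card := by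
  simp only [codegree, Finset.card_filter]
  rw [Finset.sum_comm, mul_comm, ← smul_eq_mul]
  refine Finset.sum_le_card_nsmul _ _ _ fun X hX => ?_
  rw [← Finset.card_filter, ← hA X hX, ← Finset.card_powerset]
  exact Finset.card_le_card fun J hJ => Finset.mem_powerset.2 (Finset.mem_filter.1 hJ).2

/-- The number of members of `A` with a heavy `j`-subset is estimated by vertex sampling. -/
theorem ave_abs_heavyFound_sub_le (k j : ℕ) (h : ℝ) (h1 : 1 ≤ h)
    (hN : (N : ℝ) ≤ 2 * h) (hM : 0 < M) (o : Fin M₁ → Fin M₀ → V → Fin N)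
    (A : Finset (Finset V)) (hA : ∀ X ∈ A, X.card = k + 1) (hdeg : CodegreeBound k h A j)
    (hgood : OracleGood k h o A j) :
    (ave fun g : Fin M → V → Fin N =>
      |(∑ i, ((heavyFound k h o A j (g i)).card : ℝ) * (N : ℝ) ^ (k + 1 - j)) / M
        - (A.filter fun X => (heavySubsets k h o A j X).Nonempty).card|)
      ≤ √(2 ^ (2 * k + 4) / M) * (2 ^ (k + 1) * A.card) := by
  have hM' : (0 : ℝ) < M := by exact_mod_cast hM
  set s := (Finset.univ : Finset V).powersetCard j with hs
  -- Grouping by the designated heavy subset counts a simplex with several heavy subsets only once.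
  set B : Finset V → Finset (Finset V) := fun J => A.filter fun X =>
    (heavySubsets k h o A j X).Nonempty ∧ pick (heavySubsets k h o A j X) = J with hB
  have hpick : ∀ X, (heavySubsets k h o A j X).Nonempty →
      pick (heavySubsets k h o A j X) ∈ s ∧ pick (heavySubsets k h o A j X) ⊆ X ∧
      IsHeavy k h o A (pick (heavySubsets k h o A j X)) := by
    intro X hX
    obtain ⟨h2, h3⟩ := Finset.mem_filter.1 (pick_mem hX)
    obtain ⟨h4, h5⟩ := Finset.mem_powersetCard.1 h2
    exact ⟨Finset.mem_powersetCard_univ.2 h5, h4, h3⟩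
  have e1 : ∀ g : V → Fin N, ((heavyFound k h o A j g).card : ℝ)
      = ∑ J ∈ s, (((B J).filter fun X => ∀ v ∈ X \ J, g v = 0).card : ℝ) := by
    intro g
    rw [← Nat.cast_sum]
    congr 1
    rw [Finset.card_eq_sum_card_fiberwise (f := fun X => pick (heavySubsets k h o A j X)) (t := s)]
    · refine Finset.sum_congr rfl fun J _ => ?_
      congr 1
      ext X
      simp only [heavyFound, hB, Finset.mem_filter]
      constructor
      · rintro ⟨⟨ha, hb, hc⟩, rfl⟩; exact ⟨⟨ha, hb, rfl⟩, hc⟩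
      · rintro ⟨⟨ha, hb, rfl⟩, hc⟩; exact ⟨⟨ha, hb, hc⟩, rfl⟩
    · intro X hX
      exact (hpick X (Finset.mem_filter.1 hX).2.1).1
  have e2 : ((A.filter fun X => (heavySubsets k h o A j X).Nonempty).card : ℝ)
      = ∑ J ∈ s, ((B J).card : ℝ) := by
    rw [← Nat.cast_sum]
    congr 1
    rw [Finset.card_eq_sum_card_fiberwise (f := fun X => pick (heavySubsets k h o A j X)) (t := s)]
    · refine Finset.sum_congr rfl fun J _ => ?_
      rw [hB, Finset.filter_filter]
    · intro X hX
      exact (hpick X (Finset.mem_filter.1 hX).2).1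
  set F : Finset V → (Fin M → V → Fin N) → ℝ := fun J g =>
    (∑ i, (((B J).filter fun X => ∀ v ∈ X \ J, g i v = 0).card : ℝ) * (N : ℝ) ^ (k + 1 - j)) / M
      - (B J).card with hF
  have e3 : ∀ g : Fin M → V → Fin N,
      (∑ i, ((heavyFound k h o A j (g i)).card : ℝ) * (N : ℝ) ^ (k + 1 - j)) / M
        - (A.filter fun X => (heavySubsets k h o A j X).Nonempty).card = ∑ J ∈ s, F J g := by
    intro g
    rw [e2, hF, Finset.sum_sub_distrib, ← Finset.sum_div, Finset.sum_comm]
    congr 3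
    ext i
    rw [e1, Finset.sum_mul]
  -- The variance at `J` is at most `|B J| 2^(2k+3) h^(k+1-j) / M`, and heaviness replaces
  -- `h^(k+1-j)` by `2 * codegree A J`. The mean absolute deviation is thus proportional to the
  -- codegree, and such deviations may be summed over `J` without any independence.
  have key : ∀ J ∈ s, (ave fun g => |F J g|) ≤ √(2 ^ (2 * k + 4) / M) * codegree A J := by
    intro J hJ
    have hJc : J.card = j := Finset.mem_powersetCard_univ.1 hJ
    by_cases hheavy : IsHeavy k h o A J
    · have hsub : ∀ X ∈ B J, X ∈ A ∧ J ⊆ X := by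
        intro X hX
        obtain ⟨ha, hb, rfl⟩ := Finset.mem_filter.1 hX
        exact ⟨ha, (hpick X hb).2.1⟩
      obtain ⟨a1, a2⟩ := ave_sq_sampled_sub_le (N := N) k (k + 1 - j) (B J) J (fun X hX => by
        obtain ⟨hX, hJX⟩ := hsub X hX
        exact ⟨hJX, hA X hX, by rw [Finset.card_sdiff_of_subset hJX, hA X hX, hJc]⟩) h h1 hN
        (fun I hI => (hdeg.mono (Finset.filter_subset _ _)) I (hJc ▸ Finset.card_lt_card hI))
      have a3 := ave_sq_mean_sub_le M hM _ _ _ a1 a2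
      have a4 : ((B J).card : ℝ) ≤ codegree A J := Nat.cast_le.2 (Finset.card_le_card
        fun X hX => Finset.mem_filter.2 (hsub X hX))
      have a5 := (hgood J hJc).1 hheavy
      refine (ave_abs_le _ a3).trans ?_
      rw [← Real.sqrt_sq (Nat.cast_nonneg (codegree A J)), ← Real.sqrt_mul (by positivity)]
      refine Real.sqrt_le_sqrt ?_
      calc ((B J).card : ℝ) * (2 ^ (2 * k + 3) * h ^ (k + 1 - j)) / M
          ≤ (codegree A J : ℝ) * (2 ^ (2 * k + 3) * (2 * codegree A J)) / M := by gcongr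
        _ = _ := by ring
    · have : B J = ∅ := by
        refine Finset.filter_eq_empty_iff.2 fun X hX hcon => hheavy ?_
        rw [← hcon.2]
        exact (hpick X hcon.1).2.2
      have h0 : ∀ g, |F J g| = 0 := by intro g; simp [hF, this]
      simp only [h0, ave_const]
      positivity
  simp only [e3]
  calc _ ≤ ave fun g : Fin M → V → Fin N => ∑ J ∈ s, |F J g| :=
        ave_mono fun g => Finset.abs_sum_le_sum_abs _ _
    _ = ∑ J ∈ s, ave fun g => |F J g| := ave_sum _ _
    _ ≤ ∑ J ∈ s, √(2 ^ (2 * k + 4) / M) * codegree A J := Finset.sum_le_sum key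
    _ = √(2 ^ (2 * k + 4) / M) * ((∑ J ∈ s, codegree A J : ℕ) : ℝ) := by
        rw [← Finset.mul_sum, Nat.cast_sum]
    _ ≤ _ := by
        gcongr
        exact_mod_cast sum_codegree A k j hA

/-- The part of the estimate for simplices with heavy `(k - d)`-subsets. -/
noncomputable def levelEstimate (k : ℕ) (h : ℝ) (O : Fin (k + 1) → Fin M₁ → Fin M₀ → V → Fin N)
    (g : Fin M → V → Fin N) (G : Finset (Finset V)) (d : ℕ) : ℝ :=
  (∑ i, ((heavyFound k h (O (Fin.ofNat (k + 1) d)) (survivors k h O G d) (k - d) (g i)).card : ℝ)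
    * (N : ℝ) ^ (d + 1)) / M

theorem card_filter_heavySubsets (k : ℕ) (h : ℝ) (O : Fin (k + 1) → Fin M₁ → Fin M₀ → V → Fin N)
    (G : Finset (Finset V)) (d : ℕ) :
    (((survivors k h O G d).filter fun X => (heavySubsets k h (O (Fin.ofNat (k + 1) d))
      (survivors k h O G d) (k - d) X).Nonempty).card : ℝ)
      = (survivors k h O G d).card - (survivors k h O G (d + 1)).card := by
  rw [eq_sub_iff_add_eq, ← Nat.cast_add, Nat.cast_inj,
    ← Finset.card_filter_add_card_filter_not (s := survivors k h O G d)
      (fun X => (heavySubsets k h (O (Fin.ofNat (k + 1) d)) (survivors k h O G d) (k - d) X).Nonempty)]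
  congr 2
  rw [survivors]
  refine Finset.filter_congr fun X _ => ?_
  rw [Finset.not_nonempty_iff_eq_empty, heavySubsets, Finset.filter_eq_empty_iff]

/-- Level `d` estimates how many simplices are lost between `survivors` at `d` and at `d + 1`; these
losses telescope. -/
theorem ave_abs_sum_levelEstimate_sub_le (k D : ℕ) (hD : D ≤ k) (h : ℝ) (h1 : 1 ≤ h)
    (hN : (N : ℝ) ≤ 2 * h) (hM : 0 < M) (O : Fin (k + 1) → Fin M₁ → Fin M₀ → V → Fin N)
    (G : Finset (Finset V)) (hO : AllGood k h O G) :
    (ave fun g : Fin M → V → Fin N =>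
      |∑ d ∈ Finset.range D, levelEstimate k h O g G d
        - (((simplicesOf k G).card : ℝ) - (survivors k h O G D).card)|)
      ≤ k * (√(2 ^ (2 * k + 4) / M) * (2 ^ (k + 1) * (simplicesOf k G).card)) := by
  have e : ((simplicesOf k G).card : ℝ) - (survivors k h O G D).card
      = ∑ d ∈ Finset.range D, ((survivors k h O G d).card - (survivors k h O G (d + 1)).card : ℝ) := by
    rw [Finset.sum_range_sub']; rfl
  simp only [e, ← Finset.sum_sub_distrib]
  calc _ ≤ ave fun g : Fin M → V → Fin N => ∑ d ∈ Finset.range D, |levelEstimate k h O g G d -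
          ((survivors k h O G d).card - (survivors k h O G (d + 1)).card : ℝ)| :=
        ave_mono fun g => Finset.abs_sum_le_sum_abs _ _
    _ = ∑ d ∈ Finset.range D, ave fun g : Fin M → V → Fin N => |levelEstimate k h O g G d -
          ((survivors k h O G d).card - (survivors k h O G (d + 1)).card : ℝ)| := ave_sum _ _
    _ ≤ ∑ d ∈ Finset.range D,
          √(2 ^ (2 * k + 4) / M) * (2 ^ (k + 1) * (simplicesOf k G).card) := by
        refine Finset.sum_le_sum fun d hd => ?_
        have hd' : d < k := (Finset.mem_range.1 hd).trans_le hD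
        have hdeg := hO.codegreeBound h1 d hd'.le
        have := ave_abs_heavyFound_sub_le k (k - d) h h1 hN hM
          (O (Fin.ofNat (k + 1) d)) (survivors k h O G d)
          (fun X hX => card_of_mem_survivors hX) hdeg (hO d hd' hdeg)
        rw [card_filter_heavySubsets, show k + 1 - (k - d) = d + 1 by omega] at this
        refine this.trans ?_
        gcongr
        exact survivors_subset k h O G d
    _ ≤ _ := by
        rw [Finset.sum_const, Finset.card_range, nsmul_eq_mul]
        gcongr

end Estimator

/-! ### Accuracy of the whole estimate -/

section Accuracy

variable {V : Type*} [Fintype V] [LinearOrder V] {N N' M M₀ M₁ : ℕ} [NeZero N] [NeZero N']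

/-- The part of the estimate for simplices without heavy subsets. -/
noncomputable def lightEstimate (k r : ℕ) (h : ℝ) (O : Fin (k + 1) → Fin M₁ → Fin M₀ → V → Fin N)
    (f : Fin M → Finset V → Fin N') (G : Finset (Finset V)) : ℝ :=
  (∑ i, (((survivors k h O G (k - r)).filter fun X =>
    ∃ c, ∀ W ∈ windows k r X, f i W = c).card : ℝ) * (N' : ℝ) ^ (k + 1 - r)) / M

/-- Chebyshev's inequality: the variance is at most `2^(2k+3) T / M` times the number of survivors,
and both `T` and that number are at most the number of all simplices. -/
theorem prob_lightEstimate_le (k r a : ℕ) (hr : 0 < r) (ha : 0 < a) (ha2 : a ≤ 2)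
    (hk : k + 1 = 2 * r + a) (h ν T ε : ℝ) (h1 : 1 ≤ ν) (hν : ν ^ a = h) (hT : 0 ≤ T)
    (hhT : h ^ (k + 2) = T ^ 2) (hN' : (N' : ℝ) ≤ 2 * ν) (hM : 0 < M) (hε : 0 < ε)
    (O : Fin (k + 1) → Fin M₁ → Fin M₀ → V → Fin N)
    (G : Finset (Finset V)) (hO : AllGood k h O G) (hTG : T ≤ (simplicesOf k G).card)
    (hpos : 0 < (simplicesOf k G).card) :
    prob (fun f : Fin M → Finset V → Fin N' =>
      ε / 2 * (simplicesOf k G).card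
        ≤ |lightEstimate k r h O f G - (survivors k h O G (k - r)).card|)
      ≤ 2 ^ (2 * k + 5) / (ε ^ 2 * M) := by
  have hM' : (0 : ℝ) < M := by exact_mod_cast hM
  have hpos' : (0 : ℝ) < (simplicesOf k G).card := by exact_mod_cast hpos
  have hdeg := hO.codegreeBound (hν ▸ one_le_pow₀ h1) (k - r) (by omega)
  rw [show k - (k - r) = r by omega] at hdeg
  obtain ⟨e1, e2⟩ := ave_sq_colored_sub_le (N := N') k r a hr ha ha2 hk
    (survivors k h O G (k - r)) (fun X hX => card_of_mem_survivors hX) h ν T h1 hν hT hhT hN' hdeg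
  have e3 := ave_sq_mean_sub_le M hM _ _ _ e1 e2
  refine (prob_abs_sub_le (by positivity)).trans ?_
  rw [div_le_div_iff₀ (by positivity) (by positivity)]
  calc _ ≤ ((survivors k h O G (k - r)).card : ℝ) * (2 ^ (2 * k + 3) * T) / M * (ε ^ 2 * M) := by
        gcongr
        exact e3
    _ ≤ ((simplicesOf k G).card : ℝ) * (2 ^ (2 * k + 3) * (simplicesOf k G).card) / M
          * (ε ^ 2 * M) := by
        gcongr
        exact survivors_subset k h O G _
    _ = _ := by field_simp; ring

/-- The whole estimate is accurate with high probability. -/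
theorem prob_estimate_le (k r a : ℕ) (hr : 0 < r) (ha : 0 < a) (ha2 : a ≤ 2)
    (hk : k + 1 = 2 * r + a) (h ν T ε : ℝ) (h1 : 1 ≤ ν) (hν : ν ^ a = h) (hT : 0 ≤ T)
    (hhT : h ^ (k + 2) = T ^ 2) (hN : (N : ℝ) ≤ 2 * h) (hN' : (N' : ℝ) ≤ 2 * ν)
    (hV : 0 < Fintype.card V) (hM₀ : 2 ^ (2 * k + 8) ≤ M₀) (hε : 0 < ε) (hM : 0 < M)
    (G : Finset (Finset V)) (hTG : T ≤ (simplicesOf k G).card)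
    (hpos : 0 < (simplicesOf k G).card) :
    prob (fun ω : (Fin (k + 1) → Fin M₁ → Fin M₀ → V → Fin N) × (Fin M → V → Fin N) ×
        (Fin M → Finset V → Fin N') =>
      ¬ |∑ d ∈ Finset.range (k - r), levelEstimate k h ω.1 ω.2.1 G d
          + lightEstimate k r h ω.1 ω.2.2 G - (simplicesOf k G).card|
        ≤ ε * (simplicesOf k G).card)
      ≤ k * ((Fintype.card V : ℝ) ^ k * Real.exp (-(M₁ / 4)))
        + (k * (√(2 ^ (2 * k + 4) / M) * 2 ^ (k + 2)) / ε + 2 ^ (2 * k + 5) / (ε ^ 2 * M)) := by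
  have hh1 : 1 ≤ h := hν ▸ one_le_pow₀ h1
  have hpos' : (0 : ℝ) < (simplicesOf k G).card := by exact_mod_cast hpos
  set τ : ℝ := ((simplicesOf k G).card : ℝ) with hτ
  set β : ℝ := k * (√(2 ^ (2 * k + 4) / M) * 2 ^ (k + 2)) / ε + 2 ^ (2 * k + 5) / (ε ^ 2 * M)
    with hβ
  have hβ0 : 0 ≤ β := by positivity
  set E := fun ω : (Fin (k + 1) → Fin M₁ → Fin M₀ → V → Fin N) × (Fin M → V → Fin N) ×
      (Fin M → Finset V → Fin N') =>
    ∑ d ∈ Finset.range (k - r), levelEstimate k h ω.1 ω.2.1 G d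
          + lightEstimate k r h ω.1 ω.2.2 G - τ with hE
  -- Once the oracle is fixed and right, the error budget `ε τ` is split in halves: Markov's
  -- inequality for the heavy levels, Chebyshev's for the light part.
  have step : ∀ O : Fin (k + 1) → Fin M₁ → Fin M₀ → V → Fin N,
      prob (fun b : (Fin M → V → Fin N) × (Fin M → Finset V → Fin N') =>
        AllGood k h O G ∧ ¬ |E (O, b)| ≤ ε * τ) ≤ β := by
    intro O
    by_cases hO : AllGood k h O G
    · have p1 := (prob_le_ave_div (fun g => abs_nonneg _)
        (show (0 : ℝ) < ε / 2 * τ by positivity)).trans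
        (div_le_div_of_nonneg_right (ave_abs_sum_levelEstimate_sub_le (M := M) k (k - r)
          (by omega) h hh1 hN hM O G hO) (show (0 : ℝ) ≤ ε / 2 * τ by positivity))
      have p2 := prob_lightEstimate_le (N' := N') (M := M) k r a hr ha ha2 hk h ν T ε h1 hν hT hhT
        hN' hM hε O G hO hTG hpos
      rw [← prob_fst (Ω' := Fin M → Finset V → Fin N')] at p1
      rw [← prob_snd (Ω := Fin M → V → Fin N)] at p2
      refine (prob_mono fun b hb => ?_).trans ((prob_or_le _ _).trans
        ((add_le_add p1 p2).trans_eq ?_))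
      · by_contra hcon
        push Not at hcon
        obtain ⟨c1, c2⟩ := hcon
        refine hb.2 ?_
        have : E (O, b) = (∑ d ∈ Finset.range (k - r), levelEstimate k h O b.1 G d
            - (τ - (survivors k h O G (k - r)).card))
            + (lightEstimate k r h O b.2 G - (survivors k h O G (k - r)).card) := by
          rw [hE]; ring
        rw [this]
        refine (abs_add_le _ _).trans ?_
        linarith
      · rw [hβ]
        congr 1
        field_simp
        ring
    · refine (prob_mono (q := fun _ => False) fun b hb => hO hb.1).trans ?_
      simp only [prob, if_false, ave, Finset.sum_const_zero, zero_div]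
      exact hβ0
  have p3 := prob_not_allGood_le (M₁ := M₁) k hV h hh1 hN hM₀ G
  rw [← prob_fst (Ω' := (Fin M → V → Fin N) × (Fin M → Finset V → Fin N'))] at p3
  have p4 := prob_prod_le (fun ω => AllGood k h ω.1 G ∧ ¬ |E ω| ≤ ε * τ) β step
  refine (prob_mono fun ω hω => ?_).trans ((prob_or_le _ _).trans (add_le_add p3 p4))
  by_cases hO : AllGood k h ω.1 G
  · exact Or.inr ⟨hO, hω⟩
  · exact Or.inl hO

end Accuracy

/-! ### Locality: which edges the estimate depends on -/

section Locality

variable {V : Type*} [Fintype V] [DecidableEq V] {N M M₀ M₁ : ℕ} [NeZero N]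

theorem simplicesOf_mono {k : ℕ} {G E : Finset (Finset V)} (h : G ⊆ E) :
    simplicesOf k G ⊆ simplicesOf k E := fun _ hX =>
  mem_simplicesOf.2 ⟨(mem_simplicesOf.1 hX).1, (mem_simplicesOf.1 hX).2.trans h⟩

/-- If `X` arises from `J` by adding sampled vertices, then all its faces other than `J` contain
sampled vertices. -/
theorem mem_simplicesOf_of_sampled {k : ℕ} {G E : Finset (Finset V)} {X J : Finset V}
    {z : V → Prop} (hX : X ∈ simplicesOf k E) (hJ : J.card ≤ k)
    (hJG : J.card = k → J ∈ G) (hz : ∀ v ∈ X \ J, z v) (hG : ∀ e ∈ E, (∃ v ∈ e, z v) → e ∈ G) :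
    X ∈ simplicesOf k G := by
  obtain ⟨hXc, hXE⟩ := mem_simplicesOf.1 hX
  refine mem_simplicesOf.2 ⟨hXc, fun e he => ?_⟩
  obtain ⟨heX, hec⟩ := Finset.mem_powersetCard.1 he
  by_cases hex : ∃ v ∈ e, v ∈ X \ J
  · obtain ⟨v, hve, hv⟩ := hex
    exact hG e (hXE he) ⟨v, hve, hz v hv⟩
  · push Not at hex
    have heJ : e ⊆ J := fun v hv => by
      by_contra hvJ
      exact hex v hv (Finset.mem_sdiff.2 ⟨heX hv, hvJ⟩)
    have hJe : e = J := Finset.eq_of_subset_of_card_le heJ (by omega)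
    rw [hJe]
    exact hJG (by rw [← hJe, hec])

/-- The edges with a vertex that is sampled for the oracle suffice to consult the oracle. -/
theorem survivors_eq_filter (k : ℕ) (h : ℝ) (O : Fin (k + 1) → Fin M₁ → Fin M₀ → V → Fin N)
    {G E : Finset (Finset V)} (hGE : G ⊆ E)
    (hG : ∀ d u i, ∀ e ∈ E, (∃ v ∈ e, O d u i v = 0) → e ∈ G) (d : ℕ) :
    survivors k h O G d = (survivors k h O E d).filter (· ∈ simplicesOf k G) ∧
    ∀ J : Finset V, J.card = k - d → (J.card = k → J ∈ G) →
      (IsHeavy k h (O (Fin.ofNat (k + 1) d)) (survivors k h O G d) J ↔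
        IsHeavy k h (O (Fin.ofNat (k + 1) d)) (survivors k h O E d) J) := by
  have step : ∀ d, survivors k h O G d = (survivors k h O E d).filter (· ∈ simplicesOf k G) →
      ∀ J : Finset V, J.card = k - d → (J.card = k → J ∈ G) →
      (IsHeavy k h (O (Fin.ofNat (k + 1) d)) (survivors k h O G d) J ↔
        IsHeavy k h (O (Fin.ofNat (k + 1) d)) (survivors k h O E d) J) := by
    intro d hd J hJ hJG
    have e : ∀ u i, sampledAround (O (Fin.ofNat (k + 1) d) u i) (survivors k h O G d) J
        = sampledAround (O (Fin.ofNat (k + 1) d) u i) (survivors k h O E d) J := by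
      intro u i
      ext X
      simp only [sampledAround, hd, Finset.mem_filter]
      constructor
      · rintro ⟨⟨ha, -⟩, hb⟩; exact ⟨ha, hb⟩
      · rintro ⟨ha, hb, hc⟩
        exact ⟨⟨ha, mem_simplicesOf_of_sampled (survivors_subset k h O E d ha) (by omega) hJG hc
          (hG _ u i)⟩, hb, hc⟩
    unfold IsHeavy codegreeEstimate
    simp only [e]
  -- The two claims feed each other: equality of survivors at level `d` gives agreement of the
  -- oracle there, hence equality at level `d + 1`. For a simplex of `G` all `k`-subsets lie in `G`,
  -- so the side condition on `J` holds for its subsets.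
  suffices h1 : survivors k h O G d = (survivors k h O E d).filter (· ∈ simplicesOf k G) from
    ⟨h1, step d h1⟩
  induction d with
  | zero =>
    ext X
    simp only [survivors, Finset.mem_filter]
    exact ⟨fun hX => ⟨simplicesOf_mono hGE hX, hX⟩, fun hX => hX.2⟩
  | succ d ih =>
    have hs := step d ih
    ext X
    rw [survivors, survivors]
    simp only [Finset.mem_filter]
    rw [ih]
    simp only [Finset.mem_filter]
    rw [← ih]
    constructor
    · rintro ⟨⟨ha, hb⟩, hc⟩
      refine ⟨⟨ha, fun J hJ => ?_⟩, hb⟩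
      rw [← hs J (Finset.mem_powersetCard.1 hJ).2 fun hJk => (mem_simplicesOf.1 hb).2
        (Finset.mem_powersetCard.2 ⟨(Finset.mem_powersetCard.1 hJ).1, hJk⟩)]
      exact hc J hJ
    · rintro ⟨⟨ha, hc⟩, hb⟩
      refine ⟨⟨ha, hb⟩, fun J hJ => ?_⟩
      rw [hs J (Finset.mem_powersetCard.1 hJ).2 fun hJk => (mem_simplicesOf.1 hb).2
        (Finset.mem_powersetCard.2 ⟨(Finset.mem_powersetCard.1 hJ).1, hJk⟩)]
      exact hc J hJ

theorem heavySubsets_eq (k : ℕ) (h : ℝ) (O : Fin (k + 1) → Fin M₁ → Fin M₀ → V → Fin N)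
    {G E : Finset (Finset V)} (hGE : G ⊆ E)
    (hG : ∀ d u i, ∀ e ∈ E, (∃ v ∈ e, O d u i v = 0) → e ∈ G) (d : ℕ) {X : Finset V}
    (hX : (∀ J ∈ X.powersetCard (k - d), J.card = k → J ∈ G)) :
    heavySubsets k h (O (Fin.ofNat (k + 1) d)) (survivors k h O G d) (k - d) X
      = heavySubsets k h (O (Fin.ofNat (k + 1) d)) (survivors k h O E d) (k - d) X :=
  Finset.filter_congr fun J hJ => (survivors_eq_filter k h O hGE hG d).2 J
    (Finset.mem_powersetCard.1 hJ).2 (hX J hJ)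

/-- For `d > 0` the designated subset has fewer than `k` vertices, so every face contains a sampled
vertex and is stored. This breaks down for `d = 0`, where the designated subset is a face that may
be missing from `G`. -/
theorem heavyFound_eq (k : ℕ) (h : ℝ) (O : Fin (k + 1) → Fin M₁ → Fin M₀ → V → Fin N)
    {G E : Finset (Finset V)} (hGE : G ⊆ E)
    (hG : ∀ d u i, ∀ e ∈ E, (∃ v ∈ e, O d u i v = 0) → e ∈ G) (d : ℕ) (hd : 0 < d) (hk : 0 < k)
    (g : V → Fin N) (hg : ∀ e ∈ E, (∃ v ∈ e, g v = 0) → e ∈ G) :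
    heavyFound k h (O (Fin.ofNat (k + 1) d)) (survivors k h O G d) (k - d) g
      = heavyFound k h (O (Fin.ofNat (k + 1) d)) (survivors k h O E d) (k - d) g := by
  have hs := fun X : Finset V => heavySubsets_eq k h O hGE hG d (X := X) fun J hJ hJk => by
    have := (Finset.mem_powersetCard.1 hJ).2
    omega
  ext X
  simp only [heavyFound, Finset.mem_filter, hs]
  rw [(survivors_eq_filter k h O hGE hG d).1, Finset.mem_filter]
  constructor
  · rintro ⟨⟨ha, -⟩, hb⟩; exact ⟨ha, hb⟩
  · rintro ⟨ha, hb, hc⟩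
    obtain ⟨h2, h3⟩ := Finset.mem_powersetCard.1 (Finset.mem_filter.1 (pick_mem hb)).1
    exact ⟨⟨ha, mem_simplicesOf_of_sampled (survivors_subset k h O E d ha)
      (h3.trans_le (Nat.sub_le _ _)) (fun h4 => absurd (h3.symm.trans h4) (by omega)) hc hg⟩, hb, hc⟩

theorem heavySubsets_zero_eq (k : ℕ) (h : ℝ) (O : Fin (k + 1) → Fin M₁ → Fin M₀ → V → Fin N)
    {G E : Finset (Finset V)} (hGE : G ⊆ E)
    (hG : ∀ d u i, ∀ e ∈ E, (∃ v ∈ e, O d u i v = 0) → e ∈ G) {X : Finset V}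
    (hX : X ∈ simplicesOf k G) :
    heavySubsets k h (O 0) (simplicesOf k G) k X
      = heavySubsets k h (O 0) (simplicesOf k E) k X := by
  have h1 := heavySubsets_eq k h O hGE hG 0 (X := X) fun J hJ _ => by
    rw [Nat.sub_zero] at hJ
    exact (mem_simplicesOf.1 hX).2 hJ
  rw [Nat.sub_zero, survivors, survivors, show Fin.ofNat (k + 1) 0 = 0 from Fin.ext (Nat.zero_mod _)]
    at h1
  exact h1

theorem levelEstimate_zero (k : ℕ) (h : ℝ) (O : Fin (k + 1) → Fin M₁ → Fin M₀ → V → Fin N)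
    (g : Fin M → V → Fin N) (G : Finset (Finset V)) :
    levelEstimate k h O g G 0
      = ((∑ i, (heavyFound k h (O 0) (simplicesOf k G) k (g i)).card : ℕ) : ℝ) * N / M := by
  rw [levelEstimate, Nat.sub_zero, survivors,
    show Fin.ofNat (k + 1) 0 = 0 from Fin.ext (Nat.zero_mod _), ← Finset.sum_mul, Nat.cast_sum,
    zero_add, pow_one]

/-- What the arrival of the edge `e` adds to the count of simplices found at heavy edges, if `G`
is the set of stored edges. -/
noncomputable def arrivalCount (k : ℕ) (h : ℝ) (O : Fin (k + 1) → Fin M₁ → Fin M₀ → V → Fin N)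
    (g : Fin M → V → Fin N) (G : Finset (Finset V)) (e : Finset V) : ℕ :=
  ∑ i, ((heavyFound k h (O 0) (simplicesOf k (insert e G)) k (g i)).filter fun X =>
    pick (heavySubsets k h (O 0) (simplicesOf k (insert e G)) k X) = e).card

/-- A simplex found around its designated heavy edge `e` is counted at the arrival of `e` and at no
other time. Then `e` is known, all other faces contain sampled vertices, and `insert e G` still
contains all edges sampled for the oracle, so heaviness is judged as in `E`. -/
theorem sum_arrivalCount (k : ℕ) (h : ℝ) (O : Fin (k + 1) → Fin M₁ → Fin M₀ → V → Fin N)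
    {G E : Finset (Finset V)} (hGE : G ⊆ E)
    (hG : ∀ d u i, ∀ e ∈ E, (∃ v ∈ e, O d u i v = 0) → e ∈ G)
    (g : Fin M → V → Fin N) (hg : ∀ i, ∀ e ∈ E, (∃ v ∈ e, g i v = 0) → e ∈ G) :
    ∑ e ∈ E, arrivalCount k h O g G e
      = ∑ i, (heavyFound k h (O 0) (simplicesOf k E) k (g i)).card := by
  unfold arrivalCount
  rw [Finset.sum_comm]
  refine Finset.sum_congr rfl fun i _ => ?_
  rw [Finset.card_eq_sum_card_fiberwise
    (f := fun X => pick (heavySubsets k h (O 0) (simplicesOf k E) k X)) (t := E)]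
  · refine Finset.sum_congr rfl fun e he => ?_
    have hGE' : insert e G ⊆ E := Finset.insert_subset he hGE
    have hs : ∀ X ∈ simplicesOf k (insert e G),
        heavySubsets k h (O 0) (simplicesOf k (insert e G)) k X
          = heavySubsets k h (O 0) (simplicesOf k E) k X := fun X hX =>
      heavySubsets_zero_eq k h O hGE'
        (fun d u i e' he' hv => Finset.mem_insert_of_mem (hG d u i e' he' hv)) hX
    refine congrArg Finset.card (Finset.ext fun X => ?_)
    rw [Finset.mem_filter, Finset.mem_filter, heavyFound, heavyFound, Finset.mem_filter,
      Finset.mem_filter]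
    refine ⟨?_, ?_⟩
    · rintro ⟨⟨ha, hb, hc⟩, hp⟩
      rw [hs X ha] at hb hc hp
      exact ⟨⟨simplicesOf_mono hGE' ha, hb, hc⟩, hp⟩
    · rintro ⟨⟨ha, hb, hc⟩, hp⟩
      have h3 := (Finset.mem_powersetCard.1 (Finset.mem_filter.1 (pick_mem hb)).1).2
      have ha' : X ∈ simplicesOf k (insert e G) := mem_simplicesOf_of_sampled ha h3.le
        (fun _ => hp ▸ Finset.mem_insert_self _ _) hc
        (fun e' he' hv => Finset.mem_insert_of_mem (hg i e' he' hv))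
      rw [hs X ha']
      exact ⟨⟨ha', hb, hc⟩, hp⟩
  · intro X hX
    obtain ⟨ha, hb, hc⟩ := Finset.mem_filter.1 hX
    exact (mem_simplicesOf.1 ha).2 (Finset.mem_filter.1 (pick_mem hb)).1

/-- A crude bound: only the number of bits of the counter matters. -/
theorem arrivalCount_le (k : ℕ) (h : ℝ) (O : Fin (k + 1) → Fin M₁ → Fin M₀ → V → Fin N)
    (g : Fin M → V → Fin N) (G : Finset (Finset V)) (e : Finset V) :
    arrivalCount k h O g G e ≤ M * Fintype.card V ^ (k + 1) := by
  unfold arrivalCount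
  refine (Finset.sum_le_card_nsmul _ _ (Fintype.card V ^ (k + 1)) fun i _ => ?_).trans_eq (by simp)
  refine (Finset.card_le_card ((Finset.filter_subset _ _).trans ((Finset.filter_subset _ _).trans
    (Finset.filter_subset _ _)))).trans ?_
  rw [Finset.card_powersetCard, Finset.card_univ]
  exact Nat.choose_le_pow _ _

end Locality

/-! ### The stored edges: sufficiency and probability -/

section Storage

variable {V : Type*} [Fintype V] [LinearOrder V] {N N' M M₀ M₁ : ℕ} [NeZero N]

/-- The first pass stores the edges with a sampled vertex and those with `a + 1` different
`r`-subsets of one colour. -/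
def IsStored (r a : ℕ) {κ : Type*} (O : κ → Fin M₁ → Fin M₀ → V → Fin N) (g : Fin M → V → Fin N)
    (f : Fin M → Finset V → Fin N') (e : Finset V) : Prop :=
  (∃ d u i, ∃ v ∈ e, O d u i v = 0) ∨ (∃ i, ∃ v ∈ e, g i v = 0) ∨
    ∃ i, ∃ W ∈ (e.powersetCard r).powersetCard (a + 1), ∃ c, ∀ w ∈ W, f i w = c

noncomputable instance (r a : ℕ) {κ : Type*} (O : κ → Fin M₁ → Fin M₀ → V → Fin N)
    (g : Fin M → V → Fin N) (f : Fin M → Finset V → Fin N') (e : Finset V) :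
    Decidable (IsStored r a O g f e) :=
  Classical.dec _

/-- A face of `X` omits a single vertex, and at least `k + 2 - 2r = a + 1` windows avoid that
vertex. If all windows of `X` have one colour, every face therefore has `a + 1` `r`-subsets of that
colour and is stored. -/
theorem lightEstimate_eq (k r a : ℕ) (hr : 0 < r) (hk : k + 1 = 2 * r + a) (h : ℝ)
    (O : Fin (k + 1) → Fin M₁ → Fin M₀ → V → Fin N) (f : Fin M → Finset V → Fin N')
    {G E : Finset (Finset V)} (hGE : G ⊆ E)
    (hG : ∀ d u i, ∀ e ∈ E, (∃ v ∈ e, O d u i v = 0) → e ∈ G)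
    (hf : ∀ i, ∀ e ∈ E,
      (∃ W ∈ (e.powersetCard r).powersetCard (a + 1), ∃ c, ∀ w ∈ W, f i w = c) → e ∈ G) :
    lightEstimate k r h O f G = lightEstimate k r h O f E := by
  have e : ∀ i, (survivors k h O G (k - r)).filter (fun X => ∃ c, ∀ W ∈ windows k r X, f i W = c)
      = (survivors k h O E (k - r)).filter fun X => ∃ c, ∀ W ∈ windows k r X, f i W = c := by
    intro i
    rw [(survivors_eq_filter k h O hGE hG (k - r)).1]
    ext X
    simp only [Finset.mem_filter]
    constructor
    · rintro ⟨⟨ha, -⟩, hb⟩; exact ⟨ha, hb⟩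
    · rintro ⟨ha, c, hc⟩
      obtain ⟨hXc, hXE⟩ := mem_simplicesOf.1 (survivors_subset k h O E _ ha)
      refine ⟨⟨ha, mem_simplicesOf.2 ⟨hXc, fun e he => hf i e (hXE he) ?_⟩⟩, c, hc⟩
      obtain ⟨heX, hec⟩ := Finset.mem_powersetCard.1 he
      obtain ⟨x, hx⟩ := Finset.card_eq_one.1
        (show (X \ e).card = 1 by rw [Finset.card_sdiff_of_subset heX]; omega)
      have h1 := card_windows_erase (k := k) hr hXc x
      obtain ⟨W, hW, hWc⟩ := Finset.exists_subset_card_eq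
        (show a + 1 ≤ ((windows k r X).filter (x ∉ ·)).card by omega)
      refine ⟨W, Finset.mem_powersetCard.2 ⟨fun w hw => ?_, hWc⟩, c,
        fun w hw => hc w (Finset.mem_filter.1 (hW hw)).1⟩
      obtain ⟨hw1, hw2⟩ := Finset.mem_filter.1 (hW hw)
      obtain ⟨hw3, hw4⟩ := mem_windows hXc hw1 (by omega)
      refine Finset.mem_powersetCard.2 ⟨fun v hv => ?_, hw4⟩
      by_contra hve
      have : v ∈ X \ e := Finset.mem_sdiff.2 ⟨hw3 hv, hve⟩
      rw [hx, Finset.mem_singleton] at this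
      exact hw2 (this ▸ hv)
  unfold lightEstimate
  simp only [e]

/-- The estimate can be computed from the stored edges and the arrivals of the second pass. -/
theorem estimate_eq (k r a : ℕ) (hr : 0 < r) (hrk : r < k) (hk : k + 1 = 2 * r + a) (h : ℝ)
    (O : Fin (k + 1) → Fin M₁ → Fin M₀ → V → Fin N) (g : Fin M → V → Fin N)
    (f : Fin M → Finset V → Fin N') (E : Finset (Finset V)) :
    ((∑ e ∈ E, arrivalCount k h O g (E.filter (IsStored r a O g f)) e : ℕ) : ℝ) * N / M
      + ∑ d ∈ Finset.range (k - r - 1),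
          levelEstimate k h O g (E.filter (IsStored r a O g f)) (d + 1)
      + lightEstimate k r h O f (E.filter (IsStored r a O g f))
      = ∑ d ∈ Finset.range (k - r), levelEstimate k h O g E d + lightEstimate k r h O f E := by
  have hGE : E.filter (IsStored r a O g f) ⊆ E := Finset.filter_subset _ _
  have hG : ∀ d u i, ∀ e ∈ E, (∃ v ∈ e, O d u i v = 0) → e ∈ E.filter (IsStored r a O g f) :=
    fun d u i e he hv => Finset.mem_filter.2 ⟨he, Or.inl ⟨d, u, i, hv⟩⟩
  have hg : ∀ i, ∀ e ∈ E, (∃ v ∈ e, g i v = 0) → e ∈ E.filter (IsStored r a O g f) :=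
    fun i e he hv => Finset.mem_filter.2 ⟨he, Or.inr (Or.inl ⟨i, hv⟩)⟩
  have hf : ∀ i, ∀ e ∈ E,
      (∃ W ∈ (e.powersetCard r).powersetCard (a + 1), ∃ c, ∀ w ∈ W, f i w = c) →
        e ∈ E.filter (IsStored r a O g f) :=
    fun i e he hv => Finset.mem_filter.2 ⟨he, Or.inr (Or.inr ⟨i, hv⟩)⟩
  have hl : ∀ d, levelEstimate k h O g (E.filter (IsStored r a O g f)) (d + 1)
      = levelEstimate k h O g E (d + 1) := by
    intro d
    unfold levelEstimate
    simp only [fun i => heavyFound_eq k h O hGE hG (d + 1) d.succ_pos (by omega) (g i) (hg i)]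
  rw [lightEstimate_eq k r a hr hk h O f hGE hG hf]
  obtain ⟨D, hD⟩ : ∃ D, k - r = D + 1 := ⟨k - r - 1, by omega⟩
  rw [hD, Finset.sum_range_succ', sum_arrivalCount k h O hGE hG g hg, levelEstimate_zero,
    Nat.add_sub_cancel]
  simp only [hl]
  ring

theorem prob_sampled_vertex_le (e : Finset V) :
    prob (fun g : V → Fin N => ∃ v ∈ e, g v = 0) ≤ e.card * (1 / (N : ℝ)) :=
  prob_exists_le_of_le e (fun v (g : V → Fin N) => g v = 0) _ fun v _ => by
    have := prob_forall_eq (N := N) {v} fun _ => 0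
    simp only [Finset.mem_singleton, forall_eq, Finset.card_singleton, pow_one] at this
    exact this.le

/-- Union bound. Each of the `(k+1) M₁ M₀ + M` vertex samples hits `e` with probability at most `k /
h`. In each of the `M` colourings, `a + 1` given `r`-sets share a colour with probability at most
`N'^(-a) ≤ ν^(-a) = 1/h`, and `e` has at most `2^(2^k)` such families. -/
theorem prob_isStored_le [NeZero N'] (k r a : ℕ) (e : Finset V) (he : e.card = k) (h ν : ℝ) (h1 : 1 ≤ ν)
    (hν : ν ^ a = h) (hN : h ≤ N) (hN' : ν ≤ N') :
    prob (fun ω : (Fin (k + 1) → Fin M₁ → Fin M₀ → V → Fin N) × (Fin M → V → Fin N) ×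
        (Fin M → Finset V → Fin N') => IsStored r a ω.1 ω.2.1 ω.2.2 e)
      ≤ (((k + 1) * M₁ * M₀ + M) * k + M * 2 ^ 2 ^ k : ℕ) / h := by
  have hh : 1 ≤ h := hν ▸ one_le_pow₀ h1
  have hv : prob (fun g : V → Fin N => ∃ v ∈ e, g v = 0) ≤ k / h := by
    refine (prob_sampled_vertex_le e).trans ?_
    rw [he, mul_one_div]
    gcongr
  have p1 : prob (fun O : Fin (k + 1) → Fin M₁ → Fin M₀ → V → Fin N =>
      ∃ d u i, ∃ v ∈ e, O d u i v = 0) ≤ ((k + 1) * M₁ * M₀ : ℕ) * (k / h) := by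
    refine (prob_mono fun O hO => ?_).trans ((prob_exists_le_of_le
      (Finset.univ : Finset (Fin (k + 1) × Fin M₁ × Fin M₀))
      (fun x (O : Fin (k + 1) → Fin M₁ → Fin M₀ → V → Fin N) => ∃ v ∈ e, O x.1 x.2.1 x.2.2 v = 0)
      (k / h) fun x _ => ?_).trans_eq ?_)
    · obtain ⟨d, u, i, hv⟩ := hO
      exact ⟨(d, u, i), Finset.mem_univ _, hv⟩
    · rw [prob_pi_apply x.1 fun o : Fin M₁ → Fin M₀ → V → Fin N => ∃ v ∈ e, o x.2.1 x.2.2 v = 0,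
        prob_pi_apply x.2.1 fun o : Fin M₀ → V → Fin N => ∃ v ∈ e, o x.2.2 v = 0,
        prob_pi_apply x.2.2 fun o : V → Fin N => ∃ v ∈ e, o v = 0]
      exact hv
    · rw [Finset.card_univ]; simp [mul_assoc]
  have p2 : prob (fun g : Fin M → V → Fin N => ∃ i, ∃ v ∈ e, g i v = 0) ≤ (M : ℕ) * (k / h) := by
    refine (prob_mono fun O hO => ?_).trans ((prob_exists_le_of_le
      (Finset.univ : Finset (Fin M)) (fun x (O : Fin M → V → Fin N) => ∃ v ∈ e, O x v = 0)
      (k / h) fun x _ => ?_).trans_eq (by simp))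
    · obtain ⟨i, hv⟩ := hO
      exact ⟨i, Finset.mem_univ _, hv⟩
    · rw [prob_pi_apply x fun o : V → Fin N => ∃ v ∈ e, o v = 0]
      exact hv
  have p3 : prob (fun f : Fin M → Finset V → Fin N' =>
      ∃ i, ∃ W ∈ (e.powersetCard r).powersetCard (a + 1), ∃ c, ∀ w ∈ W, f i w = c)
      ≤ (M : ℕ) * ((2 ^ 2 ^ k : ℕ) * (1 / h)) := by
    refine (prob_mono fun f hf => ?_).trans ((prob_exists_le_of_le
      (Finset.univ : Finset (Fin M)) (fun x (f : Fin M → Finset V → Fin N') =>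
        ∃ W ∈ (e.powersetCard r).powersetCard (a + 1), ∃ c, ∀ w ∈ W, f x w = c)
      _ fun x _ => ?_).trans_eq (by rw [Finset.card_univ, Fintype.card_fin]))
    · obtain ⟨i, hv⟩ := hf
      exact ⟨i, Finset.mem_univ _, hv⟩
    · rw [prob_pi_apply x fun o : Finset V → Fin N' =>
        ∃ W ∈ (e.powersetCard r).powersetCard (a + 1), ∃ c, ∀ w ∈ W, o w = c]
      refine (prob_exists_le_of_le _ (fun W (o : Finset V → Fin N') => ∃ c, ∀ w ∈ W, o w = c)
        (1 / h) fun W hW => ?_).trans ?_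
      · refine (prob_const_on_le W).trans ?_
        have hN0 : (0 : ℝ) < N' := by linarith
        rw [(Finset.mem_powersetCard.1 hW).2, pow_succ, mul_left_comm, mul_one_div_cancel hN0.ne',
          mul_one, one_div_pow]
        rw [← hν]
        gcongr
      · gcongr
        rw [Finset.card_powersetCard, Finset.card_powersetCard, he]
        refine (Nat.choose_le_two_pow _ _).trans ?_
        exact Nat.pow_le_pow_right (by norm_num) (Nat.choose_le_two_pow _ _)
  rw [← prob_fst (Ω' := (Fin M → V → Fin N) × (Fin M → Finset V → Fin N'))] at p1
  rw [← prob_fst (Ω' := Fin M → Finset V → Fin N'),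
    ← prob_snd (Ω := Fin (k + 1) → Fin M₁ → Fin M₀ → V → Fin N)] at p2
  rw [← prob_snd (Ω := Fin M → V → Fin N),
    ← prob_snd (Ω := Fin (k + 1) → Fin M₁ → Fin M₀ → V → Fin N)] at p3
  refine (prob_or_le _ _).trans ((add_le_add p1 ((prob_or_le _ _).trans
    (add_le_add p2 p3))).trans_eq ?_)
  push_cast
  ring

end Storage

/-! ### One deterministic copy of the algorithm and its memory -/

section BaseAlgorithm

variable {n : ℕ}

/-- A set of vertices as a finite set. -/
noncomputable def toFin (x : Set (Fin n)) : Finset (Fin n) := (Set.toFinite x).toFinset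

/-- One step of the base algorithm. In the first pass it counts the symbols and collects those
that satisfy `stored`, but gives up once they are too many; in the second pass it adds up
`arrival`. -/
noncomputable def baseStep (stored : Finset (Fin n) → Prop) [DecidablePred stored]
    (arrival : Finset (Finset (Fin n)) → Finset (Fin n) → ℕ) (κ : ℝ) (i : Fin 2)
    (x : Set (Fin n)) (s : Option (ℕ × Finset (Finset (Fin n)) × ℕ)) :
    Option (ℕ × Finset (Finset (Fin n)) × ℕ) :=
  s.bind fun s =>
    if i = 0 then
      let D := if stored (toFin x) then insert (toFin x) s.2.1 else s.2.1
      -- The cap is proportional to the number of symbols read so far, since the length of the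
      -- stream is not known in advance.
      if (D.card : ℝ) ≤ κ * ((s.1 + 1 : ℕ) : ℝ) then some (s.1 + 1, D, s.2.2) else none
    else some (s.1, s.2.1, s.2.2 + arrival s.2.1 (toFin x))

/-- The finite sets that occur in a list. -/
noncomputable def edgesOf (ρ : List (Set (Fin n))) : Finset (Finset (Fin n)) :=
  (ρ.map toFin).toFinset

variable (stored : Finset (Fin n) → Prop) [DecidablePred stored]
  (arrival : Finset (Finset (Fin n)) → Finset (Fin n) → ℕ) (κ : ℝ)

theorem runDet_append {α S : Type} {p : ℕ} (step : Fin p → α → S → S) (s : S)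
    (rs rs' : List (Fin p × α)) :
    runDet step s (rs ++ rs') = runDet step (runDet step s rs) rs' := by
  simp [runDet, List.foldl_append]

theorem runDet_baseStep_first (ρ : List (Set (Fin n)))
    (hcap : ∀ j ≤ ρ.length, (((edgesOf (ρ.take j)).filter stored).card : ℝ) ≤ κ * j) :
    runDet (baseStep stored arrival κ) (some (0, ∅, 0)) (ρ.map fun x => ((0 : Fin 2), x))
      = some (ρ.length, (edgesOf ρ).filter stored, 0) := by
  induction ρ using List.reverseRecOn with
  | nil => rfl
  | append_singleton ρ x ih =>
    have hD : (edgesOf (ρ ++ [x])).filter stored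
        = if stored (toFin x) then insert (toFin x) ((edgesOf ρ).filter stored)
          else (edgesOf ρ).filter stored := by
      have : edgesOf (ρ ++ [x]) = insert (toFin x) (edgesOf ρ) := by
        ext e; simp [edgesOf, eq_comm]
      rw [this, Finset.filter_insert]
    have h1 := hcap (ρ.length + 1) (by simp)
    rw [List.take_of_length_le (by simp), hD] at h1
    rw [List.map_append, runDet_append, ih fun j hj => by
      have := hcap j (by simp; omega)
      rwa [List.take_append_of_le_length hj] at this, hD]
    simp only [runDet, List.map_cons, List.map_nil, List.foldl_cons, List.foldl_nil, baseStep,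
      Option.bind_some, if_true, List.length_append, List.length_cons, List.length_nil, zero_add]
    rw [if_pos h1]

theorem runDet_baseStep_second (ρ : List (Set (Fin n))) (t : ℕ) (D : Finset (Finset (Fin n)))
    (z : ℕ) :
    runDet (baseStep stored arrival κ) (some (t, D, z)) (ρ.map fun x => ((1 : Fin 2), x))
      = some (t, D, z + (ρ.map fun x => arrival D (toFin x)).sum) := by
  induction ρ generalizing z with
  | nil => rfl
  | cons x ρ ih =>
    rw [List.map_cons, List.map_cons, List.sum_cons, ← add_assoc, ← ih]
    rfl

theorem reads_two {α : Type} (σ : List α) :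
    StreamingAlgorithm.reads 2 σ
      = (σ.map fun x => ((0 : Fin 2), x)) ++ σ.map fun x => ((1 : Fin 2), x) := by
  simp [StreamingAlgorithm.reads, List.finRange_succ]

theorem length_of_prefix_reads {α : Type} {σ : List α} {rs : List (Fin 2 × α)}
    (h : rs <+: StreamingAlgorithm.reads 2 σ) : rs.length ≤ 2 * σ.length := by
  have := h.length_le
  rw [reads_two] at this
  simp at this
  omega

theorem mem_of_prefix_reads {α : Type} {σ : List α} {rs : List (Fin 2 × α)}
    (h : rs <+: StreamingAlgorithm.reads 2 σ) {x : Fin 2 × α} (hx : x ∈ rs) : x.2 ∈ σ := by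
  have := h.subset hx
  rw [reads_two] at this
  simp only [List.mem_append, List.mem_map] at this
  rcases this with ⟨y, hy, rfl⟩ | ⟨y, hy, rfl⟩ <;> exact hy

/-- What the base algorithm keeps in memory. -/
theorem baseStep_invariant (hκ : 0 ≤ κ) (k B : ℕ) (hB : ∀ D e, arrival D e ≤ B)
    (rs : List (Fin 2 × Set (Fin n))) (hrs : ∀ x ∈ rs, (toFin x.2).card = k) :
    ∀ s ∈ runDet (baseStep stored arrival κ) (some (0, ∅, 0)) rs,
      s.1 ≤ rs.length ∧ (s.2.1.card : ℝ) ≤ κ * rs.length ∧ (∀ e ∈ s.2.1, e.card = k) ∧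
        s.2.2 ≤ rs.length * B := by
  induction rs using List.reverseRecOn with
  | nil =>
    rintro s hs
    simp only [runDet, List.foldl_nil, Option.mem_some_iff] at hs
    subst hs
    simp
  | append_singleton rs x ih =>
    intro s hs
    have ih' := ih fun y hy => hrs y (by simp [hy])
    have hx := hrs x (by simp)
    rw [runDet_append] at hs
    simp only [runDet, List.foldl_cons, List.foldl_nil] at hs ih'
    rw [baseStep, Option.mem_def, Option.bind_eq_some_iff] at hs
    obtain ⟨s', hs', hs⟩ := hs
    obtain ⟨a1, a2, a3, a4⟩ := ih' s' hs'
    rw [List.length_append, List.length_singleton]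
    by_cases c1 : x.1 = 0
    · rw [if_pos c1] at hs
      set D := if stored (toFin x.2) then insert (toFin x.2) s'.2.1 else s'.2.1 with hD
      by_cases c2 : (D.card : ℝ) ≤ κ * ((s'.1 + 1 : ℕ) : ℝ)
      · have hs2 : some (s'.1 + 1, D, s'.2.2) = some s := (if_pos c2).symm.trans hs
        cases hs2
        refine ⟨by simpa using a1, c2.trans (by gcongr), fun e he => ?_,
          a4.trans (Nat.mul_le_mul_right _ (by omega))⟩
        change e ∈ D at he
        rw [hD] at he
        split_ifs at he
        · rcases Finset.mem_insert.1 he with rfl | he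
          · exact hx
          · exact a3 e he
        · exact a3 e he
      · have hs2 : none = some s := (if_neg c2).symm.trans hs
        cases hs2
    · rw [if_neg c1] at hs
      cases hs
      refine ⟨a1.trans (by omega), a2.trans (by push_cast; gcongr; linarith), a3, ?_⟩
      have := hB s'.2.1 (toFin x.2)
      change s'.2.2 + arrival s'.2.1 (toFin x.2) ≤ _
      rw [add_mul, one_mul]
      omega

/-- The code of the memory of the base algorithm. -/
noncomputable def baseCode (n : ℕ) : PrefixCode (Option (ℕ × Finset (Finset (Fin n)) × ℕ)) :=
  (PrefixCode.nat.prod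
    ((PrefixCode.nat.comap Fin.val Fin.val_injective).finset.finset.prod PrefixCode.nat)).option

/-- A number of size `s` takes `2s + 1` bits, a list one extra bit per entry and one at its end. The
final `5` collects these end bits from the two numbers, the set and the option. -/
theorem length_baseCode_le (n k m a b : ℕ) (s : Option (ℕ × Finset (Finset (Fin n)) × ℕ))
    (hs : ∀ x ∈ s, x.1 < 2 ^ a ∧ x.2.1.card ≤ m ∧ (∀ e ∈ x.2.1, e.card = k) ∧ x.2.2 < 2 ^ b) :
    ((baseCode n).enc s).length ≤ m * (k * (2 * n.size + 2) + 2) + 2 * a + 2 * b + 5 := by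
  cases s with
  | none =>
    change [false].length ≤ _
    simp
  | some x =>
    obtain ⟨h1, h2, h3, h4⟩ := hs x rfl
    have e1 : ∀ v : Fin n, ((PrefixCode.nat.comap Fin.val Fin.val_injective).enc v).length
        ≤ 2 * n.size + 1 := by
      intro v
      change (PrefixCode.nat.enc v.val).length ≤ _
      rw [PrefixCode.length_nat]
      have := Nat.size_le_size v.isLt.le
      omega
    have e2 : ∀ e ∈ x.2.1, ((PrefixCode.nat.comap Fin.val Fin.val_injective).finset.enc e).length
        ≤ k * (2 * n.size + 2) + 1 := by
      intro e he
      refine (PrefixCode.length_finset_le _ e (2 * n.size + 1) fun v _ => e1 v).trans ?_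
      rw [h3 e he]
    have e3 : ((PrefixCode.nat.comap Fin.val Fin.val_injective).finset.finset.enc x.2.1).length
        ≤ x.2.1.card * (k * (2 * n.size + 2) + 2) + 1 := PrefixCode.length_finset_le _ x.2.1 _ e2
    have e4 := Nat.mul_le_mul_right (k * (2 * n.size + 2) + 2) h2
    have e5 := Nat.size_le.2 h1
    have e6 := Nat.size_le.2 h4
    have e7 := PrefixCode.length_list_le (PrefixCode.nat.prod
      ((PrefixCode.nat.comap Fin.val Fin.val_injective).finset.finset.prod PrefixCode.nat)) [x]
      (m * (k * (2 * n.size + 2) + 2) + 2 * a + 2 * b + 3) (by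
        intro y hy
        rw [List.mem_singleton] at hy
        subst hy
        change (PrefixCode.nat.enc y.1 ++ (_ ++ PrefixCode.nat.enc y.2.2)).length ≤ _
        rw [List.length_append, List.length_append, PrefixCode.length_nat, PrefixCode.length_nat]
        omega)
    refine e7.trans ?_
    simp

end BaseAlgorithm

/-! ### The storage cap is rarely exceeded -/

section Capacity

variable {n : ℕ} {Ω : Type*} [Fintype Ω]

/-- The number of stored edges is rarely much larger than expected at any time. -/
theorem prob_overflow_le (stored : Ω → Finset (Fin n) → Prop) [∀ ω, DecidablePred (stored ω)]
    (σ : List (Set (Fin n))) (q κ : ℝ) (hκ : 0 < κ)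
    (hq : ∀ x ∈ σ, prob (fun ω => stored ω (toFin x)) ≤ q) (hq0 : 0 ≤ q) :
    prob (fun ω => ¬ ∀ j ≤ σ.length,
      (((edgesOf (σ.take j)).filter (stored ω)).card : ℝ) ≤ κ * j)
      ≤ q * (1 + Real.log σ.length) / κ := by
  classical
  -- The weight `1/(i+1)` is at least `1/j` for every prefix of length `j` that contains position
  -- `i`. So the single variable `Q` bounds the stored fraction of all prefixes at once, and its
  -- mean is at most `q` times a harmonic number.
  set Q : Ω → ℝ := fun ω => ∑ i : Fin σ.length,
    if stored ω (toFin (σ.get i)) then (1 / ((i : ℝ) + 1)) else 0 with hQ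
  have hQ0 : ∀ ω, 0 ≤ Q ω := fun ω => Finset.sum_nonneg fun i _ => by
    split_ifs <;> positivity
  have hcard : ∀ ω j, (((edgesOf (σ.take j)).filter (stored ω)).card : ℝ) ≤ j * Q ω := by
    intro ω j
    have hsub : (edgesOf (σ.take j)).filter (stored ω) ⊆
        ((Finset.univ : Finset (Fin σ.length)).filter
          fun i : Fin σ.length => (i : ℕ) < j ∧ stored ω (toFin (σ.get i))).image fun i => toFin (σ.get i) := by
      intro e he
      obtain ⟨he, hs⟩ := Finset.mem_filter.1 he
      simp only [edgesOf, List.mem_toFinset, List.mem_map] at he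
      obtain ⟨x, hx, rfl⟩ := he
      obtain ⟨i, hi, rfl⟩ := List.mem_take_iff_getElem.1 hx
      refine Finset.mem_image.2 ⟨⟨i, by omega⟩, Finset.mem_filter.2 ⟨Finset.mem_univ _, ?_, hs⟩, rfl⟩
      change i < j
      omega
    calc _ ≤ (((Finset.univ : Finset (Fin σ.length)).filter
          fun i : Fin σ.length => (i : ℕ) < j ∧ stored ω (toFin (σ.get i))).card : ℝ) :=
          Nat.cast_le.2 ((Finset.card_le_card hsub).trans Finset.card_image_le)
      _ = ∑ i : Fin σ.length, if (i : ℕ) < j ∧ stored ω (toFin (σ.get i)) then (1 : ℝ) else 0 := by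
          rw [Finset.sum_boole]
      _ ≤ _ := by
          rw [hQ, Finset.mul_sum]
          refine Finset.sum_le_sum fun i _ => ?_
          by_cases hs : stored ω (toFin (σ.get i))
          · by_cases hj : (i : ℕ) < j
            · rw [if_pos ⟨hj, hs⟩, if_pos hs, mul_one_div, one_le_div (by positivity)]
              exact_mod_cast hj
            · rw [if_neg fun h => hj h.1, if_pos hs]; positivity
          · rw [if_neg fun h => hs h.2, if_neg hs, mul_zero]
  have have_ave : ave Q ≤ q * (1 + Real.log σ.length) := by
    rw [hQ, ave_sum]
    calc _ ≤ ∑ i : Fin σ.length, q * (1 / ((i : ℝ) + 1)) := by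
          refine Finset.sum_le_sum fun i _ => ?_
          have : (ave fun ω => if stored ω (toFin (σ.get i)) then (1 / ((i : ℝ) + 1)) else 0)
              = 1 / ((i : ℝ) + 1) * prob fun ω => stored ω (toFin (σ.get i)) := by
            unfold prob
            rw [← ave_const_mul]
            congr 1; ext ω
            split_ifs <;> simp
          rw [this, mul_comm]
          gcongr
          exact hq _ (List.get_mem _ _)
      _ = q * (harmonic σ.length : ℝ) := by
          rw [← Finset.mul_sum, harmonic, Fin.sum_univ_eq_sum_range (fun i => 1 / ((i : ℝ) + 1))]
          push_cast
          simp
      _ ≤ _ := by gcongr; exact harmonic_le_one_add_log _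
  refine (prob_mono fun ω hω => ?_).trans ((prob_le_ave_div hQ0 hκ).trans (by gcongr))
  by_contra hcon
  refine hω fun j _ => (hcard ω j).trans ?_
  rw [mul_comm]
  push Not at hcon
  gcongr

end Capacity

/-! ### Failure probability of one copy -/

section Correctness

variable {n N N' M M₀ M₁ : ℕ} [NeZero N]

theorem toFin_injective : Function.Injective (toFin (n := n)) := fun x y h => by
  have := congrArg (fun s : Finset (Fin n) => (s : Set (Fin n))) h
  simpa [toFin] using this

/-- The output of the base algorithm. -/
noncomputable def baseOutput (k r : ℕ) (h : ℝ)
    (ω : (Fin (k + 1) → Fin M₁ → Fin M₀ → Fin n → Fin N) × (Fin M → Fin n → Fin N) ×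
      (Fin M → Finset (Fin n) → Fin N')) :
    Option (ℕ × Finset (Finset (Fin n)) × ℕ) → ℝ
  | none => 0
  | some s => (s.2.2 : ℝ) * N / M
      + ∑ d ∈ Finset.range (k - r - 1), levelEstimate k h ω.1 ω.2.1 s.2.1 (d + 1)
      + lightEstimate k r h ω.1 ω.2.2 s.2.1

/-- The base algorithm with the random functions `ω`. -/
noncomputable def baseAlgorithm (k r a : ℕ) (h κ : ℝ)
    (ω : (Fin (k + 1) → Fin M₁ → Fin M₀ → Fin n → Fin N) × (Fin M → Fin n → Fin N) ×
      (Fin M → Finset (Fin n) → Fin N')) :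
    Fin 2 → Set (Fin n) → Option (ℕ × Finset (Finset (Fin n)) × ℕ) →
      Option (ℕ × Finset (Finset (Fin n)) × ℕ) :=
  baseStep (IsStored r a ω.1 ω.2.1 ω.2.2) (arrivalCount k h ω.1 ω.2.1) κ

theorem baseOutput_eq (k r a : ℕ) (hr : 0 < r) (hrk : r < k) (hk : k + 1 = 2 * r + a) (h κ : ℝ)
    (ω : (Fin (k + 1) → Fin M₁ → Fin M₀ → Fin n → Fin N) × (Fin M → Fin n → Fin N) ×
      (Fin M → Finset (Fin n) → Fin N'))
    (σ : List (Set (Fin n))) (hσ : σ.Nodup)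
    (hcap : ∀ j ≤ σ.length, (((edgesOf (σ.take j)).filter
      (IsStored r a ω.1 ω.2.1 ω.2.2)).card : ℝ) ≤ κ * j) :
    baseOutput k r h ω (runDet (baseAlgorithm k r a h κ ω) (some (0, ∅, 0))
      (StreamingAlgorithm.reads 2 σ))
      = ∑ d ∈ Finset.range (k - r), levelEstimate k h ω.1 ω.2.1 (edgesOf σ) d
        + lightEstimate k r h ω.1 ω.2.2 (edgesOf σ) := by
  rw [reads_two, runDet_append, baseAlgorithm, runDet_baseStep_first _ _ _ _ hcap,
    runDet_baseStep_second, zero_add, baseOutput,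
    ← estimate_eq k r a hr hrk hk h ω.1 ω.2.1 ω.2.2 (edgesOf σ)]
  rw [edgesOf, List.sum_toFinset _ (hσ.map toFin_injective), List.map_map]
  rfl

theorem prob_baseAlgorithm_le [NeZero N'] (k r a : ℕ) (hr : 0 < r) (hrk : r < k) (ha : 0 < a) (ha2 : a ≤ 2)
    (hk : k + 1 = 2 * r + a) (h ν T ε κ : ℝ) (h1 : 1 ≤ ν) (hν : ν ^ a = h) (hT : 0 < T)
    (hhT : h ^ (k + 2) = T ^ 2) (hN : (N : ℝ) ≤ 2 * h) (hN' : (N' : ℝ) ≤ 2 * ν)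
    (hNl : h ≤ N) (hNl' : ν ≤ N') (hκ : 0 < κ)
    (hV : 0 < n) (hM₀ : 2 ^ (2 * k + 8) ≤ M₀) (hε : 0 < ε) (hM : 0 < M)
    (σ : List (Set (Fin n))) (hσ : σ.Nodup) (hσk : ∀ x ∈ σ, (toFin x).card = k)
    (hTG : T ≤ (simplicesOf k (edgesOf σ)).card) :
    prob (fun ω : (Fin (k + 1) → Fin M₁ → Fin M₀ → Fin n → Fin N) × (Fin M → Fin n → Fin N) ×
        (Fin M → Finset (Fin n) → Fin N') =>
      ¬ ((1 - ε) * (simplicesOf k (edgesOf σ)).card ≤ baseOutput k r h ω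
          (runDet (baseAlgorithm k r a h κ ω) (some (0, ∅, 0)) (StreamingAlgorithm.reads 2 σ)) ∧
        baseOutput k r h ω
          (runDet (baseAlgorithm k r a h κ ω) (some (0, ∅, 0)) (StreamingAlgorithm.reads 2 σ))
          ≤ (1 + ε) * (simplicesOf k (edgesOf σ)).card))
      ≤ (((k + 1) * M₁ * M₀ + M) * k + M * 2 ^ 2 ^ k : ℕ) / h * (1 + Real.log σ.length) / κ
        + (k * ((n : ℝ) ^ k * Real.exp (-(M₁ / 4)))
        + (k * (√(2 ^ (2 * k + 4) / M) * 2 ^ (k + 2)) / ε + 2 ^ (2 * k + 5) / (ε ^ 2 * M))) := by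
  have hpos : 0 < (simplicesOf k (edgesOf σ)).card := by
    have : (0 : ℝ) < (simplicesOf k (edgesOf σ)).card := hT.trans_le hTG
    exact_mod_cast this
  have p1 := prob_estimate_le (N := N) (N' := N') (M := M) (M₁ := M₁) k r a hr ha ha2 hk h ν T ε h1
    hν hT.le hhT hN hN' (by simpa using hV) hM₀ hε hM (edgesOf σ) hTG hpos
  have p2 := prob_overflow_le
    (fun ω : (Fin (k + 1) → Fin M₁ → Fin M₀ → Fin n → Fin N) × (Fin M → Fin n → Fin N) ×
        (Fin M → Finset (Fin n) → Fin N') => IsStored r a ω.1 ω.2.1 ω.2.2) σ _ κ hκ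
    (fun x hx => prob_isStored_le k r a (toFin x) (hσk x hx) h ν h1 hν hNl hNl')
    (div_nonneg (Nat.cast_nonneg _) (by have : 1 ≤ h := hν ▸ one_le_pow₀ h1
                                        linarith))
  rw [Fintype.card_fin] at p1
  refine (prob_mono fun ω hω => ?_).trans ((prob_or_le _ _).trans (add_le_add p2 p1))
  by_contra hcon
  push Not at hcon
  obtain ⟨c1, c2⟩ := hcon
  rw [baseOutput_eq k r a hr hrk hk h κ ω σ hσ c1] at hω
  rw [abs_le] at c2
  exact hω ⟨by linarith [c2.1], by linarith [c2.2]⟩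

end Correctness

/-! ### From hypergraphs to streams, and the number of streams -/

section Streams

variable {n k : ℕ}

theorem coe_toFin (x : Set (Fin n)) : (toFin x : Set (Fin n)) = x := by simp [toFin]

theorem card_toFin (x : Set (Fin n)) : (toFin x).card = x.ncard := by
  rw [← Set.ncard_coe_finset, coe_toFin]

theorem mem_edgesOf {σ : List (Set (Fin n))} {e : Finset (Fin n)} :
    e ∈ edgesOf σ ↔ (e : Set (Fin n)) ∈ σ := by
  simp only [edgesOf, List.mem_toFinset, List.mem_map]
  constructor
  · rintro ⟨x, hx, rfl⟩; rwa [coe_toFin]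
  · intro h; exact ⟨_, h, Finset.coe_injective (coe_toFin _)⟩

theorem card_edgesOf {σ : List (Set (Fin n))} (hσ : σ.Nodup) : (edgesOf σ).card = σ.length := by
  rw [edgesOf, List.toFinset_card_of_nodup (hσ.map toFin_injective), List.length_map]

theorem simplexCount_eq {H : Hypergraph (Fin n)} (hH : H.vertexSet = Set.univ)
    {σ : List (Set (Fin n))} (hσ : H.IsEdgeStream σ) :
    H.simplexCount k = (simplicesOf k (edgesOf σ)).card := by
  have : H.simplices k = (fun X : Finset (Fin n) => (X : Set (Fin n))) ''
      (simplicesOf k (edgesOf σ) : Set (Finset (Fin n))) := by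
    ext X
    simp only [Hypergraph.simplices, hH, Set.subset_univ, true_and, Set.mem_ofPred_eq, Set.mem_image,
      Finset.mem_coe]
    constructor
    · rintro ⟨h1, h2⟩
      refine ⟨toFin X, mem_simplicesOf.2 ⟨by rw [card_toFin, h1], fun e he => ?_⟩, coe_toFin X⟩
      obtain ⟨h3, h4⟩ := Finset.mem_powersetCard.1 he
      rw [mem_edgesOf, hσ.2]
      refine h2 _ ?_ (by rw [Set.ncard_coe_finset, h4])
      rw [← coe_toFin X]; exact_mod_cast h3
    · rintro ⟨Y, hY, rfl⟩
      obtain ⟨h1, h2⟩ := mem_simplicesOf.1 hY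
      refine ⟨by rw [Set.ncard_coe_finset, h1], fun e he hek => ?_⟩
      have h3 : toFin e ∈ edgesOf σ := h2 (Finset.mem_powersetCard.2
        ⟨by rw [← Finset.coe_subset, coe_toFin]; exact he, by rw [card_toFin, hek]⟩)
      rwa [mem_edgesOf, coe_toFin, hσ.2] at h3
  rw [Hypergraph.simplexCount, this, Set.ncard_image_of_injective _ Finset.coe_injective,
    Set.ncard_coe_finset]

theorem ncard_edgeSet_eq {H : Hypergraph (Fin n)} {σ : List (Set (Fin n))}
    (hσ : H.IsEdgeStream σ) : H.edgeSet.ncard = σ.length := by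
  have : H.edgeSet = (fun X : Finset (Fin n) => (X : Set (Fin n))) ''
      (edgesOf σ : Set (Finset (Fin n))) := by
    ext e
    simp only [Set.mem_image, Finset.mem_coe, mem_edgesOf]
    rw [← hσ.2]
    exact ⟨fun h => ⟨toFin e, by rwa [coe_toFin], coe_toFin e⟩, by rintro ⟨x, hx, rfl⟩; exact hx⟩
  rw [this, Set.ncard_image_of_injective _ Finset.coe_injective, Set.ncard_coe_finset,
    card_edgesOf hσ.1]

/-- Any two faces of a simplex determine it. -/
theorem card_simplicesOf_le_sq {V : Type*} [Fintype V] [DecidableEq V] (hk : 1 ≤ k)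
    (E : Finset (Finset V)) : (simplicesOf k E).card ≤ E.card ^ 2 := by
  have : simplicesOf k E ⊆ (E ×ˢ E).image fun x => x.1 ∪ x.2 := by
    intro X hX
    obtain ⟨hXc, hXE⟩ := mem_simplicesOf.1 hX
    obtain ⟨x, hx, y, hy, hxy⟩ := Finset.one_lt_card.1 (show 1 < X.card by omega)
    have hmem : ∀ z ∈ X, X.erase z ∈ E := fun z hz => hXE (Finset.mem_powersetCard.2
      ⟨Finset.erase_subset _ _, by rw [Finset.card_erase_of_mem hz]; omega⟩)
    refine Finset.mem_image.2 ⟨(X.erase x, X.erase y),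
      Finset.mem_product.2 ⟨hmem x hx, hmem y hy⟩, ?_⟩
    ext v
    simp only [Finset.mem_union, Finset.mem_erase]
    constructor
    · rintro (h | h) <;> exact h.2
    · intro hv
      by_cases hvx : v = x
      · exact Or.inr ⟨by rw [hvx]; exact hxy, hv⟩
      · exact Or.inl ⟨hvx, hv⟩
  refine (Finset.card_le_card this).trans (Finset.card_image_le.trans_eq ?_)
  rw [Finset.card_product, sq]

theorem length_le_of_card_eq {σ : List (Set (Fin n))} (hσ : σ.Nodup)
    (hk : ∀ x ∈ σ, (toFin x).card = k) : σ.length ≤ n ^ k := by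
  rw [← card_edgesOf hσ]
  have : edgesOf σ ⊆ Finset.univ.powersetCard k := fun e he => by
    simp only [edgesOf, List.mem_toFinset, List.mem_map] at he
    obtain ⟨x, hx, rfl⟩ := he
    exact Finset.mem_powersetCard_univ.2 (hk x hx)
  refine (Finset.card_le_card this).trans ?_
  rw [Finset.card_powersetCard, Finset.card_univ, Fintype.card_fin]
  exact Nat.choose_le_pow _ _

/-- Short streams over `n` vertices. -/
def streamCode (n Q : ℕ) (σ : List (Set (Fin n))) : Fin Q → Option (Set (Fin n)) :=
  fun i => σ[(i : ℕ)]?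

theorem streamCode_injOn (n Q : ℕ) :
    Set.InjOn (streamCode n Q) {σ | σ.length ≤ Q} := by
  intro σ hσ τ hτ h
  refine List.ext_getElem? fun i => ?_
  by_cases hi : i < Q
  · exact congrFun h ⟨i, hi⟩
  · rw [List.getElem?_eq_none (le_trans hσ (by omega)), List.getElem?_eq_none (le_trans hτ (by omega))]

/-- Each of the `Q` positions holds one of `2^n` sets or nothing, and `2^n + 1 ≤ 2^(n+1)`. -/
theorem log_card_streams_le (n Q : ℕ) (I : Type*) [Fintype I] (σ : I → List (Set (Fin n)))
    (hσ : Function.Injective σ) (hQ : ∀ i, (σ i).length ≤ Q) :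
    Real.log (Fintype.card I) ≤ Q * (n + 1) := by
  classical
  rcases isEmpty_or_nonempty I with hI | hI
  · simp; positivity
  have h1 : Fintype.card I ≤ Fintype.card (Fin Q → Option (Set (Fin n))) :=
    Fintype.card_le_of_injective (fun i => streamCode n Q (σ i)) fun i j hij =>
      hσ (streamCode_injOn n Q (hQ i) (hQ j) hij)
  rw [Fintype.card_fun, Fintype.card_option, Fintype.card_set, Fintype.card_fin, Fintype.card_fin]
    at h1
  have h2 : (2 ^ n + 1) ^ Q ≤ (2 ^ (n + 1)) ^ Q := by
    gcongr
    have := Nat.one_le_two_pow (n := n)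
    rw [pow_succ]; omega
  have h3 : (Fintype.card I : ℝ) ≤ (2 : ℝ) ^ (Q * (n + 1)) := by
    have := h1.trans h2
    rw [← pow_mul, mul_comm] at this
    exact_mod_cast this
  refine (Real.log_le_log (by exact_mod_cast Fintype.card_pos) h3).trans ?_
  rw [Real.log_pow]
  have := Real.log_two_lt_d9
  push_cast
  have h4 : (0 : ℝ) ≤ Q * (n + 1) := by positivity
  nlinarith

end Streams

/-! ### Choice of parameters and arithmetic of the space bound -/

section Parameters

/-- Each of the four terms of the failure probability is brought to at most `1/128`; together they
give the `1/32` that the choice of seeds requires. Here the cap carries the factor `128`. -/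
theorem overflow_term_le {K h l b : ℝ} (hK : 0 < K) (hh : 0 < h) (hl : l ≤ b) (hb : 0 ≤ b) :
    K / h * (1 + l) / (128 * K * (1 + b) / h) ≤ 1 / 128 := by
  have : K / h * (1 + l) / (128 * K * (1 + b) / h) = (1 + l) / (1 + b) / 128 := by
    have : 1 + b ≠ 0 := by positivity
    field_simp
  rw [this]
  have : (1 + l) / (1 + b) ≤ 1 := (div_le_one (by positivity)).2 (by linarith)
  linarith

theorem oracle_term_le {k n M₁ : ℕ} (hk : 0 < k) (hn : 0 < n)
    (hM : 4 * (Real.log (128 * k) + k * Real.log n) ≤ M₁) :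
    (k : ℝ) * ((n : ℝ) ^ k * Real.exp (-(M₁ / 4))) ≤ 1 / 128 := by
  have hk' : (0 : ℝ) < k := by exact_mod_cast hk
  have hn' : (0 : ℝ) < n := by exact_mod_cast hn
  have h1 : Real.exp (-(M₁ / 4)) ≤ Real.exp (-(Real.log (128 * k) + k * Real.log n)) :=
    Real.exp_le_exp.2 (by linarith)
  rw [Real.exp_neg (_ + _), Real.exp_add, Real.exp_log (by positivity), ← Real.log_pow,
    Real.exp_log (by positivity)] at h1
  calc (k : ℝ) * ((n : ℝ) ^ k * Real.exp (-(M₁ / 4)))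
      ≤ k * ((n : ℝ) ^ k * (128 * k * (n : ℝ) ^ k)⁻¹) := by gcongr
    _ = 1 / 128 := by field_simp

theorem level_term_le {ε c a d M : ℝ} (hε : 0 < ε) (hc : 0 < c) (ha : 0 < a) (hd : 0 < d)
    (hM : a * (128 * c * d) ^ 2 / ε ^ 2 ≤ M) : c * (√(a / M) * d) / ε ≤ 1 / 128 := by
  have hM0 : 0 < M := lt_of_lt_of_le (by positivity) hM
  have h1 : √(a / M) ≤ ε / (128 * c * d) := by
    rw [Real.sqrt_le_left (by positivity), div_pow, div_le_div_iff₀ hM0 (by positivity)]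
    rw [div_le_iff₀ (by positivity)] at hM
    linarith
  calc c * (√(a / M) * d) / ε ≤ c * (ε / (128 * c * d) * d) / ε := by gcongr
    _ = 1 / 128 := by field_simp

/-- The number `M` of copies dictated by the heavy levels is ample for the light part. -/
theorem light_term_le {ε c a d M : ℝ} (hε : 0 < ε) (hc : 1 ≤ c) (ha : 0 < a) (hd : 1 ≤ d)
    (hM : a * (128 * c * d) ^ 2 / ε ^ 2 ≤ M) : 2 * a / (ε ^ 2 * M) ≤ 1 / 128 := by
  have hM0 : 0 < M := lt_of_lt_of_le (by positivity) hM
  rw [div_le_div_iff₀ (by positivity) (by norm_num)]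
  rw [div_le_iff₀ (by positivity)] at hM
  have h1 : 1 ≤ c * d := one_le_mul_of_one_le_of_one_le hc hd
  have h2 : 1 ≤ (c * d) ^ 2 := one_le_pow₀ h1
  have h3 : a * (128 * c * d) ^ 2 = 16384 * (a * (c * d) ^ 2) := by ring
  have h4 : a ≤ a * (c * d) ^ 2 := le_mul_of_one_le_right ha.le h2
  nlinarith

/-- The space used by one copy of the base algorithm and its seed. -/
theorem bits_le {k c₁ c₂ L E x s M K z b : ℝ} (hk : 0 ≤ k) (hL : 1 ≤ L) (hE : 1 ≤ E) (hx : 1 ≤ x)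
    (hs₀ : 0 ≤ s) (hs : s ≤ 3 * L) (hM : M ≤ c₁ * E) (hc₁ : 0 ≤ c₁) (hc₂ : 0 ≤ c₂)
    (hK : K ≤ c₂ * (L * E))
    (hz : z ≤ s * (k + 1) + 5)
    (hb : b ≤ 256 * K * (1 + k * L) * x * (k * (2 * s + 2) + 2) + 2 * (s * k + 2)
      + 2 * (s * (2 * k + 1) + M + 2) + 5) :
    2 * z + b + 2 ≤ (256 * c₂ * (1 + k) * (8 * k + 2) + 24 * k + 2 * c₁ + 37) * (E * L ^ 3 * x) := by
  set P := E * L ^ 3 * x with hP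
  have hL3 : L ≤ L ^ 3 := le_self_pow₀ hL (by norm_num)
  have hLP : L ≤ P := by
    calc L ≤ L ^ 3 := hL3
      _ = 1 * L ^ 3 * 1 := by ring
      _ ≤ P := by rw [hP]; gcongr
  have hEP : E ≤ P := by
    calc E = E * 1 * 1 := by ring
      _ ≤ P := by rw [hP]; gcongr; linarith
  have h1P : 1 ≤ P := hL.trans hLP
  -- The three logarithms come from `K` (the majority votes of the oracle), from `1 + k * L` (the
  -- cap) and from `s` (the bits of a vertex).
  have hmain : 256 * K * (1 + k * L) * x * (k * (2 * s + 2) + 2)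
      ≤ 256 * c₂ * (1 + k) * (8 * k + 2) * P := by
    have h1 : 1 + k * L ≤ (1 + k) * L := by nlinarith
    have h2 : k * (2 * s + 2) + 2 ≤ (8 * k + 2) * L := by
      have : k * (2 * s + 2) ≤ k * (8 * L) := by gcongr; linarith
      linarith
    calc 256 * K * (1 + k * L) * x * (k * (2 * s + 2) + 2)
        ≤ 256 * (c₂ * (L * E)) * ((1 + k) * L) * x * ((8 * k + 2) * L) := by gcongr
      _ = 256 * c₂ * (1 + k) * (8 * k + 2) * P := by rw [hP]; ring
  have hsP : s ≤ 3 * P := hs.trans (by linarith)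
  have hskP : s * k ≤ 3 * P * k := by gcongr
  have hMP : M ≤ c₁ * P := hM.trans (by gcongr)
  nlinarith

theorem size_le_three_mul_log {n : ℕ} (hn : 3 ≤ n) : (n.size : ℝ) ≤ 3 * Real.log n := by
  have h1 : 2 ^ (n.size - 1) ≤ n := Nat.lt_size.1 (by
    have : 0 < n.size := Nat.size_pos.2 (by omega)
    omega)
  have h2 : ((n.size - 1 : ℕ) : ℝ) * Real.log 2 ≤ Real.log n := by
    rw [← Real.log_pow]
    exact Real.log_le_log (by positivity) (by exact_mod_cast h1)
  have h3 : (n.size : ℝ) ≤ ((n.size - 1 : ℕ) : ℝ) + 1 := by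
    exact_mod_cast (by omega : n.size ≤ n.size - 1 + 1)
  have h4 := Real.log_two_gt_d9
  have h5 : Real.log 3 ≤ Real.log n := Real.log_le_log (by norm_num) (by exact_mod_cast hn)
  have h6 : 1 ≤ Real.log 3 := by
    rw [Real.le_log_iff_exp_le (by norm_num)]
    linarith [Real.exp_one_lt_d9]
  have h7 : (0 : ℝ) ≤ ((n.size - 1 : ℕ) : ℝ) := Nat.cast_nonneg _
  nlinarith

theorem one_le_log {n : ℕ} (hn : 3 ≤ n) : 1 ≤ Real.log n := by
  rw [Real.le_log_iff_exp_le (by positivity)]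
  have : (3 : ℝ) ≤ n := by exact_mod_cast hn
  linarith [Real.exp_one_lt_d9]

theorem size_seeds_le (n k : ℕ) :
    (16 * (n ^ k * (n + 1)) + 1).size ≤ n.size * (k + 1) + 5 := by
  rw [Nat.size_le]
  have h0 : n < 2 ^ n.size := Nat.lt_size_self n
  have h1 : n ^ k ≤ (2 ^ n.size) ^ k := by gcongr
  have h2 : n ^ k * (n + 1) ≤ (2 ^ n.size) ^ k * 2 ^ n.size := Nat.mul_le_mul h1 h0
  have h3 : 2 ^ (n.size * (k + 1) + 5) = 32 * ((2 ^ n.size) ^ k * 2 ^ n.size) := by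
    rw [pow_add, pow_mul, pow_succ]; ring
  have h4 : 0 < (2 ^ n.size) ^ k * 2 ^ n.size := by positivity
  omega

theorem two_mul_lt_two_pow {n k m : ℕ} (hm : m ≤ n ^ k) : 2 * m < 2 ^ (n.size * k + 2) := by
  have h0 : n < 2 ^ n.size := Nat.lt_size_self n
  have h1 : n ^ k ≤ (2 ^ n.size) ^ k := by gcongr
  have h2 : 2 ^ (n.size * k + 2) = 4 * (2 ^ n.size) ^ k := by rw [pow_add, pow_mul]; ring
  have h3 : 0 < (2 ^ n.size) ^ k := by positivity
  omega

/-- Bounding `M` by `2^M` spends `M` bits on the counter, which is harmless as `M = O(ε⁻²)` fits the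
budget. -/
theorem counter_lt_two_pow {n k m M : ℕ} (hm : m ≤ n ^ k) :
    2 * m * (M * n ^ (k + 1)) < 2 ^ (n.size * (2 * k + 1) + M + 2) := by
  have h0 : n < 2 ^ n.size := Nat.lt_size_self n
  have h1 : M < 2 ^ M := Nat.lt_two_pow_self
  calc 2 * m * (M * n ^ (k + 1)) ≤ 2 * n ^ k * (2 ^ M * n ^ (k + 1)) := by gcongr
    _ ≤ 2 * (2 ^ n.size) ^ k * (2 ^ M * (2 ^ n.size) ^ (k + 1)) := by gcongr
    _ = 2 ^ (n.size * (2 * k + 1) + M + 1) := by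
        rw [← pow_mul, ← pow_mul]
        ring_nf
    _ < 2 ^ (n.size * (2 * k + 1) + M + 2) := Nat.pow_lt_pow_right (by norm_num) (by omega)

/-- The number of copies of which the median is taken. -/
theorem repetitions {δ : ℝ} (hδ : 0 < δ) (hδ1 : δ < 1) :
    Real.exp (-((⌈4 * Real.log (2 / δ)⌉₊ : ℝ) / 4)) ≤ δ ∧
      (⌈4 * Real.log (2 / δ)⌉₊ : ℝ) ≤ 6 * Real.log (2 / δ) ∧ 1 ≤ 2 * Real.log (2 / δ) := by
  have h1 : Real.log 2 ≤ Real.log (2 / δ) := by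
    refine Real.log_le_log (by norm_num) ?_
    rw [le_div_iff₀ hδ]; linarith
  have h2 := Real.log_two_gt_d9
  refine ⟨?_, ?_, by linarith⟩
  · calc Real.exp (-((⌈4 * Real.log (2 / δ)⌉₊ : ℝ) / 4)) ≤ Real.exp (-Real.log (2 / δ)) :=
          Real.exp_le_exp.2 (by linarith [Nat.le_ceil (4 * Real.log (2 / δ))])
      _ = δ / 2 := by rw [Real.exp_neg, Real.exp_log (by positivity), inv_div]
      _ ≤ δ := by linarith
  · have := (Nat.ceil_lt_add_one (by linarith : 0 ≤ 4 * Real.log (2 / δ))).le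
    linarith

end Parameters

/-! ### Assembly of the estimator -/

section Assembly

variable {n N N' M M₀ M₁ : ℕ} [NeZero N] [NeZero N']

theorem exists_estimator (k r a : ℕ) (hr : 0 < r) (hrk : r < k) (ha : 0 < a) (ha2 : a ≤ 2)
    (hk : k + 1 = 2 * r + a) (h ν T ε κ δ : ℝ) (h1 : 1 ≤ ν) (hν : ν ^ a = h) (hT : 0 < T)
    (hhT : h ^ (k + 2) = T ^ 2) (hN : (N : ℝ) ≤ 2 * h) (hN' : (N' : ℝ) ≤ 2 * ν)
    (hNl : h ≤ N) (hNl' : ν ≤ N') (hκ : 0 < κ)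
    (hV : 0 < n) (hM₀ : 2 ^ (2 * k + 8) ≤ M₀) (hε : 0 < ε) (hM : 0 < M) (hδ : 0 < δ) (hδ1 : δ < 1)
    (hfail : ∀ m : ℕ, m ≤ n ^ k →
      (((k + 1) * M₁ * M₀ + M) * k + M * 2 ^ 2 ^ k : ℕ) / h * (1 + Real.log m) / κ
        + (k * ((n : ℝ) ^ k * Real.exp (-(M₁ / 4)))
        + (k * (√(2 ^ (2 * k + 4) / M) * 2 ^ (k + 2)) / ε + 2 ^ (2 * k + 5) / (ε ^ 2 * M)))
        ≤ 1 / 32) :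
    ∃ A : StreamingAlgorithm (Set (Fin n)) 2, ∀ σ : List (Set (Fin n)), σ.Nodup →
      (∀ x ∈ σ, (toFin x).card = k) → T ≤ (simplicesOf k (edgesOf σ)).card →
      A.IsEstimate σ ε δ (simplicesOf k (edgesOf σ)).card ∧
      A.RunsInSpace σ ((⌈4 * Real.log (2 / δ)⌉₊ * (2 * (16 * (n ^ k * (n + 1)) + 1).size
        + (⌊κ * (2 * σ.length : ℕ)⌋₊ * (k * (2 * n.size + 2) + 2) + 2 * (n.size * k + 2)
          + 2 * (n.size * (2 * k + 1) + M + 2) + 5) + 2) + 1 : ℕ) : ℝ) := by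
  -- The seeds must serve all admissible streams, of every length, simultaneously. These form a
  -- finite type whose logarithmic size is at most `n^k (n+1)`.
  let I := {σ : List (Set (Fin n)) // σ.Nodup ∧ (∀ x ∈ σ, (toFin x).card = k) ∧
    T ≤ (simplicesOf k (edgesOf σ)).card}
  have hlen : ∀ i : I, i.1.length ≤ n ^ k := fun i => length_le_of_card_eq i.2.1 i.2.2.1
  have hfin : Finite I := Finite.of_injective (fun i : I => streamCode n (n ^ k) i.1)
    fun i j hij => Subtype.ext (streamCode_injOn n (n ^ k) (hlen i) (hlen j) hij)
  have : Fintype I := Fintype.ofFinite I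
  have hcard : 16 * Real.log (Fintype.card I) < ((16 * (n ^ k * (n + 1)) + 1 : ℕ) : ℝ) := by
    have := log_card_streams_le n (n ^ k) I (fun i => i.1) Subtype.val_injective hlen
    push_cast at this ⊢
    linarith
  obtain ⟨A, hA⟩ := exists_streamingAlgorithm (p := 2) (baseCode n) (some (0, ∅, 0))
    (baseAlgorithm (M := M) (M₀ := M₀) (M₁ := M₁) (N := N) (N' := N') k r a h κ)
    (baseOutput k r h) (fun i : I => i.1)
    (fun i => (1 - ε) * (simplicesOf k (edgesOf i.1)).card)
    (fun i => (1 + ε) * (simplicesOf k (edgesOf i.1)).card)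
    (fun i => ⌊κ * (2 * i.1.length : ℕ)⌋₊ * (k * (2 * n.size + 2) + 2) + 2 * (n.size * k + 2)
          + 2 * (n.size * (2 * k + 1) + M + 2) + 5)
    (fun i => (prob_baseAlgorithm_le k r a hr hrk ha ha2 hk h ν T ε κ h1 hν hT hhT hN hN' hNl hNl' hκ
      hV hM₀ hε hM i.1 i.2.1 i.2.2.1 i.2.2.2).trans (hfail _ (hlen i)))
    (fun i ω rs hrs => by
      have hrl := length_of_prefix_reads hrs
      refine length_baseCode_le n k _ _ _ _ fun s hs => ?_
      obtain ⟨b1, b2, b3, b4⟩ := baseStep_invariant (IsStored r a ω.1 ω.2.1 ω.2.2)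
        (arrivalCount k h ω.1 ω.2.1) κ hκ.le k (M * n ^ (k + 1))
        (fun D e => by simpa using arrivalCount_le k h ω.1 ω.2.1 D e) rs
        (fun x hx => i.2.2.1 _ (mem_of_prefix_reads hrs hx)) s hs
      refine ⟨lt_of_le_of_lt (b1.trans hrl) (two_mul_lt_two_pow (hlen i)), ?_, b3,
        lt_of_le_of_lt (b4.trans (Nat.mul_le_mul_right _ hrl)) (counter_lt_two_pow (hlen i))⟩
      refine Nat.le_floor (b2.trans ?_)
      have : (rs.length : ℝ) ≤ ((2 * i.1.length : ℕ) : ℝ) := by exact_mod_cast hrl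
      gcongr)
    (16 * (n ^ k * (n + 1)) + 1) ⌈4 * Real.log (2 / δ)⌉₊ hcard (Nat.succ_pos _) δ
    (repetitions hδ hδ1).1
  exact ⟨A, fun σ s1 s2 s3 => hA ⟨σ, s1, s2, s3⟩⟩

end Assembly

/-! ### The theorem -/

/-- Thresholds at least `1`, with the stream in place of the hypergraph. -/
theorem exists_space_constant (k : ℕ) (hk : 2 ≤ k) : ∃ C : ℝ, 0 ≤ C ∧
    ∀ (n : ℕ) (T ε δ : ℝ), k < n →
    1 ≤ T → 0 < ε → ε ≤ 1 → 0 < δ → δ < 1 →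
    ∃ A : StreamingAlgorithm (Set (Fin n)) 2, ∀ σ : List (Set (Fin n)), σ.Nodup →
      (∀ x ∈ σ, (toFin x).card = k) → T ≤ (simplicesOf k (edgesOf σ)).card →
      A.IsEstimate σ ε δ (simplicesOf k (edgesOf σ)).card ∧
      A.RunsInSpace σ (C * (ε⁻¹ ^ 2 * Real.log (2 / δ) * Real.log (n : ℝ) ^ 3)
        * ((σ.length : ℝ) / T ^ ((2 : ℝ) / ((k : ℝ) + 2)))) := by
  have hk1 : (1 : ℝ) ≤ k := by exact_mod_cast (by omega : 1 ≤ k)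
  -- With `M ≥ c / ε^2` the heavy levels contribute at most `1/128` to the failure probability.
  set c : ℝ := 2 ^ (2 * k + 4) * (128 * k * 2 ^ (k + 2)) ^ 2 with hc
  have hc0 : 0 < c := by positivity
  have hlog : 0 ≤ Real.log (128 * k) := Real.log_nonneg (by linarith)
  set c₀ : ℝ := 4 * Real.log (128 * k) + 4 * k + 1 with hc₀
  set c₂ : ℝ := ((k + 1) * c₀ * 2 ^ (2 * k + 8) + (c + 1)) * k + (c + 1) * 2 ^ 2 ^ k with hc₂
  have hc₀' : 0 ≤ c₀ := by positivity
  have hc₂' : 0 ≤ c₂ := by positivity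
  set c₃ : ℝ := 256 * c₂ * (1 + k) * (8 * k + 2) + 24 * k + 2 * (c + 1) + 37 with hc₃
  have hc₃' : 0 ≤ c₃ := by positivity
  refine ⟨6 * c₃ + 2, by positivity, fun n T ε δ hn hT hε hε1 hδ hδ1 => ?_⟩
  set L := Real.log n with hL
  have hL1 : 1 ≤ L := one_le_log (by omega)
  set E := ε⁻¹ ^ 2 with hE
  have hE1 : 1 ≤ E := one_le_pow₀ ((one_le_inv₀ hε).2 hε1)
  set h : ℝ := T ^ ((2 : ℝ) / ((k : ℝ) + 2)) with hh
  have hh1 : 1 ≤ h := Real.one_le_rpow hT (by positivity)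
  have hhT : h ^ (k + 2) = T ^ 2 := by
    rw [hh, ← Real.rpow_natCast, ← Real.rpow_mul (by linarith), ← Real.rpow_natCast T 2]
    congr 1
    push_cast
    field_simp
  -- `r = ⌊k/2⌋`, and `a` is `1` for even and `2` for odd `k`; `k ≥ 2` makes `r` positive.
  obtain ⟨r, a, hr, hrk, ha, ha2, hkra⟩ : ∃ r a, 0 < r ∧ r < k ∧ 0 < a ∧ a ≤ 2 ∧
      k + 1 = 2 * r + a := ⟨k / 2, k + 1 - 2 * (k / 2), by omega, by omega, by omega, by omega,
        by omega⟩
  obtain ⟨ν, hν1, hν⟩ : ∃ ν : ℝ, 1 ≤ ν ∧ ν ^ a = h :=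
    ⟨h ^ ((a : ℝ)⁻¹), Real.one_le_rpow hh1 (by positivity),
      Real.rpow_inv_natCast_pow (by linarith) ha.ne'⟩
  have hceil : ∀ x : ℝ, 1 ≤ x → (⌈x⌉₊ : ℝ) ≤ 2 * x ∧ ⌈x⌉₊ ≠ 0 := fun x hx =>
    ⟨by linarith [Nat.ceil_lt_add_one (by linarith : 0 ≤ x)],
      (Nat.ceil_pos.2 (by linarith)).ne'⟩
  have : NeZero ⌈h⌉₊ := ⟨(hceil h hh1).2⟩
  have : NeZero ⌈ν⌉₊ := ⟨(hceil ν hν1).2⟩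
  set M₁ : ℕ := ⌈4 * (Real.log (128 * k) + k * L)⌉₊ with hM₁
  set M : ℕ := ⌈c * E⌉₊ with hM
  have hM₁u : (M₁ : ℝ) ≤ c₀ * L := by
    have h1 := (Nat.ceil_lt_add_one (by positivity : 0 ≤ 4 * (Real.log (128 * k) + k * L))).le
    rw [← hM₁] at h1
    rw [hc₀]
    nlinarith
  have hMu : (M : ℝ) ≤ (c + 1) * E := by
    have h1 := (Nat.ceil_lt_add_one (by positivity : 0 ≤ c * E)).le
    rw [← hM] at h1
    linarith
  have hMpos : 0 < M := Nat.ceil_pos.2 (by positivity)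
  have hMl : (2 : ℝ) ^ (2 * k + 4) * (128 * k * 2 ^ (k + 2)) ^ 2 / ε ^ 2 ≤ M := by
    have h1 : c / ε ^ 2 = c * E := by rw [hE, inv_pow, div_eq_mul_inv]
    rw [← hc, h1]
    exact Nat.le_ceil _
  set K : ℕ := ((k + 1) * M₁ * 2 ^ (2 * k + 8) + M) * k + M * 2 ^ 2 ^ k with hKdef
  have hKpos : (0 : ℝ) < K := by
    have : 0 < M * 2 ^ 2 ^ k := by positivity
    exact_mod_cast (by omega : 0 < K)
  have hKu : (K : ℝ) ≤ c₂ * (L * E) := by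
    have e1 : (M₁ : ℝ) ≤ c₀ * (L * E) := hM₁u.trans (by
      gcongr; exact le_mul_of_one_le_right (by linarith) hE1)
    have e2 : (M : ℝ) ≤ (c + 1) * (L * E) := hMu.trans (by
      gcongr; exact le_mul_of_one_le_left (by linarith) hL1)
    rw [hKdef]
    push_cast
    calc (((k : ℝ) + 1) * M₁ * 2 ^ (2 * k + 8) + M) * k + M * 2 ^ 2 ^ k
        ≤ (((k : ℝ) + 1) * (c₀ * (L * E)) * 2 ^ (2 * k + 8) + (c + 1) * (L * E)) * k
          + (c + 1) * (L * E) * 2 ^ 2 ^ k := by gcongr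
      _ = c₂ * (L * E) := by rw [hc₂]; ring
  set κ : ℝ := 128 * K * (1 + k * L) / h with hκ
  have hκ0 : 0 < κ := by positivity
  have hlogm : ∀ m : ℕ, m ≤ n ^ k → Real.log m ≤ k * L := fun m hm => by
    rcases Nat.eq_zero_or_pos m with rfl | hm0
    · simp; positivity
    · rw [hL, ← Real.log_pow]
      exact Real.log_le_log (by exact_mod_cast hm0) (by exact_mod_cast hm)
  obtain ⟨A, hA⟩ := exists_estimator (n := n) (N := ⌈h⌉₊) (N' := ⌈ν⌉₊) (M := M)
    (M₀ := 2 ^ (2 * k + 8)) (M₁ := M₁) k r a hr hrk ha ha2 hkra h ν T ε κ δ hν1 hν (by linarith) hhT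
    (hceil h hh1).1 (hceil ν hν1).1 (Nat.le_ceil _) (Nat.le_ceil _) hκ0 (by omega) le_rfl hε hMpos
    hδ hδ1 fun m hm => by
      have f1 := overflow_term_le hKpos (by linarith : 0 < h) (hlogm m hm) (by positivity)
      have f2 := oracle_term_le (k := k) (n := n) (M₁ := M₁) (by omega) (by omega) (Nat.le_ceil _)
      have f3 := level_term_le hε (by linarith : (0 : ℝ) < k) (by positivity) (by positivity) hMl
      have f4 := light_term_le hε hk1 (by positivity) (one_le_pow₀ (by norm_num)) hMl
      have e4 : (2 : ℝ) * 2 ^ (2 * k + 4) = 2 ^ (2 * k + 5) := by rw [← pow_succ']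
      rw [e4] at f4
      rw [← hκ] at f1
      linarith
  refine ⟨A, fun σ s1 s2 s3 => ⟨(hA σ s1 s2 s3).1, fun rs hrs s hs =>
    ((hA σ s1 s2 s3).2 rs hrs s hs).trans ?_⟩⟩
  set m := σ.length with hm
  -- Two faces determine a simplex, so `T ≤ m^2` and `h^(k+2) = T^2 ≤ m^4 ≤ m^(k+2)`, where `k ≥ 2`
  -- enters. Hence `m / h ≥ 1`, which absorbs the additive terms of the space bound.
  have hhm : h ≤ m := by
    have q1 : T ≤ (m : ℝ) ^ 2 := by
      have := card_simplicesOf_le_sq (k := k) (by omega) (edgesOf σ)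
      rw [card_edgesOf s1] at this
      exact s3.trans (by exact_mod_cast this)
    have q2 : (1 : ℝ) ≤ m := by
      by_contra hcon
      have : m = 0 := by
        have : (m : ℝ) < 1 := not_le.1 hcon
        exact Nat.lt_one_iff.1 (by exact_mod_cast this)
      rw [this] at q1
      norm_num at q1
      linarith
    refine le_of_pow_le_pow_left₀ (n := k + 2) (by omega) (by positivity) ?_
    rw [hhT]
    calc T ^ 2 ≤ ((m : ℝ) ^ 2) ^ 2 := by gcongr
      _ = (m : ℝ) ^ 4 := by ring
      _ ≤ (m : ℝ) ^ (k + 2) := pow_le_pow_right₀ q2 (by omega)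
  set x : ℝ := m / h with hx
  have hx1 : 1 ≤ x := (one_le_div (by linarith)).2 hhm
  have hfl : (⌊κ * (2 * m : ℕ)⌋₊ : ℝ) ≤ 256 * K * (1 + k * L) * x := by
    refine (Nat.floor_le (by positivity)).trans_eq ?_
    rw [hκ, hx]; push_cast; ring
  obtain ⟨-, hR, hΛ⟩ := repetitions hδ hδ1
  set Λ := Real.log (2 / δ) with hΛdef
  have hbits := bits_le (k := k) (c₁ := c + 1) (c₂ := c₂) (L := L) (E := E) (x := x)
    (s := n.size) (M := M) (K := K) (z := ((16 * (n ^ k * (n + 1)) + 1).size : ℕ))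
    (b := ((⌊κ * (2 * m : ℕ)⌋₊ * (k * (2 * n.size + 2) + 2) + 2 * (n.size * k + 2)
          + 2 * (n.size * (2 * k + 1) + M + 2) + 5 : ℕ) : ℝ)) (by positivity) hL1 hE1 hx1
    (by positivity) (size_le_three_mul_log (by omega)) hMu (by positivity) hc₂' hKu
    (by exact_mod_cast size_seeds_le n k)
    (by push_cast at hfl ⊢; gcongr)
  rw [← hc₃] at hbits
  have hP1 : 1 ≤ E * L ^ 3 * x := one_le_mul_of_one_le_of_one_le
    (one_le_mul_of_one_le_of_one_le hE1 (one_le_pow₀ hL1)) hx1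
  rw [Nat.cast_add, Nat.cast_mul, Nat.cast_add, Nat.cast_add, Nat.cast_mul, Nat.cast_one,
    Nat.cast_ofNat]
  calc _ ≤ 6 * Λ * (c₃ * (E * L ^ 3 * x)) + 2 * Λ * (E * L ^ 3 * x) := by
        gcongr
        · linarith
        · exact one_le_mul_of_one_le_of_one_le hΛ hP1
    _ = (6 * c₃ + 2) * (E * Λ * L ^ 3) * x := by ring

theorem mainTheorem11 (k : ℕ) (hk : 2 ≤ k) :
    ∃ (C : ℝ) (c : ℕ), ∀ (n : ℕ) (T ε δ : ℝ),
      0 < T → 0 < ε → ε ≤ 1 → 0 < δ → δ < 1 →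
      ∃ A : StreamingAlgorithm (Set (Fin n)) 2,
        ∀ H : Hypergraph (Fin n), H.vertexSet = Set.univ → H.IsKUniform k →
          T ≤ (H.simplexCount k : ℝ) →
          ∀ σ : List (Set (Fin n)), H.IsEdgeStream σ →
            A.IsEstimate σ ε δ (H.simplexCount k : ℝ) ∧
            A.RunsInSpace σ
              (C * (ε⁻¹ ^ 2 * Real.log (2 / δ) * Real.log (n : ℝ) ^ c)
                * ((H.edgeSet.ncard : ℝ) / T ^ ((2 : ℝ) / ((k : ℝ) + 2)))) := by
  obtain ⟨C, hC0, hC⟩ := exists_space_constant k hk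
  refine ⟨C, 3, fun n T ε δ hT hε hε1 hδ hδ1 => ?_⟩
  rcases Nat.lt_or_ge k n with hn | hn
  -- The number of simplices is an integer, so a positive threshold may be raised to at least `1`;
  -- this only strengthens the space bound.
  · obtain ⟨A, hA⟩ := hC n (max T 1) ε δ hn (le_max_right _ _) hε hε1 hδ hδ1
    refine ⟨A, fun H hH hHk hTH σ hσ => ?_⟩
    rw [simplexCount_eq hH hσ] at hTH ⊢
    have h1 : max T 1 ≤ (simplicesOf k (edgesOf σ)).card := by
      refine max_le hTH ?_
      have : (0 : ℝ) < (simplicesOf k (edgesOf σ)).card := hT.trans_le hTH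
      exact_mod_cast this
    obtain ⟨a1, a2⟩ := hA σ hσ.1
      (fun x hx => by rw [card_toFin]; exact hHk x ((hσ.2 x).1 hx)) h1
    refine ⟨a1, fun rs hrs s hs => (a2 rs hrs s hs).trans ?_⟩
    rw [ncard_edgeSet_eq hσ]
    have h2 : 0 ≤ Real.log (2 / δ) := Real.log_nonneg (by rw [le_div_iff₀ hδ]; linarith)
    have h3 : 0 ≤ Real.log (n : ℝ) := Real.log_natCast_nonneg n
    gcongr
    exact le_max_left _ _
  -- With at most `k` vertices there are no simplices, the threshold is never met, and any algorithm
  -- will do.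
  · refine ⟨⟨Unit, fun _ => [], fun _ _ _ => rfl, PMF.pure (), fun _ _ _ => PMF.pure (),
      fun _ => 0⟩, fun H hH _ hTH σ hσ => ?_⟩
    exfalso
    rw [simplexCount_eq hH hσ] at hTH
    have h1 : simplicesOf k (edgesOf σ) = ∅ := Finset.eq_empty_of_forall_notMem fun X hX => by
      have h2 := (mem_simplicesOf.1 hX).1
      have h3 := Finset.card_le_univ X
      rw [Fintype.card_fin] at h3
      omega
    rw [h1, Finset.card_empty, Nat.cast_zero] at hTH
    linarith
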